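/- Let $f:\mathbb R\to[-1,0)$ be Lipschitz and $2\pi$-periodic, with $f<-\delta$ for some $\delta>0$, and let $L>0$, $C\in\mathbb R$. For $\epsilon>0$ such that $L/(2\pi\epsilon)$ is an integer put $$\Omega^\epsilon=\{x: 0<x_1<L,\ \epsilon f(x_1/\epsilon)<x_2<1\},\qquad \Omega^0=(0,L)\times(0,1),$$ $\Gamma^\epsilon=\{x_2=\epsilon f(x_1/\epsilon)\}$, $\Gamma^0=\{x_2=0\}$, $\Gamma^1=\{x_2=1\}$. Let $u^\epsilon\in H^1(\Omega^\epsilon)$ be the weak solution of $$-\Delta u^\epsilon=C\ \text{in }\Omega^\epsilon,\qquad u^\epsilon=0\ \text{on }\Gamma^\epsilon\cup\Gamma^1,\qquad u^\epsilon\ \text{$L$-periodic in }x_1 .$$ Let $\beta$ and $\gamma$ be the weak solutions, locally integrable, $2\pi$-periodic in $y_1$ and with gradient square integrable over one period, of the cell problems $$\Delta\beta=\Delta\gamma=0\ \text{ in }\{y_2>f(y_1)\},\qquad \beta=-y_2,\quad \gamma=-y_2^2\ \text{ on }\{y_2=f(y_1)\},$$ and let $\overline\beta=\frac1{2\pi}\int_0^{2\pi}\beta(y_1,0)\,dy_1$,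 $\overline\gamma=\frac1{2\pi}\int_0^{2\pi}\gamma(y_1,0)\,dy_1$. Let $u^1\in H^1(\Omega^0)$ be the weak solution of the averaged first-order (Saffman–Joseph/Robin) wall law $$-\Delta u^1=C\ \text{in }\Omega^0,\qquad u^1=\epsilon\overline\beta\,\frac{\partial u^1}{\partial x_2}\ \text{on }\Gamma^0,\qquad u^1=0\ \text{on }\Gamma^1,\qquad u^1\ \text{$L$-periodic in }x_1,$$ and let $u^2$ be the weak solution of the averaged second-order (Wentzell) wall law $$-\Delta u^2=C\ \text{in }\Omega^0,\qquad u^2=\epsilon\overline\beta\,\frac{\partial u^2}{\partial x_2}+\frac{\epsilon^2}{2}\overline\gamma\,\frac{\partial^2u^2}{\partial x_2^2}\ \text{on }\Gamma^0,\qquad u^2=0\ \text{on }\Gamma^1,\qquad u^2\ \text{$L$-periodic in }x_1,$$ that is, with $V$ the space of the $L$-periodic $v\in H^1(\Omega^0)$ with $v=0$ on $\Gamma^1$ and periodic $H^1$ trace on $\Gamma^0$, the function $u^2\in V$ with $$\frac{1}{\epsilon\overline\beta}(u^2,v)_{\Gamma^0}+(\nabla u^2,\nabla v)_{\Omega^0}-\frac{\epsilon\overline\gamma}{2\overline\beta}\Big(\frac{\partial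 u^2}{\partial x_1},\frac{\partial v}{\partial x_1}\Big)_{\Gamma^0}=(C,v)_{\Omega^0}-\frac{\epsilon\overline\gamma}{2\overline\beta}(C,v)_{\Gamma^0}\qquad\text{for all }v\in V.$$ Then there is a constant $K$, independent of $\epsilon$, such that for all such $\epsilon$ $$\|u^\epsilon-u^1\|_{L^2(\Omega^0)}\le K\epsilon^{3/2}\qquad\text{and}\qquad \|u^\epsilon-u^2\|_{L^2(\Omega^0)}\le K\epsilon^{3/2}.$$ -/

import Mathlib

open MeasureTheory Set Filter Topology
open scoped ContDiff ENNReal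

noncomputable section

namespace WallLaw

/-! ### Geometry

All domains are written unrolled in the first variable, i.e. as `x₁`-periodic subsets of the plane;
`periodCell D L` is one period of such a domain. -/

/-- The profile `f` of one boundary cell, continued `2π`-periodically: Lipschitz, with values in
`[-1, 0)` and bounded away from `0`. -/
structure IsRoughProfile (f : ℝ → ℝ) : Prop where
  lipschitz : ∃ K, LipschitzWith K f
  periodic : Function.Periodic f (2 * Real.pi)
  mem_Ico : ∀ y, f y ∈ Ico (-1 : ℝ) 0
  away : ∃ δ > 0, ∀ y, f y < -δ

/-- Height of the rough wall `Γ^ε`, the graph of `x₁ ↦ ε f(x₁/ε)`. -/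
def wall (f : ℝ → ℝ) (ε : ℝ) : ℝ → ℝ := fun s => ε * f (s / ε)

/-- The rough domain `Ω^ε` (unrolled). -/
def roughDomain (f : ℝ → ℝ) (ε : ℝ) : Set (ℝ × ℝ) := {x | wall f ε x.1 < x.2 ∧ x.2 < 1}

/-- The smooth domain `Ω⁰` (unrolled). -/
def smoothDomain : Set (ℝ × ℝ) := {x | 0 < x.2 ∧ x.2 < 1}

/-- The microscopic domain `Z⁺ ∪ Γ ∪ P` (unrolled), the region above the graph of `f`. -/
def cellDomain (f : ℝ → ℝ) : Set (ℝ × ℝ) := {y | f y.1 < y.2}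

/-- One period `0 < x₁ < L` of an unrolled domain. -/
def periodCell (D : Set (ℝ × ℝ)) (L : ℝ) : Set (ℝ × ℝ) := {x | x ∈ D ∧ x.1 ∈ Ioo 0 L}

/-! ### Periodic Sobolev spaces -/

/-- `G` is the weak gradient of `u` in the open set `D`. -/
structure IsWeakGradient (D : Set (ℝ × ℝ)) (u : ℝ × ℝ → ℝ) (G : ℝ × ℝ → ℝ × ℝ) : Prop where
  locallyIntegrableOn : LocallyIntegrableOn u D
  locallyIntegrableOn_grad : LocallyIntegrableOn G D
  integral_fst : ∀ φ : ℝ × ℝ → ℝ, ContDiff ℝ ∞ φ → HasCompactSupport φ → tsupport φ ⊆ D →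
    ∫ x in D, u x * fderiv ℝ φ x (1, 0) = -∫ x in D, (G x).1 * φ x
  integral_snd : ∀ φ : ℝ × ℝ → ℝ, ContDiff ℝ ∞ φ → HasCompactSupport φ → tsupport φ ⊆ D →
    ∫ x in D, u x * fderiv ℝ φ x (0, 1) = -∫ x in D, (G x).2 * φ x

/-- `u` is (almost everywhere) `L`-periodic in the first variable on `D`. -/
def IsPeriodicOn {E : Type*} (D : Set (ℝ × ℝ)) (L : ℝ) (u : ℝ × ℝ → E) : Prop :=
  ∀ᵐ x ∂(volume.restrict D), u (x.1 + L, x.2) = u x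

/-- `u ∈ D^{1,2}_#(D)` with weak gradient `G`: locally integrable, `L`-periodic in the first
variable, with gradient square integrable over one period. -/
structure MemD12 (D : Set (ℝ × ℝ)) (L : ℝ) (u : ℝ × ℝ → ℝ) (G : ℝ × ℝ → ℝ × ℝ) : Prop where
  isWeakGradient : IsWeakGradient D u G
  periodic : IsPeriodicOn D L u
  periodic_grad : IsPeriodicOn D L G
  memLp_grad : MemLp G 2 (volume.restrict (periodCell D L))

/-- `u ∈ H¹_#(D)` with weak gradient `G`. -/
structure MemH1 (D : Set (ℝ × ℝ)) (L : ℝ) (u : ℝ × ℝ → ℝ) (G : ℝ × ℝ → ℝ × ℝ) : Prop extends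
    MemD12 D L u G where
  memLp : MemLp u 2 (volume.restrict (periodCell D L))

/-- `g ∈ L²(0, L)` is the trace of `u` on the graph of `h`: the `L²` limit, in the sense of
averages over thin layers `0 < t < d`, of the shifted functions `s ↦ u (s, h s + σ t)`.
The side is given by `σ`: from above for `σ = 1`, from below for `σ = -1`. -/
structure HasTrace (L σ : ℝ) (h : ℝ → ℝ) (u : ℝ × ℝ → ℝ) (g : ℝ → ℝ) : Prop where
  memLp : MemLp g 2 (volume.restrict (Ioo 0 L))
  tendsto : Tendsto
    (fun d : ℝ => (ENNReal.ofReal d)⁻¹ *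
      ∫⁻ t in Ioo 0 d, ∫⁻ s in Ioo 0 L, ‖u (s, h s + σ * t) - g s‖ₑ ^ 2)
    (𝓝[>] 0) (𝓝 0)

/-- `g` is an `L`-periodic `H¹` function on the line with weak derivative `g'`. -/
structure MemH1Line (L : ℝ) (g g' : ℝ → ℝ) : Prop where
  locallyIntegrable : LocallyIntegrable g
  locallyIntegrable_deriv : LocallyIntegrable g'
  integral : ∀ φ : ℝ → ℝ, ContDiff ℝ ∞ φ → HasCompactSupport φ →
    ∫ s, g s * deriv φ s = -∫ s, g' s * φ s
  periodic : ∀ᵐ s, g (s + L) = g s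
  periodic_deriv : ∀ᵐ s, g' (s + L) = g' s
  memLp : MemLp g 2 (volume.restrict (Ioo 0 L))
  memLp_deriv : MemLp g' 2 (volume.restrict (Ioo 0 L))

/-- The Dirichlet form `(∇u, ∇v)_A`, written for the gradients. -/
def dirichletForm (A : Set (ℝ × ℝ)) (G H : ℝ × ℝ → ℝ × ℝ) : ℝ :=
  ∫ x in A, ((G x).1 * (H x).1 + (G x).2 * (H x).2)

/-! ### The rough problem -/

/-- `H¹_#(Ω^ε)` functions that vanish on `Γ^ε ∪ Γ¹`. -/
structure MemRough (f : ℝ → ℝ) (L ε : ℝ) (u : ℝ × ℝ → ℝ) (G : ℝ × ℝ → ℝ × ℝ) : Prop where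
  memH1 : MemH1 (roughDomain f ε) L u G
  trace_wall : HasTrace L 1 (wall f ε) u 0
  trace_top : HasTrace L (-1) (fun _ => 1) u 0

/-- Weak solution of `-Δu = C` in `Ω^ε`, `u = 0` on `Γ^ε ∪ Γ¹`, `u` `x₁`-periodic. -/
def IsRoughSolution (f : ℝ → ℝ) (L C ε : ℝ) (u : ℝ × ℝ → ℝ) : Prop :=
  ∃ G, MemRough f L ε u G ∧ ∀ v H, MemRough f L ε v H →
    dirichletForm (periodCell (roughDomain f ε) L) G H =
      ∫ x in periodCell (roughDomain f ε) L, C * v x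

/-! ### The cell problems -/

/-- Weak solution `β ∈ D^{1,2}` of `-Δβ = 0` in `Z⁺ ∪ Γ ∪ P`, `β(y) = b(y₂)` on `P⁰`,
`β` `2π`-periodic in `y₁`. -/
def IsCellSolution (f : ℝ → ℝ) (b : ℝ → ℝ) (β : ℝ × ℝ → ℝ) : Prop :=
  ∃ G, MemD12 (cellDomain f) (2 * Real.pi) β G ∧
    HasTrace (2 * Real.pi) 1 f β (fun s => b (f s)) ∧
    ∀ v H, MemD12 (cellDomain f) (2 * Real.pi) v H → HasTrace (2 * Real.pi) 1 f v 0 →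
      dirichletForm (periodCell (cellDomain f) (2 * Real.pi)) G H = 0

/-- `m` is the mean over one period of (the trace of) `β` on `Γ = {y₂ = 0}`. -/
def IsInterfaceMean (β : ℝ × ℝ → ℝ) (m : ℝ) : Prop :=
  ∃ η, HasTrace (2 * Real.pi) 1 (fun _ => 0) β η ∧
    m = (2 * Real.pi)⁻¹ * ∫ s in (0 : ℝ)..2 * Real.pi, η s

/-! ### The averaged wall laws -/

/-- `H¹_#(Ω⁰)` functions that vanish on `Γ¹`, with weak gradient `G` and trace `g` on `Γ⁰`. -/
structure MemSmooth (L : ℝ) (u : ℝ × ℝ → ℝ) (G : ℝ × ℝ → ℝ × ℝ) (g : ℝ → ℝ) : Prop where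
  memH1 : MemH1 smoothDomain L u G
  trace_top : HasTrace L (-1) (fun _ => 1) u 0
  trace_bot : HasTrace L 1 (fun _ => 0) u g

/-- Weak solution of the first order wall law: `-Δu = C` in `Ω⁰`, `u = ε m ∂u/∂x₂` on `Γ⁰`,
`u = 0` on `Γ¹`, `u` `x₁`-periodic, where `m` is the mean of the first cell solution. -/
def IsRobinSolution (L C ε m : ℝ) (u : ℝ × ℝ → ℝ) : Prop :=
  ∃ G g, MemSmooth L u G g ∧ ∀ v H k, MemSmooth L v H k →
    1 / (ε * m) * (∫ s in (0 : ℝ)..L, g s * k s) + dirichletForm (periodCell smoothDomain L) G H =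
      ∫ x in periodCell smoothDomain L, C * v x

/-- Weak solution in `H^{1,1}_#(Ω⁰) = {v ∈ H¹_#(Ω⁰) : v = 0 on Γ¹, v|_{Γ⁰} ∈ H¹_#(Γ⁰)}` of the
second order wall law: `-Δu = C` in `Ω⁰`, `u = ε m ∂u/∂x₂ + (ε²/2) n ∂²u/∂x₂²` on `Γ⁰`,
`u = 0` on `Γ¹`, `u` `x₁`-periodic, where `m`, `n` are the means of the two cell solutions.
On `Γ⁰` the normal derivative `∂²u/∂x₂²` is `-C - ∂²u/∂x₁²` by the equation, and the tangential
derivative is integrated by parts along `Γ⁰`. -/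
def IsWentzellSolution (L C ε m n : ℝ) (u : ℝ × ℝ → ℝ) : Prop :=
  ∃ G g g', MemSmooth L u G g ∧ MemH1Line L g g' ∧
    ∀ v H k k', MemSmooth L v H k → MemH1Line L k k' →
      1 / (ε * m) * (∫ s in (0 : ℝ)..L, g s * k s)
          + dirichletForm (periodCell smoothDomain L) G H
          - ε * (n / (2 * m)) * (∫ s in (0 : ℝ)..L, g' s * k' s) =
        (∫ x in periodCell smoothDomain L, C * v x)
          - ε * (n / (2 * m)) * (∫ s in (0 : ℝ)..L, C * k s)

end WallLaw

end

open MeasureTheory Set Filter Topology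
open scoped ContDiff ENNReal

noncomputable section

namespace WallLaw

/-! ### Directional weak derivatives -/

/-! The right-hand side is constant and the averaged wall laws have constant coefficients, so their
solutions depend on `x₂` alone: they are quadratics P_a(t) = C/2 (1 - t)(t + a) (`profile`), with a₁
= εm/(1 + εm) for the Robin law and a₂ = (εm - ε²n)/(1 + εm) for the Wentzell law, where m and n are
the interface means of β and γ. That no other solution exists is an energy identity
(`MemSmooth.ae_eq_zero`) that needs m > 0 and n ≤ 0; both signs come from a weak maximum principle
for the cell problem (`cell_nonpos`).

On the rough wall x₂ = εf, and P_{a₂} + c₁ (β(x/ε) - m) + c₂ (γ(x/ε) - n) with c₁ = C/2 (1 - a₂) ε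
and c₂ = -C/2 ε² vanishes identically there: β removes the term linear in εf, γ the quadratic one,
and the equation for a₂ removes the constants. The correctors are harmonic, so once they are cut off
near the top, this sum differs from the rough solution by an admissible test function r whose energy
is produced only where the cutoff varies (`rough_sub_profile_sq_le`).

What remains is the size of the correctors (`exists_isCorrector`): O(ε^{1/2}) in L²(Ω⁰), and the
same for their gradients above height 1/2. Exponential decay is not needed. The flux of β through
horizontal lines vanishes, so its mean stays equal to m, and the one-dimensional Poincaré inequality
makes β - m square integrable over the half strip (`cell_sub_mean_memLp`). A Caccioppoli inequality
with a cutoff of slope O(ε) then bounds the energy above height 1/(2ε) by O(ε²)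
(`cell_energy_decay`). Rescaling gives N cells of weight ε², and Nε² = Lε/(2π). Since c₁ and c₂ are
O(ε), the energy of r and the squared norms of the scaled correctors are O(ε³), which is the rate
ε^{3/2} for the Wentzell law. The rate for the Robin law follows from a₁ - a₂ = O(ε²).

The calculus of weak gradients and traces rests on one fact: a function with a weak vertical
derivative is a primitive on almost every vertical line (`exists_vertPrim_rep`). The chain rule, the
uniqueness of traces, Poincaré's inequality and Green's formula are read off on these lines. The
scaled cell solutions are harmonic at the large scale because an `L`-periodic test function can be
folded into a single cell (`CellEq.dirichletForm_comp_dil`). -/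

/-- Smooth functions with compact support in `D`. -/
structure IsTest (D : Set (ℝ × ℝ)) (φ : ℝ × ℝ → ℝ) : Prop where
  smooth : ContDiff ℝ ∞ φ
  compact : HasCompactSupport φ
  subset : tsupport φ ⊆ D

/-- `g` is the weak derivative of `u` in the direction `e` in `D`. -/
def HasWeakDeriv (D : Set (ℝ × ℝ)) (u g : ℝ × ℝ → ℝ) (e : ℝ × ℝ) : Prop :=
  ∀ φ, IsTest D φ → ∫ x in D, u x * fderiv ℝ φ x e = -∫ x in D, g x * φ x

variable {D D₁ D₂ : Set (ℝ × ℝ)} {u v g k : ℝ × ℝ → ℝ} {G H : ℝ × ℝ → ℝ × ℝ} {e : ℝ × ℝ}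

lemma locallyIntegrableOn_fst (h : LocallyIntegrableOn G D) :
    LocallyIntegrableOn (fun x => (G x).1) D := fun x hx =>
  let ⟨U, hU, h⟩ := h x hx
  ⟨U, hU, h.fst⟩

lemma locallyIntegrableOn_snd (h : LocallyIntegrableOn G D) :
    LocallyIntegrableOn (fun x => (G x).2) D := fun x hx =>
  let ⟨U, hU, h⟩ := h x hx
  ⟨U, hU, h.snd⟩

lemma locallyIntegrableOn_prodMk (hu : LocallyIntegrableOn u D) (hv : LocallyIntegrableOn v D) :
    LocallyIntegrableOn (fun x => (u x, v x)) D := fun x hx => by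
  obtain ⟨U, hU, h⟩ := hu x hx
  obtain ⟨V, hV, h'⟩ := hv x hx
  exact ⟨U ∩ V, inter_mem hU hV, (h.mono_set inter_subset_left).prodMk (h'.mono_set inter_subset_right)⟩

lemma IsWeakGradient.fst (h : IsWeakGradient D u G) :
    HasWeakDeriv D u (fun x => (G x).1) (1, 0) := fun φ hφ =>
  h.integral_fst φ hφ.smooth hφ.compact hφ.subset

lemma IsWeakGradient.snd (h : IsWeakGradient D u G) :
    HasWeakDeriv D u (fun x => (G x).2) (0, 1) := fun φ hφ =>
  h.integral_snd φ hφ.smooth hφ.compact hφ.subset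

lemma IsWeakGradient.of_hasWeakDeriv (hu : LocallyIntegrableOn u D) (hG : LocallyIntegrableOn G D)
    (h1 : HasWeakDeriv D u (fun x => (G x).1) (1, 0))
    (h2 : HasWeakDeriv D u (fun x => (G x).2) (0, 1)) : IsWeakGradient D u G :=
  ⟨hu, hG, fun φ a b c => h1 φ ⟨a, b, c⟩, fun φ a b c => h2 φ ⟨a, b, c⟩⟩

lemma integrableOn_mul_of_tsupport {ψ : ℝ × ℝ → ℝ}
    (hu : LocallyIntegrableOn u D) (hψ : Continuous ψ) (hc : HasCompactSupport ψ)
    (hs : tsupport ψ ⊆ D) : Integrable (fun x => u x * ψ x) := by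
  have h1 : IntegrableOn u (tsupport ψ) := hu.integrableOn_compact_subset hs hc
  have h2 : IntegrableOn (fun x => u x * ψ x) (tsupport ψ) :=
    h1.mul_continuousOn hψ.continuousOn hc
  refine (integrableOn_iff_integrable_of_support_subset ?_).1 h2
  intro x hx
  apply subset_tsupport ψ
  simp only [Function.mem_support] at hx ⊢
  exact fun h => hx (by simp [h])

lemma setIntegral_mul_of_tsupport {ψ : ℝ × ℝ → ℝ} (hs : tsupport ψ ⊆ D) :
    ∫ x in D, u x * ψ x = ∫ x, u x * ψ x := by
  apply setIntegral_eq_integral_of_forall_compl_eq_zero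
  intro x hx
  have : ψ x = 0 := by
    by_contra h
    exact hx (hs (subset_tsupport ψ h))
  simp [this]

lemma IsTest.continuous_fderiv {φ : ℝ × ℝ → ℝ} (h : IsTest D φ) (e : ℝ × ℝ) :
    Continuous (fun x => fderiv ℝ φ x e) :=
  (h.smooth.continuous_fderiv (by simp)).clm_apply continuous_const

lemma IsTest.tsupport_fderiv {φ : ℝ × ℝ → ℝ} (h : IsTest D φ) (e : ℝ × ℝ) :
    tsupport (fun x => fderiv ℝ φ x e) ⊆ D :=
  (tsupport_fderiv_apply_subset ℝ e).trans h.subset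

lemma IsTest.compact_fderiv {φ : ℝ × ℝ → ℝ} (h : IsTest D φ) (e : ℝ × ℝ) :
    HasCompactSupport (fun x => fderiv ℝ φ x e) :=
  h.compact.of_isClosed_subset (isClosed_tsupport _) (tsupport_fderiv_apply_subset ℝ e)

lemma IsTest.integrable_mul {φ : ℝ × ℝ → ℝ} (h : IsTest D φ) (hu : LocallyIntegrableOn u D) :
    Integrable (fun x => u x * φ x) :=
  integrableOn_mul_of_tsupport hu h.smooth.continuous h.compact h.subset

lemma IsTest.integrable_mul_fderiv {φ : ℝ × ℝ → ℝ} (h : IsTest D φ) (e : ℝ × ℝ)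
    (hu : LocallyIntegrableOn u D) : Integrable (fun x => u x * fderiv ℝ φ x e) :=
  integrableOn_mul_of_tsupport hu (h.continuous_fderiv e) (h.compact_fderiv e) (h.tsupport_fderiv e)

lemma IsTest.mono {φ : ℝ × ℝ → ℝ} (h : IsTest D₁ φ) (hD : D₁ ⊆ D₂) : IsTest D₂ φ :=
  ⟨h.smooth, h.compact, h.subset.trans hD⟩

/-- Test functions vanish off `D`, so the integrals may run over the whole plane; in this form,
passing to a smaller domain is immediate. -/
lemma hasWeakDeriv_iff : HasWeakDeriv D u g e ↔
    ∀ φ, IsTest D φ → ∫ x, u x * fderiv ℝ φ x e = -∫ x, g x * φ x := by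
  refine forall₂_congr fun φ hφ => ?_
  rw [setIntegral_mul_of_tsupport (hφ.tsupport_fderiv e), setIntegral_mul_of_tsupport hφ.subset]

lemma HasWeakDeriv.mono (h : HasWeakDeriv D₂ u g e) (hD : D₁ ⊆ D₂) : HasWeakDeriv D₁ u g e := by
  rw [hasWeakDeriv_iff] at h ⊢
  exact fun φ hφ => h φ (hφ.mono hD)

lemma HasWeakDeriv.add (h : HasWeakDeriv D u g e) (h' : HasWeakDeriv D v k e)
    (hu : LocallyIntegrableOn u D) (hv : LocallyIntegrableOn v D)
    (hg : LocallyIntegrableOn g D) (hk : LocallyIntegrableOn k D) :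
    HasWeakDeriv D (fun x => u x + v x) (fun x => g x + k x) e := by
  rw [hasWeakDeriv_iff] at h h' ⊢
  intro φ hφ
  simp only [add_mul]
  rw [integral_add (hφ.integrable_mul_fderiv e hu) (hφ.integrable_mul_fderiv e hv),
    integral_add (hφ.integrable_mul hg) (hφ.integrable_mul hk), h φ hφ, h' φ hφ]
  ring

lemma HasWeakDeriv.const_mul (c : ℝ) (h : HasWeakDeriv D u g e) :
    HasWeakDeriv D (fun x => c * u x) (fun x => c * g x) e := by
  rw [hasWeakDeriv_iff] at h ⊢
  intro φ hφ
  simp only [mul_assoc]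
  rw [integral_const_mul, integral_const_mul, h φ hφ]
  ring

lemma hasWeakDeriv_of_contDiff {θ : ℝ × ℝ → ℝ} (hθ : ContDiff ℝ ∞ θ) (e : ℝ × ℝ) :
    HasWeakDeriv D θ (fun x => fderiv ℝ θ x e) e := by
  rw [hasWeakDeriv_iff]
  intro φ hφ
  have hθ' : Continuous (fun x => fderiv ℝ θ x e) :=
    (hθ.continuous_fderiv (by simp)).clm_apply continuous_const
  exact integral_mul_fderiv_eq_neg_fderiv_mul_of_integrable
    (hφ.integrable_mul (hθ'.locallyIntegrable.locallyIntegrableOn D))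
    (hφ.integrable_mul_fderiv e (hθ.continuous.locallyIntegrable.locallyIntegrableOn D))
    (hφ.integrable_mul (hθ.continuous.locallyIntegrable.locallyIntegrableOn D))
    (fun x _ => hθ.differentiable (by simp) x) (fun x _ => hφ.smooth.differentiable (by simp) x)

/-- The product rule with a smooth cutoff, which may extend the function by zero to a larger
domain. -/
lemma HasWeakDeriv.cutoff_mul {χ : ℝ × ℝ → ℝ} (hχ : ContDiff ℝ ∞ χ)
    (hs : tsupport χ ∩ D₂ ⊆ D₁) (hu : LocallyIntegrableOn u D₁) (hg : LocallyIntegrableOn g D₁)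
    (h : HasWeakDeriv D₁ u g e) :
    HasWeakDeriv D₂ (fun x => χ x * u x) (fun x => χ x * g x + fderiv ℝ χ x e * u x) e := by
  rw [hasWeakDeriv_iff] at h ⊢
  intro φ hφ
  -- The support of the product lies in both supports, hence in `D₁`; this is what permits the
  -- extension by zero to `D₂`.
  have hχφ : IsTest D₁ (fun x => χ x * φ x) := by
    refine ⟨hχ.mul hφ.smooth, hφ.compact.mul_left, fun x hx => hs ⟨?_, hφ.subset ?_⟩⟩
    · exact tsupport_mul_subset_left hx
    · exact tsupport_mul_subset_right hx
  have hd : ∀ x, fderiv ℝ (fun x => χ x * φ x) x e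
      = χ x * fderiv ℝ φ x e + φ x * fderiv ℝ χ x e := fun x => by
    rw [fderiv_fun_mul (hχ.differentiable (by simp) x) (hφ.smooth.differentiable (by simp) x)]
    simp
  have i1 := hχφ.integrable_mul_fderiv e hu
  have i2 := hχφ.integrable_mul hg
  have hχ' : Continuous (fun x => fderiv ℝ χ x e) :=
    (hχ.continuous_fderiv (by simp)).clm_apply continuous_const
  have i3 : Integrable (fun x => u x * (φ x * fderiv ℝ χ x e)) := by
    refine integrableOn_mul_of_tsupport hu (hφ.smooth.continuous.mul hχ') hφ.compact.mul_right ?_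
    intro x hx
    exact hs ⟨tsupport_fderiv_apply_subset ℝ e (tsupport_mul_subset_right hx),
      hφ.subset (tsupport_mul_subset_left hx)⟩
  have key := h _ hχφ
  calc ∫ x, χ x * u x * fderiv ℝ φ x e
      = ∫ x, (u x * fderiv ℝ (fun x => χ x * φ x) x e - u x * (φ x * fderiv ℝ χ x e)) := by
        congr 1; ext x; rw [hd]; ring
    _ = -∫ x, (g x * (χ x * φ x) + u x * (φ x * fderiv ℝ χ x e)) := by
        rw [integral_sub i1 i3, key, integral_add i2 i3]; ring
    _ = _ := by congr 2; ext x; ring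

lemma locallyIntegrableOn_cutoff_mul {χ : ℝ × ℝ → ℝ} (hχ : Continuous χ) (hD₁ : IsOpen D₁)
    (hs : tsupport χ ∩ D₂ ⊆ D₁) (hu : LocallyIntegrableOn u D₁) :
    LocallyIntegrableOn (fun x => χ x * u x) D₂ := by
  intro x hx
  by_cases hxχ : x ∈ tsupport χ
  · have h1 : LocallyIntegrableOn (fun x => χ x * u x) D₁ :=
      hu.continuousOn_mul hχ.continuousOn hD₁.isLocallyClosed
    obtain ⟨U, hU, h⟩ := h1 x (hs ⟨hxχ, hx⟩)
    rw [hD₁.nhdsWithin_eq (hs ⟨hxχ, hx⟩)] at hU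
    exact ⟨U, mem_nhdsWithin_of_mem_nhds hU, h⟩
  · refine ⟨(tsupport χ)ᶜ, mem_nhdsWithin_of_mem_nhds
      ((isClosed_tsupport χ).isOpen_compl.mem_nhds hxχ), ?_⟩
    have : EqOn (fun x => χ x * u x) (fun _ => 0) (tsupport χ)ᶜ := fun y hy => by
      simp [image_eq_zero_of_notMem_tsupport hy]
    exact (integrableOn_congr_fun this (isClosed_tsupport χ).measurableSet.compl).2
      (integrable_zero _ _ _)

/-- Pullback of weak derivatives along an invertible affine map. -/
lemma HasWeakDeriv.comp_affine (M : (ℝ × ℝ) ≃L[ℝ] (ℝ × ℝ)) (a : ℝ × ℝ) {T : ℝ × ℝ → ℝ × ℝ}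
    (hT : ∀ x, T x = M x + a) {c : ℝ≥0∞}
    (hmap : Measure.map T volume = c • volume) (h : HasWeakDeriv D u g (M e)) :
    HasWeakDeriv (T ⁻¹' D) (fun x => u (T x)) (fun x => g (T x)) e := by
  rw [hasWeakDeriv_iff] at h ⊢
  intro φ hφ
  let S : ℝ × ℝ → ℝ × ℝ := fun x => M.symm (x - a)
  have hST : ∀ x, S (T x) = x := fun x => by simp [S, hT]
  have hTS : ∀ x, T (S x) = x := fun x => by simp [S, hT]
  have hTc : Continuous T := by
    have : T = fun x => M x + a := funext hT
    rw [this]; fun_prop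
  have hSc : Continuous S := by fun_prop
  let Th : (ℝ × ℝ) ≃ₜ (ℝ × ℝ) := ⟨⟨T, S, hST, hTS⟩, hTc, hSc⟩
  have hme : MeasurableEmbedding T := Th.measurableEmbedding
  have hSd : ContDiff ℝ ∞ S := by
    apply M.symm.contDiff.comp
    fun_prop
  have hψ : IsTest D (fun x => φ (S x)) := by
    refine ⟨hφ.smooth.comp hSd, hφ.compact.comp_homeomorph Th.symm, ?_⟩
    have : tsupport (fun x => φ (S x)) = S ⁻¹' tsupport φ :=
      tsupport_comp_eq_preimage φ Th.symm
    rw [this]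
    intro x hx
    have := hφ.subset hx
    simpa [hTS] using this
  have key := h _ hψ
  have hint : ∀ F : ℝ × ℝ → ℝ, ∫ x, F (T x) = c.toReal * ∫ x, F x := fun F => by
    rw [← hme.integral_map, hmap, integral_smul_measure, smul_eq_mul]
  have hd : ∀ x, fderiv ℝ (fun x => φ (S x)) (T x) (M e) = fderiv ℝ φ x e := fun x => by
    have h1 : HasFDerivAt S (M.symm : (ℝ × ℝ) →L[ℝ] (ℝ × ℝ)) (T x) := by
      have := (M.symm.hasFDerivAt (x := T x - a)).comp (T x) ((hasFDerivAt_id (T x)).sub_const a)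
      exact this.congr_fderiv (by ext <;> simp)
    have h2 : HasFDerivAt φ (fderiv ℝ φ x) (S (T x)) := by
      rw [hST]; exact (hφ.smooth.differentiable (by simp) x).hasFDerivAt
    have := h2.comp (T x) h1
    have h3 := this.fderiv
    have h4 : (φ ∘ S) = fun x => φ (S x) := rfl
    rw [← h4, h3]
    simp
  have e1 := hint (fun x => u x * fderiv ℝ (fun x => φ (S x)) x (M e))
  have e2 := hint (fun x => g x * φ (S x))
  simp only [hd, hST] at e1 e2
  rw [e1, e2, key]
  ring

lemma locallyIntegrableOn_comp_homeomorph {E : Type*} [NormedAddCommGroup E]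
    {w : ℝ × ℝ → E} (hD : IsOpen D) (T : (ℝ × ℝ) ≃ₜ (ℝ × ℝ)) {c : ℝ≥0∞} (hc' : c ≠ ⊤)
    (hmap : Measure.map T volume = c • volume) (h : LocallyIntegrableOn w D) :
    LocallyIntegrableOn (fun x => w (T x)) (T ⁻¹' D) := by
  rw [locallyIntegrableOn_iff (hD.preimage T.continuous).isLocallyClosed]
  intro K hK hKc
  have hKD : T '' K ⊆ D := by
    rintro _ ⟨x, hx, rfl⟩
    exact hK hx
  have h1 : IntegrableOn w (T '' K) := h.integrableOn_compact_subset hKD (hKc.image T.continuous)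
  have h2 : IntegrableOn w (T '' K) (Measure.map T volume) := by
    rw [hmap, IntegrableOn, Measure.restrict_smul]
    exact h1.smul_measure hc'
  rw [T.measurableEmbedding.integrableOn_map_iff, T.preimage_image] at h2
  exact h2

end WallLaw

namespace WallLaw

variable {D : Set (ℝ × ℝ)} {u v g k : ℝ × ℝ → ℝ} {e : ℝ × ℝ}

/-! ### One-dimensional tools -/

lemma absolutelyContinuousOnInterval_comp_lipschitz {φ F : ℝ → ℝ} {p q M : ℝ}
    (hφ : ∀ x y, |φ x - φ y| ≤ M * |x - y|) (hF : AbsolutelyContinuousOnInterval F p q) :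
    AbsolutelyContinuousOnInterval (fun x => φ (F x)) p q := by
  apply squeeze_zero (fun t => ?_) (fun t => ?_) (by simpa using Tendsto.const_mul M hF)
  · exact Finset.sum_nonneg (fun i _ => dist_nonneg)
  · rw [Finset.mul_sum]
    exact Finset.sum_le_sum fun i _ => by simpa [Real.dist_eq] using hφ _ _

/-- Integration by parts against a `C¹` function composed with a primitive. -/
lemma intervalIntegral_comp_primitive_mul_deriv {φ φ' g ψ : ℝ → ℝ} {p q m c M : ℝ}
    (hφ : ∀ x, HasDerivAt φ (φ' x) x) (hM : ∀ x, |φ' x| ≤ M)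
    (hg : IntervalIntegrable g volume p q) (hm : m ∈ uIcc p q) (hψ : ContDiff ℝ 1 ψ) :
    ∫ z in p..q, φ (c + ∫ s in m..z, g s) * deriv ψ z =
      φ (c + ∫ s in m..q, g s) * ψ q - φ (c + ∫ s in m..p, g s) * ψ p -
      ∫ z in p..q, φ' (c + ∫ s in m..z, g s) * g z * ψ z := by
  have hac0 := hg.absolutelyContinuousOnInterval_intervalIntegral hm
  have hlip : ∀ x y, |φ (c + x) - φ (c + y)| ≤ M * |x - y| := fun x y => by
    have := Convex.norm_image_sub_le_of_norm_hasDerivWithin_le (f := φ) (f' := φ') (C := M)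
      (s := univ) (x := c + y) (y := c + x) (fun x _ => (hφ x).hasDerivWithinAt)
      (fun x _ => hM x) convex_univ trivial trivial
    simpa using this
  have hac := absolutelyContinuousOnInterval_comp_lipschitz hlip hac0
  have hacψ : AbsolutelyContinuousOnInterval ψ p q :=
    hψ.contDiffOn.absolutelyContinuousOnInterval
  rw [hac.integral_mul_deriv_eq_deriv_mul hacψ]
  congr 1
  apply intervalIntegral.integral_congr_ae
  filter_upwards [hg.ae_hasDerivAt_integral] with z hz hz'
  have h1 := hz (uIoc_subset_uIcc hz') m hm
  have h2 := (hφ (c + ∫ s in m..z, g s)).comp z (h1.const_add c)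
  have h3 : deriv (fun x => φ (c + ∫ s in m..x, g s)) z = φ' (c + ∫ s in m..z, g s) * g z :=
    h2.deriv
  rw [h3]

/-- The interval spanned by `S` and the base point stays in `F` by order-connectedness, and openness
leaves room to enlarge it on both sides. A test function supported in `S` then vanishes at both
ends, so integration by parts leaves no boundary terms. -/
lemma exists_Icc_subset_of_isCompact {F S : Set ℝ} (hF : IsOpen F) (hF' : F.OrdConnected)
    (hS : IsCompact S) (hSF : S ⊆ F) {m : ℝ} (hm : m ∈ F) :
    ∃ p q, p < m ∧ m < q ∧ Icc p q ⊆ F ∧ S ⊆ Ioo p q := by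
  have hS' : IsCompact (insert m S) := hS.insert m
  have hne : (insert m S).Nonempty := insert_nonempty _ _
  have hsub : insert m S ⊆ F := insert_subset hm hSF
  obtain ⟨δ, hδ, h1⟩ := Metric.isOpen_iff.1 hF _ (hsub (hS'.sInf_mem hne))
  obtain ⟨δ', hδ', h2⟩ := Metric.isOpen_iff.1 hF _ (hsub (hS'.sSup_mem hne))
  have hlo : ∀ z ∈ insert m S, sInf (insert m S) ≤ z := fun z hz => csInf_le hS'.bddBelow hz
  have hhi : ∀ z ∈ insert m S, z ≤ sSup (insert m S) := fun z hz => le_csSup hS'.bddAbove hz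
  have hp : sInf (insert m S) - δ / 2 ∈ F := h1 (by simp [abs_of_pos hδ]; linarith)
  have hq : sSup (insert m S) + δ' / 2 ∈ F :=
    h2 (by simp [abs_of_pos hδ']; linarith)
  refine ⟨_, _, ?_, ?_, hF'.out hp hq, fun z hz => ⟨?_, ?_⟩⟩
  · have := hlo m (mem_insert _ _); linarith
  · have := hhi m (mem_insert _ _); linarith
  · have := hlo z (mem_insert_of_mem _ hz); linarith
  · have := hhi z (mem_insert_of_mem _ hz); linarith

lemma integral_comp_primitive_mul_deriv {φ φ' g ψ : ℝ → ℝ} {F : Set ℝ} {m c M : ℝ}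
    (hφ : ∀ x, HasDerivAt φ (φ' x) x) (hM : ∀ x, |φ' x| ≤ M)
    (hF : IsOpen F) (hF' : F.OrdConnected) (hm : m ∈ F) (hg : LocallyIntegrableOn g F)
    (hψ : ContDiff ℝ 1 ψ) (hψc : HasCompactSupport ψ) (hψF : tsupport ψ ⊆ F) :
    ∫ z, φ (c + ∫ s in m..z, g s) * deriv ψ z =
      -∫ z, φ' (c + ∫ s in m..z, g s) * g z * ψ z := by
  obtain ⟨p, q, hp, hq, hpq, hS⟩ := exists_Icc_subset_of_isCompact hF hF' hψc hψF hm
  have hle : p ≤ q := (hp.trans hq).le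
  have h0 : ∀ z, z ∉ Ioc p q → ψ z = 0 := fun z hz => by
    by_contra h
    exact hz (Ioo_subset_Ioc_self (hS (subset_tsupport ψ h)))
  have h0' : ∀ z, z ∉ Ioc p q → deriv ψ z = 0 := fun z hz => by
    by_contra h
    exact hz (Ioo_subset_Ioc_self (hS (tsupport_deriv_subset (subset_tsupport _ h))))
  have hψp : ψ p = 0 := h0 p (by simp)
  have hψq : ψ q = 0 := by
    by_contra h
    have := hS (subset_tsupport ψ h)
    simp at this
  have hgi : IntervalIntegrable g volume p q := by
    rw [intervalIntegrable_iff_integrableOn_Icc_of_le hle]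
    exact hg.integrableOn_compact_subset hpq isCompact_Icc
  have key := intervalIntegral_comp_primitive_mul_deriv (c := c) hφ hM hgi
    (m := m) (by rw [uIcc_of_le hle]; exact ⟨hp.le, hq.le⟩) hψ
  rw [hψp, hψq, intervalIntegral.integral_of_le hle, intervalIntegral.integral_of_le hle,
    setIntegral_eq_integral_of_forall_compl_eq_zero (fun z hz => by rw [h0' z hz, mul_zero]),
    setIntegral_eq_integral_of_forall_compl_eq_zero (fun z hz => by rw [h0 z hz, mul_zero])] at key
  rw [key]; ring

/-! ### Representation on vertical lines -/

/-- `D` contains with each point the vertical segments that join it to the heights in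
`[1/4, 3/4]`. -/
def IsVertStar (D : Set (ℝ × ℝ)) : Prop :=
  ∀ x ∈ D, ∀ s ∈ Icc (1 / 4 : ℝ) (3 / 4), ∀ z ∈ uIcc x.2 s, (x.1, z) ∈ D

lemma IsVertStar.mem_half (h : IsVertStar D) {s z : ℝ} (hs : (s, z) ∈ D) : (s, (1 / 2 : ℝ)) ∈ D :=
  h _ hs (1 / 2) (by norm_num) _ right_mem_uIcc

lemma IsVertStar.ordConnected (h : IsVertStar D) (s : ℝ) : {z | (s, z) ∈ D}.OrdConnected := by
  refine ⟨fun a ha b hb z hz => ?_⟩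
  rcases le_total z (1 / 2) with hz' | hz'
  · exact h _ ha (1 / 2) (by norm_num) z (by rw [mem_uIcc]; exact Or.inl ⟨hz.1, hz'⟩)
  · exact h _ hb (1 / 2) (by norm_num) z (by rw [mem_uIcc]; exact Or.inr ⟨hz', hz.2⟩)

/-- Fubini handles one open set at a time; a countable open cover on whose members `g` is integrable
keeps the exceptional set of fibres null. -/
lemma ae_locallyIntegrableOn_fiber (hD : IsOpen D) (hg : LocallyIntegrableOn g D) :
    ∀ᵐ s : ℝ, LocallyIntegrableOn (fun z => g (s, z)) {z | (s, z) ∈ D} := by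
  obtain ⟨T, hTc, hTo, hTs, hTi⟩ := hg.exists_countable_integrableOn
  have h1 : ∀ V ∈ T, ∀ᵐ s : ℝ, IntegrableOn (fun z => g (s, z)) {z | (s, z) ∈ V ∩ D} := by
    intro V hV
    have hm : MeasurableSet (V ∩ D) := ((hTo V hV).inter hD).measurableSet
    have h2 : Integrable (indicator (V ∩ D) g) ((volume : Measure ℝ).prod volume) :=
      (integrable_indicator_iff hm).2 (hTi V hV)
    filter_upwards [h2.prod_right_ae] with s hs
    have hm' : MeasurableSet {z | (s, z) ∈ V ∩ D} := measurable_prodMk_left hm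
    rw [← integrable_indicator_iff hm']
    exact hs
  have h3 := (ae_ball_iff hTc).2 h1
  filter_upwards [h3] with s hs z hz
  obtain ⟨V, hV, hzV⟩ := mem_iUnion₂.1 (hTs hz)
  have ho : IsOpen {z | (s, z) ∈ V ∩ D} :=
    ((hTo V hV).inter hD).preimage (by fun_prop : Continuous fun z : ℝ => (s, z))
  exact ⟨_, mem_nhdsWithin_of_mem_nhds (ho.mem_nhds ⟨hzV, hz⟩), hs V hV⟩

/-- The vertical segment that joins `x` to all heights of `[1/4, 3/4]` is compact, so it has a
rectangular neighbourhood in `D`. On such rectangles Fubini controls both primitives from height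
`1/2` and averages against a bump on `[1/4, 3/4]`. -/
lemma IsVertStar.exists_box (hD : IsOpen D) (h : IsVertStar D) {x : ℝ × ℝ} (hx : x ∈ D) :
    ∃ a b p q, x.1 ∈ Ioo a b ∧ x.2 ∈ Ioo p q ∧ p < 1 / 4 ∧ 3 / 4 < q ∧
      Icc a b ×ˢ Icc p q ⊆ D := by
  let S : Set (ℝ × ℝ) := {x.1} ×ˢ Icc (min x.2 (1 / 4)) (max x.2 (3 / 4))
  have hSc : IsCompact S := isCompact_singleton.prod isCompact_Icc
  have hSD : S ⊆ D := by
    rintro ⟨y, z⟩ ⟨hy, hz⟩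
    simp only [mem_singleton_iff] at hy
    subst hy
    simp only [mem_Icc, min_le_iff, le_max_iff] at hz
    rcases le_total z x.2 with h' | h'
    · refine h x hx (1 / 4) (by norm_num) z ?_
      rcases hz.1 with h1 | h1
      · rw [le_antisymm h' h1]; exact left_mem_uIcc
      · exact mem_uIcc.2 (Or.inr ⟨h1, h'⟩)
    · refine h x hx (3 / 4) (by norm_num) z ?_
      rcases hz.2 with h1 | h1
      · rw [le_antisymm h1 h']; exact left_mem_uIcc
      · exact mem_uIcc.2 (Or.inl ⟨h', h1⟩)
  obtain ⟨δ, hδ, hsub⟩ := hSc.exists_cthickening_subset_open hD hSD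
  have m1 := min_le_left x.2 (1 / 4)
  have m2 := min_le_right x.2 (1 / 4)
  have m3 := le_max_left x.2 (3 / 4)
  have m4 := le_max_right x.2 (3 / 4)
  refine ⟨x.1 - δ, x.1 + δ, min x.2 (1 / 4) - δ, max x.2 (3 / 4) + δ, ⟨by linarith, by linarith⟩,
    ⟨by linarith, by linarith⟩, by linarith, by linarith, ?_⟩
  rintro ⟨y, z⟩ ⟨⟨hy1, hy2⟩, ⟨hz1, hz2⟩⟩
  simp only at hy1 hy2 hz1 hz2
  apply hsub
  have hle : min x.2 (1 / 4) ≤ max x.2 (3 / 4) := m1.trans m3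
  refine Metric.mem_cthickening_of_dist_le (y, z)
    (x.1, (projIcc _ _ hle z : ℝ)) δ S ⟨rfl, (projIcc _ _ hle z).2⟩ ?_
  rw [Prod.dist_eq, max_le_iff]
  constructor
  · simp only [Real.dist_eq, abs_le]; constructor <;> linarith
  · simp only [Real.dist_eq, coe_projIcc, abs_le]
    generalize min x.2 (1 / 4) = P at *
    generalize max x.2 (3 / 4) = Q at *
    grind

/-- The primitive of `g` in the second variable that vanishes at height `1/2`. -/
def vertPrim (g : ℝ × ℝ → ℝ) (x : ℝ × ℝ) : ℝ := ∫ s in (1 / 2 : ℝ)..x.2, g (x.1, s)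

/-- The primitive is dominated by the integral of `|g|` over the whole fibre of the rectangle, which
depends on `x.1` alone and is integrable by Fubini. The remaining issue is measurability. -/
lemma integrableOn_vertPrim {a b p q : ℝ} (hp : p ≤ 1 / 2) (hq : 1 / 2 ≤ q)
    (hg : IntegrableOn g (Icc a b ×ˢ Icc p q)) :
    IntegrableOn (vertPrim g) (Icc a b ×ˢ Icc p q) := by
  set μ : Measure ℝ := volume.restrict (Icc a b)
  set ν : Measure ℝ := volume.restrict (Icc p q)
  have hμν : (volume : Measure (ℝ × ℝ)).restrict (Icc a b ×ˢ Icc p q) = μ.prod ν := by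
    rw [Measure.volume_eq_prod, Measure.prod_restrict]
  rw [IntegrableOn, hμν] at hg ⊢
  -- The signed kernel of the oriented integral from `1/2` to `x.2`: it turns the variable limits
  -- into an integral over the fixed interval, jointly measurable in all variables.
  let κ : (ℝ × ℝ) × ℝ → ℝ := fun w => indicator {w : (ℝ × ℝ) × ℝ | w.2 ≤ w.1.2} 1 w -
    indicator {w : (ℝ × ℝ) × ℝ | w.2 ≤ 1 / 2} 1 w
  have hκ : Measurable κ := by
    apply Measurable.sub
    · exact measurable_one.indicator (measurableSet_le measurable_snd (by fun_prop))
    · exact measurable_one.indicator (measurableSet_le measurable_snd (by fun_prop))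
  have hae : (fun x => ∫ s, κ (x, s) * g (x.1, s) ∂ν) =ᵐ[μ.prod ν] vertPrim g := by
    have h1 : ∀ᵐ x ∂(μ.prod ν), Integrable (fun s => g (x.1, s)) ν :=
      Measure.quasiMeasurePreserving_fst.ae hg.prod_right_ae
    have h2 : ∀ᵐ x ∂(μ.prod ν), x.2 ∈ Icc p q :=
      Measure.quasiMeasurePreserving_snd.ae (ae_restrict_mem measurableSet_Icc)
    filter_upwards [h1, h2] with x hx1 hx2
    have hi : ∀ z ∈ Icc p q, IntegrableOn (fun s => g (x.1, s)) (Icc p z) := fun z hz =>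
      IntegrableOn.mono_set hx1 (Icc_subset_Icc_right hz.2)
    have hI : ∀ z ∈ Icc p q, IntervalIntegrable (fun s => g (x.1, s)) volume p z := fun z hz =>
      (intervalIntegrable_iff_integrableOn_Icc_of_le hz.1).2 (hi z hz)
    have hs : ∀ z ∈ Icc p q, ∫ s, indicator (Iic z) (fun s => g (x.1, s)) s ∂ν
        = ∫ s in p..z, g (x.1, s) := fun z hz => by
      rw [integral_indicator measurableSet_Iic, Measure.restrict_restrict measurableSet_Iic,
        intervalIntegral.integral_of_le hz.1, ← integral_Icc_eq_integral_Ioc]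
      congr 2
      ext s; simp only [mem_inter_iff, mem_Iic, mem_Icc]; constructor
      · exact fun h => ⟨h.2.1, h.1⟩
      · exact fun h => ⟨h.2, h.1, h.2.trans hz.2⟩
    have hh : (1 / 2 : ℝ) ∈ Icc p q := ⟨hp, hq⟩
    have h3 : ∀ s, κ (x, s) * g (x.1, s) = indicator (Iic x.2) (fun s => g (x.1, s)) s -
        indicator (Iic (1 / 2)) (fun s => g (x.1, s)) s := fun s => by
      simp only [κ, indicator, mem_ofPred_eq, mem_Iic, Pi.one_apply]
      split_ifs <;> simp
    simp only [h3]
    rw [integral_sub (hx1.indicator measurableSet_Iic) (hx1.indicator measurableSet_Iic),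
      hs _ hx2, hs _ hh, vertPrim, intervalIntegral.integral_interval_sub_left (hI _ hx2) (hI _ hh)]
  have hmeas : AEStronglyMeasurable (vertPrim g) (μ.prod ν) := by
    refine AEStronglyMeasurable.congr ?_ hae
    apply AEStronglyMeasurable.integral_prod_right' (f := fun w => κ w * g (w.1.1, w.2))
    apply hκ.aestronglyMeasurable.mul
    have hq : Measure.QuasiMeasurePreserving (Prod.map Prod.fst id : (ℝ × ℝ) × ℝ → ℝ × ℝ)
        ((μ.prod ν).prod ν) (μ.prod ν) :=
      MeasureTheory.QuasiMeasurePreserving.prodMap Measure.quasiMeasurePreserving_fst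
        (Measure.QuasiMeasurePreserving.id ν)
    exact hg.aestronglyMeasurable.comp_quasiMeasurePreserving hq
  have hA : Integrable (fun x : ℝ × ℝ => ∫ s, ‖g (x.1, s)‖ ∂ν) (μ.prod ν) :=
    (hg.norm.integral_prod_left).comp_fst ν
  refine hA.mono' hmeas ?_
  have h1 : ∀ᵐ x ∂(μ.prod ν), Integrable (fun s => g (x.1, s)) ν :=
    Measure.quasiMeasurePreserving_fst.ae hg.prod_right_ae
  filter_upwards [hae, h1] with x hx hx1
  rw [← hx]
  refine (norm_integral_le_integral_norm _).trans (integral_mono_of_nonneg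
    (ae_of_all _ fun _ => norm_nonneg _) hx1.norm (ae_of_all _ fun s => ?_))
  simp only [norm_mul]
  have : ‖κ (x, s)‖ ≤ 1 := by
    simp only [κ, indicator, mem_ofPred_eq, Pi.one_apply]
    split_ifs <;> simp
  nlinarith [norm_nonneg (g (x.1, s))]

lemma locallyIntegrableOn_vertPrim (hD : IsOpen D) (hs : IsVertStar D)
    (hg : LocallyIntegrableOn g D) : LocallyIntegrableOn (vertPrim g) D := by
  intro x hx
  obtain ⟨a, b, p, q, hx1, hx2, hp, hq, hsub⟩ := hs.exists_box hD hx
  refine ⟨Icc a b ×ˢ Icc p q, mem_nhdsWithin_of_mem_nhds (prod_mem_nhds (Icc_mem_nhds hx1.1 hx1.2)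
    (Icc_mem_nhds hx2.1 hx2.2)), ?_⟩
  exact integrableOn_vertPrim (by linarith) (by linarith)
    (hg.integrableOn_compact_subset hsub (isCompact_Icc.prod isCompact_Icc))

lemma IsTest.fiber {ψ : ℝ × ℝ → ℝ} (h : IsTest D ψ) (s : ℝ) :
    ContDiff ℝ 1 (fun z => ψ (s, z)) ∧ HasCompactSupport (fun z => ψ (s, z)) ∧
      tsupport (fun z => ψ (s, z)) ⊆ {z | (s, z) ∈ D} ∧
      ∀ z, deriv (fun z => ψ (s, z)) z = fderiv ℝ ψ (s, z) (0, 1) := by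
  have hc : Continuous fun z : ℝ => (s, z) := by fun_prop
  have hts : tsupport (fun z => ψ (s, z)) ⊆ {z | (s, z) ∈ tsupport ψ} :=
    closure_minimal (fun z hz => subset_tsupport ψ hz) ((isClosed_tsupport ψ).preimage hc)
  refine ⟨(h.smooth.of_le (by simp)).comp (by fun_prop), ?_, fun z hz => h.subset (hts hz), ?_⟩
  · have : IsCompact (Prod.snd '' tsupport ψ) := IsCompact.image h.compact continuous_snd
    exact this.of_isClosed_subset (isClosed_tsupport _) fun z hz => ⟨(s, z), hts hz, rfl⟩
  · intro z
    have h1 := (h.smooth.differentiable (by simp) (s, z)).hasFDerivAt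
    have h2 : HasDerivAt (fun z : ℝ => (s, z)) ((0 : ℝ), (1 : ℝ)) z :=
      (hasDerivAt_const z s).prodMk (hasDerivAt_id z)
    exact (h1.comp_hasDerivAt z h2).deriv

lemma IsTest.eq_zero_of_notMem {ψ : ℝ × ℝ → ℝ} (h : IsTest D ψ) {x : ℝ × ℝ} (hx : x ∉ D) :
    ψ x = 0 ∧ ∀ e, fderiv ℝ ψ x e = 0 := by
  constructor
  · by_contra h'
    exact hx (h.subset (subset_tsupport ψ h'))
  · intro e
    by_contra h'
    exact hx (h.tsupport_fderiv e (subset_tsupport (fun x => fderiv ℝ ψ x e) h'))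

/-- Chain rule for functions that are primitives on vertical lines. -/
lemma hasWeakDeriv_comp_of_fiber {φ φ' : ℝ → ℝ} {c : ℝ → ℝ} {M : ℝ}
    (hφ : ∀ x, HasDerivAt φ (φ' x) x) (hM : ∀ x, |φ' x| ≤ M)
    (hD : IsOpen D) (hs : IsVertStar D) (hg : LocallyIntegrableOn g D)
    (hrep : ∀ᵐ x, x ∈ D → u x = c x.1 + vertPrim g x)
    (hu : LocallyIntegrableOn (fun x => φ (u x)) D)
    (hgu : LocallyIntegrableOn (fun x => φ' (u x) * g x) D) :
    HasWeakDeriv D (fun x => φ (u x)) (fun x => φ' (u x) * g x) (0, 1) := by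
  rw [hasWeakDeriv_iff]
  intro ψ hψ
  have i1 := hψ.integrable_mul_fderiv (0, 1) hu
  have i2 := hψ.integrable_mul hgu
  rw [Measure.volume_eq_prod] at i1 i2 hrep ⊢
  rw [integral_prod _ i1, integral_prod _ i2, ← integral_neg]
  apply integral_congr_ae
  filter_upwards [ae_locallyIntegrableOn_fiber hD hg, Measure.ae_ae_of_ae_prod hrep] with s hgs hus
  obtain ⟨f1, f2, f3, f4⟩ := hψ.fiber s
  by_cases hne : ∃ z, (s, z) ∈ D
  swap
  · push Not at hne
    simp [(hψ.eq_zero_of_notMem (hne _)).1, (hψ.eq_zero_of_notMem (hne _)).2]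
  obtain ⟨z₀, hz₀⟩ := hne
  have ho : IsOpen {z | (s, z) ∈ D} := hD.preimage (by fun_prop : Continuous fun z : ℝ => (s, z))
  have key := integral_comp_primitive_mul_deriv (c := c s) hφ hM ho (hs.ordConnected s)
    (hs.mem_half hz₀) hgs f1 f2 f3
  calc ∫ z, φ (u (s, z)) * fderiv ℝ ψ (s, z) (0, 1)
      = ∫ z, φ (c s + ∫ t in (1 / 2)..z, g (s, t)) * deriv (fun z => ψ (s, z)) z := by
        apply integral_congr_ae
        filter_upwards [hus] with z hz
        by_cases hzD : (s, z) ∈ D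
        · rw [hz hzD, f4]; rfl
        · rw [f4, (hψ.eq_zero_of_notMem hzD).2]; simp
    _ = -∫ z, φ' (u (s, z)) * g (s, z) * ψ (s, z) := by
        rw [key]
        congr 1
        apply integral_congr_ae
        filter_upwards [hus] with z hz
        by_cases hzD : (s, z) ∈ D
        · rw [hz hzD]; rfl
        · rw [(hψ.eq_zero_of_notMem hzD).1]; simp

end WallLaw

/-! ### Weakly differentiable functions are primitives on vertical lines -/

namespace WallLaw

variable {D : Set (ℝ × ℝ)} {u v g k : ℝ × ℝ → ℝ} {e : ℝ × ℝ}

/-- A smooth bump of unit mass supported in `[1/4, 3/4]`. -/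
lemma exists_unit_bump : ∃ ρ : ℝ → ℝ, ContDiff ℝ ∞ ρ ∧ HasCompactSupport ρ ∧
    tsupport ρ ⊆ Icc (1 / 4) (3 / 4) ∧ ∫ s, ρ s = 1 := by
  let b : ContDiffBump (1 / 2 : ℝ) := ⟨1 / 8, 1 / 4, by norm_num, by norm_num⟩
  refine ⟨b.normed volume, b.contDiff_normed, b.hasCompactSupport_normed, ?_, b.integral_normed⟩
  rw [b.tsupport_normed_eq, Real.closedBall_eq_Icc]
  norm_num

/-- The fibrewise chain rule with `φ = id` shows that `vertPrim g` itself has weak vertical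
derivative `g`. -/
lemma hasWeakDeriv_sub_vertPrim (hD : IsOpen D) (hs : IsVertStar D)
    (hu : LocallyIntegrableOn u D) (hg : LocallyIntegrableOn g D)
    (h : HasWeakDeriv D u g (0, 1)) :
    HasWeakDeriv D (fun x => u x - vertPrim g x) (fun _ => 0) (0, 1) := by
  have hK := locallyIntegrableOn_vertPrim hD hs hg
  have h1 : HasWeakDeriv D (vertPrim g) g (0, 1) := by
    have := hasWeakDeriv_comp_of_fiber (φ := id) (φ' := fun _ => 1) (M := 1) (c := fun _ => 0)
      (u := vertPrim g) (fun x => hasDerivAt_id x) (by simp) hD hs hg (by simp) hK (by simpa using hg)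
    simpa using this
  have h2 := h.add (h1.const_mul (-1)) hu (hK.smul (-1 : ℝ)) hg (hg.smul (-1 : ℝ))
  simpa [sub_eq_add_neg] using h2

/-- Smoothness of partial primitives. -/
lemma contDiff_setIntegral_Iic {F : ℝ × ℝ → ℝ} (hF : ContDiff ℝ ∞ F) (hc : HasCompactSupport F) :
    ContDiff ℝ ∞ (fun x : ℝ × ℝ => ∫ s in Iic x.2, F (x.1, s)) := by
  -- The partial primitive is a convolution in the second variable with the Heaviside function, the
  -- first variable being a parameter.
  let f : ℝ → ℝ := indicator (Ici 0) 1
  have hf : LocallyIntegrable f volume :=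
    (locallyIntegrable_const (1 : ℝ)).indicator measurableSet_Ici
  have hk : IsCompact (Prod.snd '' tsupport F) := IsCompact.image hc continuous_snd
  have h := contDiffOn_convolution_right_with_param (𝕜 := ℝ) (n := ⊤) (μ := (volume : Measure ℝ))
    (ContinuousLinearMap.mul ℝ ℝ) (f := f) (g := fun p s => F (p, s)) (s := univ)
    isOpen_univ hk (fun p x _ hx => by
      by_contra h'
      exact hx ⟨(p, x), subset_tsupport F h', rfl⟩) hf
    (by
      have : (↿fun p s => F (p, s)) = F := rfl
      rw [this]; exact hF.contDiffOn)
  rw [univ_prod_univ, contDiffOn_univ] at h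
  convert h using 2 with x
  rw [convolution_def]
  have h1 : ∀ t, (ContinuousLinearMap.mul ℝ ℝ) (f t) (F (x.1, x.2 - t))
      = indicator (Ici 0) (fun t => F (x.1, x.2 - t)) t := fun t => by
    simp only [f, indicator]; split_ifs <;> simp
  simp only [h1]
  have h2 : ∀ t, indicator (Ici 0) (fun t => F (x.1, x.2 - t)) t
      = (indicator (Iic x.2) (fun s => F (x.1, s))) (x.2 - t) := fun t => by
    simp only [indicator, mem_Ici, mem_Iic]
    congr 1
    simp
  simp only [h2]
  rw [integral_sub_left_eq_self (fun s => indicator (Iic x.2) (fun s => F (x.1, s)) s) volume x.2,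
    integral_indicator measurableSet_Iic]

lemma contDiff_integral_snd {F : ℝ × ℝ → ℝ} (hF : ContDiff ℝ ∞ F) (hc : HasCompactSupport F) :
    ContDiff ℝ ∞ (fun s : ℝ => ∫ z, F (s, z)) := by
  have hk : IsCompact (Prod.snd '' tsupport F) := IsCompact.image hc continuous_snd
  obtain ⟨R, hR⟩ := hk.bddAbove
  have h := (contDiff_setIntegral_Iic hF hc).comp
    (by fun_prop : ContDiff ℝ ∞ fun s : ℝ => (s, R))
  convert h using 2 with s
  rw [Function.comp_apply, setIntegral_eq_integral_of_forall_compl_eq_zero]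
  intro z hz
  by_contra h'
  exact hz (hR ⟨(s, z), subset_tsupport F h', rfl⟩)

lemma fderiv_setIntegral_Iic {F : ℝ × ℝ → ℝ} (hF : ContDiff ℝ ∞ F) (hc : HasCompactSupport F)
    (x : ℝ × ℝ) :
    fderiv ℝ (fun x : ℝ × ℝ => ∫ s in Iic x.2, F (x.1, s)) x (0, 1) = F x := by
  have hd := ((contDiff_setIntegral_Iic hF hc).differentiable (by simp) x).hasFDerivAt
  have h2 : HasDerivAt (fun z : ℝ => (x.1, z)) ((0 : ℝ), (1 : ℝ)) x.2 :=
    (hasDerivAt_const x.2 x.1).prodMk (hasDerivAt_id x.2)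
  have h3 := HasFDerivAt.comp_hasDerivAt (f := fun z : ℝ => (x.1, z)) x.2 hd h2
  have hFc : Continuous fun z => F (x.1, z) := hF.continuous.comp (by fun_prop)
  have hFs : HasCompactSupport fun z => F (x.1, z) := by
    have : IsCompact (Prod.snd '' tsupport F) := IsCompact.image hc continuous_snd
    refine this.of_isClosed_subset (isClosed_tsupport _) (closure_minimal ?_ this.isClosed)
    exact fun z hz => ⟨(x.1, z), subset_tsupport F hz, rfl⟩
  have hi : Integrable fun z => F (x.1, z) := hFc.integrable_of_hasCompactSupport hFs
  have h4 : HasDerivAt (fun z : ℝ => ∫ s in Iic z, F (x.1, s)) (F x) x.2 := by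
    have h5 : (fun z : ℝ => ∫ s in Iic z, F (x.1, s)) =
        fun z => (∫ s in Iic 0, F (x.1, s)) + ∫ s in (0 : ℝ)..z, F (x.1, s) := by
      ext z
      rw [← intervalIntegral.integral_Iic_sub_Iic hi.integrableOn hi.integrableOn]
      ring
    rw [h5]
    exact (intervalIntegral.integral_hasDerivAt_right (hFc.intervalIntegrable _ _)
      (hFc.stronglyMeasurableAtFilter _ _) hFc.continuousAt).const_add _
  exact h3.unique h4

/-- A locally integrable function with vanishing weak vertical derivative depends only on the
first variable. -/
lemma ae_eq_fst_of_hasWeakDeriv_zero (hD : IsOpen D) (hs : IsVertStar D)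
    (hu : LocallyIntegrableOn u D) (h : HasWeakDeriv D u (fun _ => 0) (0, 1)) :
    ∃ c : ℝ → ℝ, ∀ᵐ x, x ∈ D → u x = c x.1 := by
  obtain ⟨ρ, hρ, hρc, hρs, hρ1⟩ := exists_unit_bump
  have hρ0 : ∀ s, s ∉ Icc (1 / 4 : ℝ) (3 / 4) → ρ s = 0 := fun s hs' => by
    by_contra h'
    exact hs' (hρs (subset_tsupport ρ h'))
  -- The candidate is the `ρ`-weighted average on the vertical line; every line that meets `D`
  -- contains the heights `[1/4, 3/4]`, where `ρ` lives.
  let c : ℝ → ℝ := fun s => ∫ z, u (s, z) * ρ z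
  have hc : LocallyIntegrableOn (fun x : ℝ × ℝ => c x.1) D := by
    intro x hx
    obtain ⟨a, b, p, q, hx1, hx2, hp, hq, hsub⟩ := hs.exists_box hD hx
    refine ⟨Icc a b ×ˢ Icc p q, mem_nhdsWithin_of_mem_nhds (prod_mem_nhds
      (Icc_mem_nhds hx1.1 hx1.2) (Icc_mem_nhds hx2.1 hx2.2)), ?_⟩
    have h1 : IntegrableOn u (Icc a b ×ˢ Icc p q) :=
      hu.integrableOn_compact_subset hsub (isCompact_Icc.prod isCompact_Icc)
    have h2 : IntegrableOn (fun x => u x * ρ x.2) (Icc a b ×ˢ Icc p q) :=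
      h1.mul_continuousOn (hρ.continuous.comp continuous_snd).continuousOn
        (isCompact_Icc.prod isCompact_Icc)
    rw [IntegrableOn, Measure.volume_eq_prod, ← Measure.prod_restrict] at h2 ⊢
    have h3 := (h2.integral_prod_left).comp_fst (volume.restrict (Icc p q))
    refine h3.congr (ae_of_all _ fun y => ?_)
    simp only [c]
    apply setIntegral_eq_integral_of_forall_compl_eq_zero
    intro z hz
    rw [hρ0 z (fun hz' => hz ⟨by linarith [hz'.1], by linarith [hz'.2]⟩), mul_zero]
  refine ⟨c, ?_⟩
  have main := hD.ae_eq_zero_of_integral_contDiff_smul_eq_zero (μ := volume) (hu.sub hc) ?_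
  · filter_upwards [main] with x hx hxD
    have := hx hxD
    simp only [Pi.sub_apply] at this
    linarith
  intro Φ hΦ hΦc hΦs
  have hΦt : IsTest D Φ := ⟨hΦ, hΦc, hΦs⟩
  let I : ℝ → ℝ := fun s => ∫ z, Φ (s, z)
  have hI : ContDiff ℝ ∞ I := contDiff_integral_snd hΦ hΦc
  have hpr1 : IsCompact (Prod.fst '' tsupport Φ) := IsCompact.image hΦc continuous_fst
  have hI0 : ∀ s, s ∉ Prod.fst '' tsupport Φ → I s = 0 := fun s hs' => by
    have : ∀ z, Φ (s, z) = 0 := fun z => by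
      by_contra h'
      exact hs' ⟨(s, z), subset_tsupport Φ h', rfl⟩
    simp [I, this]
  -- Subtracting `ρ` times the line integral gives `F` mean zero on every vertical line, so that its
  -- vertical primitive `Ψ` has compact support and is an admissible test function with vertical
  -- derivative `F`.
  let F : ℝ × ℝ → ℝ := fun x => Φ x - ρ x.2 * I x.1
  have hF : ContDiff ℝ ∞ F :=
    hΦ.sub ((hρ.comp contDiff_snd).mul (hI.comp contDiff_fst))
  -- the vertical hull of the supports
  let Q : Set (ℝ × ℝ) :=
    (fun w : (ℝ × ℝ) × ℝ × ℝ => (w.1.1, w.1.2 + w.2.2 * (w.2.1 - w.1.2))) ''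
      (tsupport Φ ×ˢ Icc (1 / 4) (3 / 4) ×ˢ Icc 0 1)
  have hQc : IsCompact Q :=
    (IsCompact.prod hΦc (isCompact_Icc.prod isCompact_Icc)).image (by fun_prop)
  have hQD : Q ⊆ D := by
    rintro _ ⟨⟨x, s, l⟩, ⟨hx, hs', hl⟩, rfl⟩
    refine hs x (hΦs hx) s hs' _ ?_
    simp only at hl ⊢
    rw [mem_uIcc]
    rcases le_total x.2 s with h' | h'
    · left; constructor <;> nlinarith [hl.1, hl.2]
    · right; constructor <;> nlinarith [hl.1, hl.2]
  have hQmem : ∀ x ∈ tsupport Φ, ∀ s ∈ Icc (1 / 4 : ℝ) (3 / 4), ∀ z ∈ uIcc x.2 s, (x.1, z) ∈ Q := by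
    intro x hx s hs' z hz
    by_cases hxs : s = x.2
    · subst hxs
      simp only [uIcc_self, mem_singleton_iff] at hz
      exact ⟨(x, x.2, 0), ⟨hx, hs', by simp⟩, by simp [hz]⟩
    have hne : s - x.2 ≠ 0 := sub_ne_zero.2 hxs
    refine ⟨(x, s, (z - x.2) / (s - x.2)), ⟨hx, hs', ?_⟩, ?_⟩
    · rw [mem_uIcc] at hz
      rcases hz with hz | hz
      · have hp : 0 < s - x.2 := lt_of_le_of_ne (by linarith) hne.symm
        exact ⟨div_nonneg (by linarith) hp.le, (div_le_one hp).2 (by linarith)⟩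
      · have hp : s - x.2 < 0 := lt_of_le_of_ne (by linarith) hne
        exact ⟨div_nonneg_of_nonpos (by linarith) hp.le, (div_le_one_of_neg hp).2 (by linarith)⟩
    · simp only [Prod.mk.injEq, true_and]
      field_simp
      ring
  have hFQ : ∀ x, x ∉ Q → F x = 0 := by
    intro x hx
    have h1 : Φ x = 0 := by
      by_contra h'
      exact hx (hQmem x (subset_tsupport Φ h') (1 / 2) (by norm_num) _ left_mem_uIcc)
    have h2 : ρ x.2 * I x.1 = 0 := by
      by_contra h'
      have hρx : x.2 ∈ Icc (1 / 4 : ℝ) (3 / 4) := by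
        by_contra h''; exact h' (by rw [hρ0 _ h'', zero_mul])
      have hIx : x.1 ∈ Prod.fst '' tsupport Φ := by
        by_contra h''; exact h' (by rw [hI0 _ h'', mul_zero])
      obtain ⟨y, hy, hyx⟩ := hIx
      have := hQmem y hy x.2 hρx x.2 right_mem_uIcc
      rw [hyx] at this
      exact hx this
    simp [F, h1, h2]
  have hFc : HasCompactSupport F := HasCompactSupport.intro hQc hFQ
  have hΦi : ∀ s, Integrable fun z => Φ (s, z) := fun s =>
    ((hΦt.fiber s).1.continuous).integrable_of_hasCompactSupport (hΦt.fiber s).2.1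
  have hρi : Integrable ρ := hρ.continuous.integrable_of_hasCompactSupport hρc
  have hFi : ∀ s, Integrable fun z => F (s, z) := fun s => (hΦi s).sub (hρi.mul_const (I s))
  have hF1 : ∀ s, ∫ z, F (s, z) = 0 := fun s => by
    simp only [F]
    rw [integral_sub (hΦi s) (hρi.mul_const _), integral_mul_const, hρ1]
    simp [I]
  let Ψ : ℝ × ℝ → ℝ := fun x => ∫ s in Iic x.2, F (x.1, s)
  have hΨQ : ∀ x, x ∉ Q → Ψ x = 0 := by
    intro x hx
    -- the support of `F` on this line lies on one side of `x.2`
    have hside : (∀ z ≤ x.2, F (x.1, z) = 0) ∨ (∀ z, x.2 < z → F (x.1, z) = 0) := by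
      rcases le_total x.2 (1 / 2) with hh | hh
      · left
        intro z hz
        by_contra hFz
        have hzQ : (x.1, z) ∈ Q := by by_contra h'; exact hFz (hFQ _ h')
        obtain ⟨⟨y, s, l⟩, ⟨hy, hs', hl⟩, hyz⟩ := hzQ
        simp only [Prod.mk.injEq] at hyz hl
        have hy1 : y.2 ≤ x.2 ∨ s ≤ x.2 := by
          by_contra hcon
          push Not at hcon
          rcases le_total y.2 s with h1 | h1
          · linarith [mul_nonneg hl.1 (sub_nonneg.2 h1), mul_nonneg (sub_nonneg.2 hl.2) (sub_nonneg.2 h1)]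
          · linarith [mul_nonneg hl.1 (sub_nonneg.2 h1), mul_nonneg (sub_nonneg.2 hl.2) (sub_nonneg.2 h1)]
        apply hx
        rw [← Prod.mk.eta (p := x), ← hyz.1]
        rcases hy1 with hy1 | hy1
        · exact hQmem y hy (1 / 2) (by norm_num) _ (mem_uIcc.2 (Or.inl ⟨hy1, hh⟩))
        · exact hQmem y hy x.2 ⟨by linarith [hs'.1], by linarith⟩ _ right_mem_uIcc
      · right
        intro z hz
        by_contra hFz
        have hzQ : (x.1, z) ∈ Q := by by_contra h'; exact hFz (hFQ _ h')
        obtain ⟨⟨y, s, l⟩, ⟨hy, hs', hl⟩, hyz⟩ := hzQ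
        simp only [Prod.mk.injEq] at hyz hl
        have hy1 : x.2 ≤ y.2 ∨ x.2 ≤ s := by
          by_contra hcon
          push Not at hcon
          rcases le_total y.2 s with h1 | h1
          · linarith [mul_nonneg hl.1 (sub_nonneg.2 h1), mul_nonneg (sub_nonneg.2 hl.2) (sub_nonneg.2 h1)]
          · linarith [mul_nonneg hl.1 (sub_nonneg.2 h1), mul_nonneg (sub_nonneg.2 hl.2) (sub_nonneg.2 h1)]
        apply hx
        rw [← Prod.mk.eta (p := x), ← hyz.1]
        rcases hy1 with hy1 | hy1
        · exact hQmem y hy (1 / 2) (by norm_num) _ (mem_uIcc.2 (Or.inr ⟨hh, hy1⟩))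
        · exact hQmem y hy x.2 ⟨by linarith, by linarith [hs'.2]⟩ _ right_mem_uIcc
    rcases hside with h' | h'
    · exact setIntegral_eq_zero_of_forall_eq_zero fun z hz => h' z hz
    · rw [← hF1 x.1]
      exact setIntegral_eq_integral_of_forall_compl_eq_zero fun z hz => h' z (not_le.1 hz)
  have hΨt : IsTest D Ψ := by
    refine ⟨contDiff_setIntegral_Iic hF hFc, HasCompactSupport.intro hQc hΨQ, ?_⟩
    refine (closure_minimal (fun x hx => ?_) hQc.isClosed).trans hQD
    by_contra h'
    exact hx (hΨQ x h')
  have key := hasWeakDeriv_iff.1 h Ψ hΨt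
  have hder : ∀ x, fderiv ℝ Ψ x (0, 1) = Φ x - ρ x.2 * I x.1 := fun x =>
    fderiv_setIntegral_Iic hF hFc x
  have i1 := hΨt.integrable_mul_fderiv (0, 1) hu
  have i2 := hΦt.integrable_mul hu
  have i3 := hΦt.integrable_mul hc
  simp only [hder] at key i1
  have i4 : Integrable fun x => u x * (ρ x.2 * I x.1) := by
    refine (i2.sub i1).congr (ae_of_all _ fun x => ?_)
    simp only [Pi.sub_apply]; ring
  have e1 : ∫ x, u x * Φ x = ∫ x, u x * (ρ x.2 * I x.1) := by
    have : ∫ x, u x * (Φ x - ρ x.2 * I x.1) = ∫ x, (u x * Φ x - u x * (ρ x.2 * I x.1)) := by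
      congr 1; ext x; ring
    rw [this, integral_sub i2 i4] at key
    simp only [zero_mul, integral_zero, neg_zero] at key
    linarith
  -- By Fubini, pairing `u` with `ρ I` and pairing `c` with `Φ` both give the integral of `c I`.
  have e2 : ∫ x, u x * (ρ x.2 * I x.1) = ∫ s, c s * I s := by
    rw [Measure.volume_eq_prod] at i4 ⊢
    rw [integral_prod _ i4]
    congr 1
    ext s
    simp only [c]
    rw [← integral_mul_const]
    congr 1
    ext z; ring
  have e3 : ∫ x : ℝ × ℝ, c x.1 * Φ x = ∫ s, c s * I s := by
    rw [Measure.volume_eq_prod] at i3 ⊢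
    rw [integral_prod _ i3]
    congr 1
    ext s
    simp only [I]
    rw [← integral_const_mul]
  calc ∫ x, Φ x • (u - fun x : ℝ × ℝ => c x.1) x = ∫ x, (u x * Φ x - c x.1 * Φ x) := by
        congr 1; ext x; simp only [Pi.sub_apply, smul_eq_mul]; ring
    _ = 0 := by rw [integral_sub i2 i3, e1, e2, e3, sub_self]

/-- Functions with a weak vertical derivative are primitives on almost every vertical line. -/
theorem exists_vertPrim_rep (hD : IsOpen D) (hs : IsVertStar D)
    (hu : LocallyIntegrableOn u D) (hg : LocallyIntegrableOn g D)
    (h : HasWeakDeriv D u g (0, 1)) :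
    ∃ c : ℝ → ℝ, ∀ᵐ x, x ∈ D → u x = c x.1 + vertPrim g x := by
  obtain ⟨c, hc⟩ := ae_eq_fst_of_hasWeakDeriv_zero hD hs
    (hu.sub (locallyIntegrableOn_vertPrim hD hs hg)) (hasWeakDeriv_sub_vertPrim hD hs hu hg h)
  refine ⟨c, ?_⟩
  filter_upwards [hc] with x hx hxD
  have := hx hxD
  simp only [Pi.sub_apply] at this
  linarith

lemma locallyIntegrableOn_comp_lipschitz {φ : ℝ → ℝ} {M : ℝ}
    (hφ : ∀ x y, |φ x - φ y| ≤ M * |x - y|) (hu : LocallyIntegrableOn u D) :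
    LocallyIntegrableOn (fun x => φ (u x)) D := by
  have hφc : Continuous φ := by
    have : LipschitzWith (Real.toNNReal M) φ := LipschitzWith.of_dist_le_mul fun x y => by
      rw [Real.dist_eq, Real.dist_eq]
      exact (hφ x y).trans (by gcongr; exact Real.le_coe_toNNReal M)
    exact this.continuous
  have h1 : LocallyIntegrableOn (fun x => |φ 0| + M * |u x|) D :=
    (locallyIntegrableOn_const _).add (hu.norm.smul M)
  have hm := hu.aestronglyMeasurable
  intro x hx
  obtain ⟨U, hU, h⟩ := h1 x hx
  refine ⟨U ∩ D, inter_mem hU self_mem_nhdsWithin, ?_⟩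
  refine (h.mono_set inter_subset_left).mono'
    ((hφc.comp_aestronglyMeasurable hm).mono_measure (Measure.restrict_mono inter_subset_right le_rfl))
    (ae_of_all _ fun y => ?_)
  have := hφ (u y) 0
  rw [sub_zero] at this
  rw [Real.norm_eq_abs]
  have h2 := abs_sub_abs_le_abs_sub (φ (u y)) (φ 0)
  linarith

lemma locallyIntegrableOn_bdd_mul {w : ℝ × ℝ → ℝ} {M : ℝ} (hg : LocallyIntegrableOn g D)
    (hw : AEStronglyMeasurable w (volume.restrict D)) (hM : ∀ x, |w x| ≤ M) :
    LocallyIntegrableOn (fun x => w x * g x) D := by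
  intro x hx
  obtain ⟨U, hU, h⟩ := hg x hx
  refine ⟨U ∩ D, inter_mem hU self_mem_nhdsWithin, ?_⟩
  exact (h.mono_set inter_subset_left).bdd_mul
    (hw.mono_measure (Measure.restrict_mono inter_subset_right le_rfl)) (ae_of_all _ hM)

lemma lipschitz_of_hasDerivAt_le {φ φ' : ℝ → ℝ} {M : ℝ} (hφ : ∀ x, HasDerivAt φ (φ' x) x)
    (hM : ∀ x, |φ' x| ≤ M) (x y : ℝ) : |φ x - φ y| ≤ M * |x - y| := by
  have := Convex.norm_image_sub_le_of_norm_hasDerivWithin_le (f := φ) (f' := φ') (C := M)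
    (s := univ) (x := y) (y := x) (fun x _ => (hφ x).hasDerivWithinAt)
    (fun x _ => hM x) convex_univ trivial trivial
  simpa using this

/-- Chain rule for the weak vertical derivative. -/
lemma HasWeakDeriv.comp_vert {φ φ' : ℝ → ℝ} {M : ℝ} (hφ : ∀ x, HasDerivAt φ (φ' x) x)
    (hφ' : Continuous φ') (hM : ∀ x, |φ' x| ≤ M) (hD : IsOpen D) (hs : IsVertStar D)
    (hu : LocallyIntegrableOn u D) (hg : LocallyIntegrableOn g D)
    (h : HasWeakDeriv D u g (0, 1)) :
    HasWeakDeriv D (fun x => φ (u x)) (fun x => φ' (u x) * g x) (0, 1) := by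
  obtain ⟨c, hc⟩ := exists_vertPrim_rep hD hs hu hg h
  exact hasWeakDeriv_comp_of_fiber hφ hM hD hs hg hc
    (locallyIntegrableOn_comp_lipschitz (lipschitz_of_hasDerivAt_le hφ hM) hu)
    (locallyIntegrableOn_bdd_mul hg (hφ'.comp_aestronglyMeasurable hu.aestronglyMeasurable)
      fun x => hM _)

end WallLaw

namespace WallLaw

variable {D D₁ D₂ : Set (ℝ × ℝ)} {u v g k : ℝ × ℝ → ℝ} {G H : ℝ × ℝ → ℝ × ℝ} {e e' : ℝ × ℝ}

/-! ### Calculus of weak gradients -/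

lemma HasWeakDeriv.dir_smul (c : ℝ) (h : HasWeakDeriv D u g e) :
    HasWeakDeriv D u (fun x => c * g x) (c • e) := by
  rw [hasWeakDeriv_iff] at h ⊢
  intro φ hφ
  simp only [map_smul, smul_eq_mul, mul_assoc]
  rw [integral_const_mul, ← mul_neg, ← h φ hφ, ← integral_const_mul]
  congr 1; ext x; ring

lemma HasWeakDeriv.dir_add (hu : LocallyIntegrableOn u D) (hg : LocallyIntegrableOn g D)
    (hk : LocallyIntegrableOn k D) (h : HasWeakDeriv D u g e) (h' : HasWeakDeriv D u k e') :
    HasWeakDeriv D u (fun x => g x + k x) (e + e') := by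
  rw [hasWeakDeriv_iff] at h h' ⊢
  intro φ hφ
  simp only [map_add, mul_add, add_mul]
  rw [integral_add (hφ.integrable_mul_fderiv e hu) (hφ.integrable_mul_fderiv e' hu),
    integral_add (hφ.integrable_mul hg) (hφ.integrable_mul hk), h φ hφ, h' φ hφ]
  ring

lemma HasWeakDeriv.congr_deriv (h : HasWeakDeriv D u g e) (hgk : ∀ x, g x = k x) :
    HasWeakDeriv D u k e := by
  rwa [← funext hgk]

lemma IsWeakGradient.locallyIntegrableOn_fst (h : IsWeakGradient D u G) :
    LocallyIntegrableOn (fun x => (G x).1) D :=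
  WallLaw.locallyIntegrableOn_fst h.locallyIntegrableOn_grad

lemma IsWeakGradient.locallyIntegrableOn_snd (h : IsWeakGradient D u G) :
    LocallyIntegrableOn (fun x => (G x).2) D :=
  WallLaw.locallyIntegrableOn_snd h.locallyIntegrableOn_grad

lemma IsWeakGradient.mono (h : IsWeakGradient D₂ u G) (hD : D₁ ⊆ D₂) : IsWeakGradient D₁ u G :=
  .of_hasWeakDeriv (h.locallyIntegrableOn.mono_set hD) (h.locallyIntegrableOn_grad.mono_set hD)
    (h.fst.mono hD) (h.snd.mono hD)

lemma IsWeakGradient.add (h : IsWeakGradient D u G) (h' : IsWeakGradient D v H) :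
    IsWeakGradient D (fun x => u x + v x) (fun x => G x + H x) :=
  .of_hasWeakDeriv (h.locallyIntegrableOn.add h'.locallyIntegrableOn)
    (h.locallyIntegrableOn_grad.add h'.locallyIntegrableOn_grad)
    (h.fst.add h'.fst h.locallyIntegrableOn h'.locallyIntegrableOn h.locallyIntegrableOn_fst
      h'.locallyIntegrableOn_fst)
    (h.snd.add h'.snd h.locallyIntegrableOn h'.locallyIntegrableOn h.locallyIntegrableOn_snd
      h'.locallyIntegrableOn_snd)

lemma IsWeakGradient.const_mul (c : ℝ) (h : IsWeakGradient D u G) :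
    IsWeakGradient D (fun x => c * u x) (fun x => c • G x) :=
  .of_hasWeakDeriv (h.locallyIntegrableOn.smul c) (h.locallyIntegrableOn_grad.smul c)
    (h.fst.const_mul c) (h.snd.const_mul c)

lemma fderiv_comp_snd_apply {P : ℝ → ℝ} (hP : Differentiable ℝ P) (x e : ℝ × ℝ) :
    fderiv ℝ (fun x : ℝ × ℝ => P x.2) x e = deriv P x.2 * e.2 := by
  have h1 : HasFDerivAt (fun x : ℝ × ℝ => x.2) (ContinuousLinearMap.snd ℝ ℝ ℝ) x := hasFDerivAt_snd
  have h2 := (hP x.2).hasDerivAt.hasFDerivAt.comp x h1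
  have h3 := h2.fderiv
  have h4 : P ∘ (fun x : ℝ × ℝ => x.2) = fun x : ℝ × ℝ => P x.2 := rfl
  rw [← h4, h3]
  simp [mul_comm]

lemma isWeakGradient_comp_snd {P : ℝ → ℝ} (hP : ContDiff ℝ ∞ P) :
    IsWeakGradient D (fun x => P x.2) (fun x => (0, deriv P x.2)) := by
  have hc : Continuous (deriv P) := hP.continuous_deriv (by simp)
  have hs : ContDiff ℝ ∞ fun x : ℝ × ℝ => P x.2 := hP.comp contDiff_snd
  have hd : Differentiable ℝ P := hP.differentiable (by simp)
  refine .of_hasWeakDeriv (hs.continuous.locallyIntegrable.locallyIntegrableOn D)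
    ((by fun_prop : Continuous fun x : ℝ × ℝ => ((0 : ℝ), deriv P x.2)).locallyIntegrable.locallyIntegrableOn D)
    ((hasWeakDeriv_of_contDiff hs (1, 0)).congr_deriv fun x => ?_)
    ((hasWeakDeriv_of_contDiff hs (0, 1)).congr_deriv fun x => ?_)
  · simp [fderiv_comp_snd_apply hd]
  · simp [fderiv_comp_snd_apply hd]

/-- Product of a weakly differentiable function with a cutoff in the vertical variable. -/
lemma IsWeakGradient.cutoff_mul {χ : ℝ → ℝ} (hχ : ContDiff ℝ ∞ χ) (hD₁ : IsOpen D₁)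
    (hs : ∀ x ∈ D₂, x.2 ∈ tsupport χ → x ∈ D₁) (h : IsWeakGradient D₁ u G) :
    IsWeakGradient D₂ (fun x => χ x.2 * u x)
      (fun x => χ x.2 • G x + (0, deriv χ x.2 * u x)) := by
  have hc : ContDiff ℝ ∞ fun x : ℝ × ℝ => χ x.2 := hχ.comp contDiff_snd
  have hd : Differentiable ℝ χ := hχ.differentiable (by simp)
  have hc' : Continuous (deriv χ) := hχ.continuous_deriv (by simp)
  have hts : tsupport (fun x : ℝ × ℝ => χ x.2) ∩ D₂ ⊆ D₁ := by
    rintro x ⟨hx, hx'⟩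
    refine hs x hx' ?_
    have := closure_minimal (s := Function.support fun x : ℝ × ℝ => χ x.2)
      (t := Prod.snd ⁻¹' tsupport χ) (fun y hy => subset_tsupport χ hy)
      ((isClosed_tsupport χ).preimage continuous_snd)
    exact this hx
  have hts' : tsupport (fun x : ℝ × ℝ => deriv χ x.2) ∩ D₂ ⊆ D₁ := by
    rintro x ⟨hx, hx'⟩
    refine hs x hx' ?_
    have := closure_minimal (s := Function.support fun x : ℝ × ℝ => deriv χ x.2)
      (t := Prod.snd ⁻¹' tsupport χ)
      (fun y hy => tsupport_deriv_subset (subset_tsupport (deriv χ) hy))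
      ((isClosed_tsupport χ).preimage continuous_snd)
    exact this hx
  have l1 := locallyIntegrableOn_cutoff_mul hc.continuous hD₁ hts h.locallyIntegrableOn
  have l2 := locallyIntegrableOn_cutoff_mul hc.continuous hD₁ hts h.locallyIntegrableOn_fst
  have l3 := locallyIntegrableOn_cutoff_mul hc.continuous hD₁ hts h.locallyIntegrableOn_snd
  have l4 := locallyIntegrableOn_cutoff_mul (χ := fun x : ℝ × ℝ => deriv χ x.2)
    (by fun_prop) hD₁ hts' h.locallyIntegrableOn
  refine .of_hasWeakDeriv l1 ?_
    ((h.fst.cutoff_mul hc hts h.locallyIntegrableOn h.locallyIntegrableOn_fst).congr_deriv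
      fun x => ?_)
    ((h.snd.cutoff_mul hc hts h.locallyIntegrableOn h.locallyIntegrableOn_snd).congr_deriv
      fun x => ?_)
  · refine (locallyIntegrableOn_prodMk l2 (l3.add l4)).congr (ae_of_all _ fun x => ?_)
    ext <;> simp
  · simp [fderiv_comp_snd_apply hd]
  · simp [fderiv_comp_snd_apply hd]

/-! ### Measure preserving maps of the plane -/

/-- On each vertical line the map is a translation or a reflected translation, so Fubini suffices
and `h` need only be measurable. -/
lemma measurePreserving_vshear {h : ℝ → ℝ} (hh : Measurable h) {σ : ℝ} (hσ : σ = 1 ∨ σ = -1) :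
    MeasurePreserving (fun z : ℝ × ℝ => (z.1, h z.1 + σ * z.2)) volume volume := by
  have := (MeasurePreserving.id (volume : Measure ℝ)).skew_product (μc := volume) (μd := volume)
    (g := fun s t => h s + σ * t) (by fun_prop) (ae_of_all _ fun s => by
      rcases hσ with rfl | rfl
      · simpa using (measurePreserving_add_left volume (h s)).map_eq
      · have h1 := (measurePreserving_add_left (volume : Measure ℝ) (h s)).comp
          (Measure.measurePreserving_neg (volume : Measure ℝ))
        have h2 := h1.map_eq
        simpa [Function.comp_def] using h2)
  exact this

lemma measurePreserving_swap : MeasurePreserving (Prod.swap : ℝ × ℝ → ℝ × ℝ) volume volume :=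
  Measure.measurePreserving_swap

/-- The shear `(a, b) ↦ (a + κ b, b)`. -/
def hshear (κ : ℝ) : (ℝ × ℝ) ≃L[ℝ] (ℝ × ℝ) :=
  ((ContinuousLinearEquiv.prodComm ℝ ℝ ℝ).trans ((ContinuousLinearEquiv.refl ℝ ℝ).skewProd
    (ContinuousLinearEquiv.refl ℝ ℝ) (κ • ContinuousLinearMap.id ℝ ℝ))).trans
      (ContinuousLinearEquiv.prodComm ℝ ℝ ℝ)

lemma hshear_apply (κ : ℝ) (x : ℝ × ℝ) : hshear κ x = (x.1 + κ * x.2, x.2) := by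
  simp [hshear]

lemma measurePreserving_hshear (κ : ℝ) : MeasurePreserving (hshear κ) volume volume := by
  have h := (measurePreserving_swap.comp (measurePreserving_vshear (h := fun s => κ * s)
    (by fun_prop) (Or.inl rfl))).comp measurePreserving_swap
  convert h using 1
  ext x
  · simp [hshear_apply, add_comm]
  · simp [hshear_apply]

lemma HasWeakDeriv.comp_hshear (κ : ℝ) (h : HasWeakDeriv D u g (e.1 + κ * e.2, e.2)) :
    HasWeakDeriv (hshear κ ⁻¹' D) (fun x => u (hshear κ x)) (fun x => g (hshear κ x)) e := by
  refine HasWeakDeriv.comp_affine (hshear κ) 0 (c := 1) (by simp)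
    (by rw [(measurePreserving_hshear κ).map_eq, one_smul]) ?_
  rwa [hshear_apply]

lemma locallyIntegrableOn_comp_hshear {E : Type*} [NormedAddCommGroup E] {w : ℝ × ℝ → E} (κ : ℝ)
    (hD : IsOpen D) (h : LocallyIntegrableOn w D) :
    LocallyIntegrableOn (fun x => w (hshear κ x)) (hshear κ ⁻¹' D) :=
  locallyIntegrableOn_comp_homeomorph hD (hshear κ).toHomeomorph ENNReal.one_ne_top
    (by rw [one_smul]; exact (measurePreserving_hshear κ).map_eq) h

/-! ### Domains above a graph -/

lemma isOpen_cellDomain {h : ℝ → ℝ} (hh : Continuous h) : IsOpen (cellDomain h) :=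
  isOpen_lt (by fun_prop) (by fun_prop)

lemma isVertStar_cellDomain {h : ℝ → ℝ} (hh : ∀ s, h s < 0) : IsVertStar (cellDomain h) := by
  intro x hx s hs z hz
  have h1 : h x.1 < x.2 := hx
  have h2 := hh x.1
  have h3 : h x.1 < s := by linarith [hs.1]
  rw [mem_uIcc] at hz
  change h x.1 < z
  rcases hz with hz | hz <;> linarith

/-- Chain rule for weak gradients above a Lipschitz graph. -/
lemma IsWeakGradient.comp_of_lipschitz {h : ℝ → ℝ} {K : NNReal} (hK : LipschitzWith K h)
    (hh : ∀ s, h s < 0) {φ φ' : ℝ → ℝ} {M : ℝ} (hφ : ∀ x, HasDerivAt φ (φ' x) x)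
    (hφ' : Continuous φ') (hM : ∀ x, |φ' x| ≤ M) (hu : IsWeakGradient (cellDomain h) u G) :
    IsWeakGradient (cellDomain h) (fun x => φ (u x)) (fun x => φ' (u x) • G x) := by
  set D := cellDomain h
  have hD : IsOpen D := isOpen_cellDomain hK.continuous
  have hstar : IsVertStar D := isVertStar_cellDomain hh
  have l0 := hu.locallyIntegrableOn
  have l1 := hu.locallyIntegrableOn_fst
  have l2 := hu.locallyIntegrableOn_snd
  have m := hφ'.comp_aestronglyMeasurable l0.aestronglyMeasurable
  have lφ := locallyIntegrableOn_comp_lipschitz (lipschitz_of_hasDerivAt_le hφ hM) l0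
  have lφ1 := locallyIntegrableOn_bdd_mul l1 m fun x => hM _
  have lφ2 := locallyIntegrableOn_bdd_mul l2 m fun x => hM _
  have d2 := hu.snd.comp_vert hφ hφ' hM hD hstar l0 l2
  -- The direction `(κ, 1)` is steeper than the graph because `K κ < 1`. Moving up along it never
  -- leaves the domain, so the sheared domain is again vertically star-shaped and the vertical chain
  -- rule applies in this second direction.
  set κ : ℝ := 1 / (K + 1)
  have hKp : (0 : ℝ) < K + 1 := by positivity
  have hκ : 0 < κ := by positivity
  have hκK : K * κ < 1 := by
    rw [mul_one_div, div_lt_one hKp]; linarith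
  -- the sheared domain
  have hD' : IsOpen (hshear κ ⁻¹' D) := hD.preimage (hshear κ).continuous
  have hmem : ∀ x : ℝ × ℝ, x ∈ hshear κ ⁻¹' D ↔ h (x.1 + κ * x.2) < x.2 := fun x => by
    rw [mem_preimage, hshear_apply]; rfl
  have hup : ∀ a b b', b ≤ b' → h (a + κ * b) < b → h (a + κ * b') < b' := by
    intro a b b' hb hab
    have := hK.dist_le_mul (a + κ * b') (a + κ * b)
    rw [Real.dist_eq, Real.dist_eq, show a + κ * b' - (a + κ * b) = κ * (b' - b) by ring,
      abs_of_nonneg (mul_nonneg hκ.le (sub_nonneg.2 hb))] at this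
    have h1 := le_abs_self (h (a + κ * b') - h (a + κ * b))
    nlinarith [mul_nonneg (sub_nonneg.2 hκK.le) (sub_nonneg.2 hb)]
  have hstar' : IsVertStar (hshear κ ⁻¹' D) := by
    intro x hx s hs z hz
    rw [hmem] at hx ⊢
    rw [mem_uIcc] at hz
    rcases hz with hz | hz
    · exact hup _ _ _ hz.1 hx
    · exact (hh _).trans_le (by linarith [hs.1, hz.1])
  have dκ : HasWeakDeriv D u (fun x => κ * (G x).1 + (G x).2) (κ, 1) := by
    have := HasWeakDeriv.dir_add l0 (l1.smul κ) l2 (hu.fst.dir_smul κ) hu.snd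
    simpa using this
  have lκ : LocallyIntegrableOn (fun x => κ * (G x).1 + (G x).2) D := (l1.smul κ).add l2
  have d3 : HasWeakDeriv (hshear κ ⁻¹' D) (fun x => u (hshear κ x))
      (fun x => κ * (G (hshear κ x)).1 + (G (hshear κ x)).2) (0, 1) :=
    HasWeakDeriv.comp_hshear (e := (0, 1)) (g := fun x => κ * (G x).1 + (G x).2) κ
      (by simpa using dκ)
  have d4 := d3.comp_vert hφ hφ' hM hD' hstar' (locallyIntegrableOn_comp_hshear κ hD l0)
    (locallyIntegrableOn_comp_hshear κ hD lκ)
  have hinv : ∀ x, hshear κ (hshear (-κ) x) = x := fun x => by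
    rw [hshear_apply, hshear_apply]; ext <;> simp
  have d5 := HasWeakDeriv.comp_hshear (e := (κ, 1)) (-κ) (by simpa using d4)
  have hpre : hshear (-κ) ⁻¹' (hshear κ ⁻¹' D) = D := by
    ext x; simp only [mem_preimage, hinv]
  simp only [hinv, hpre] at d5
  -- The horizontal direction is recovered as `(1, 0) = κ⁻¹ ((κ, 1) - (0, 1))`.
  have d6 := (HasWeakDeriv.dir_add lφ 
    (locallyIntegrableOn_bdd_mul lκ m fun x => hM _) (lφ2.smul (-1 : ℝ))
    d5 (d2.dir_smul (-1))).dir_smul κ⁻¹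
  have d1 : HasWeakDeriv D (fun x => φ (u x)) (fun x => φ' (u x) * (G x).1) (1, 0) := by
    have he : κ⁻¹ • ((κ, 1) + (-1 : ℝ) • ((0 : ℝ), (1 : ℝ))) = (1, 0) := by
      ext <;> simp [hκ.ne']
    rw [he] at d6
    refine d6.congr_deriv fun x => ?_
    simp only [Pi.smul_apply, smul_eq_mul]
    field_simp
    ring
  exact .of_hasWeakDeriv lφ (locallyIntegrableOn_prodMk lφ1 lφ2) d1 d2

/-! ### Scaling and translation -/

/-- The map `x ↦ ε x + (a, 0)`. -/
def dil (ε a : ℝ) (x : ℝ × ℝ) : ℝ × ℝ := (ε * x.1 + a, ε * x.2)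

lemma map_dil {ε : ℝ} (hε : 0 < ε) (a : ℝ) :
    Measure.map (dil ε a) volume = ENNReal.ofReal ((ε ^ 2)⁻¹) • (volume : Measure (ℝ × ℝ)) := by
  have h1 : dil ε a = (fun x => x + (a, 0)) ∘ (fun x => ε • x) := by
    ext x <;> simp [dil]
  rw [h1, ← Measure.map_map (by fun_prop) (by fun_prop), Measure.map_addHaar_smul _ hε.ne',
    Measure.map_smul, (measurePreserving_add_right volume ((a, 0) : ℝ × ℝ)).map_eq]
  congr 2
  simp

/-- `dil` as a homeomorphism. -/
def dilHomeo (ε a : ℝ) (hε : ε ≠ 0) : (ℝ × ℝ) ≃ₜ (ℝ × ℝ) where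
  toFun := dil ε a
  invFun := fun x => (ε⁻¹ * (x.1 - a), ε⁻¹ * x.2)
  left_inv := fun x => by simp [dil, hε]
  right_inv := fun x => by simp [dil, hε]
  continuous_toFun := by unfold dil; fun_prop
  continuous_invFun := by fun_prop

lemma IsWeakGradient.comp_dil {ε : ℝ} (hε : 0 < ε) (a : ℝ) (hD : IsOpen D)
    (h : IsWeakGradient D u G) :
    IsWeakGradient (dil ε a ⁻¹' D) (fun x => u (dil ε a x)) (fun x => ε • G (dil ε a x)) := by
  let M : (ℝ × ℝ) ≃L[ℝ] (ℝ × ℝ) := ContinuousLinearEquiv.smulLeft (Units.mk0 ε hε.ne')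
  have hM : ∀ x, M x = ε • x := fun x => rfl
  have hT : ∀ x, dil ε a x = M x + (a, 0) := fun x => by rw [hM]; ext <;> simp [dil]
  refine .of_hasWeakDeriv
    (locallyIntegrableOn_comp_homeomorph hD (dilHomeo ε a hε.ne') ENNReal.ofReal_ne_top
      (map_dil hε a) h.locallyIntegrableOn)
    ((locallyIntegrableOn_comp_homeomorph hD (dilHomeo ε a hε.ne') ENNReal.ofReal_ne_top
      (map_dil hε a) h.locallyIntegrableOn_grad).smul ε)
    (HasWeakDeriv.comp_affine M (a, 0) (g := fun x => ε * (G x).1) hT (map_dil hε a) ?_)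
    (HasWeakDeriv.comp_affine M (a, 0) (g := fun x => ε * (G x).2) hT (map_dil hε a) ?_)
  · rw [hM]; exact h.fst.dir_smul ε
  · rw [hM]; exact h.snd.dir_smul ε

end WallLaw

namespace WallLaw

variable {D : Set (ℝ × ℝ)} {u v : ℝ × ℝ → ℝ} {G H : ℝ × ℝ → ℝ × ℝ}

/-! ### Traces and primitives in a layer -/

/-- The rectangle `(0, L) × (0, T)`. -/
def layer (L T : ℝ) : Set (ℝ × ℝ) := Ioo 0 L ×ˢ Ioo 0 T

lemma measurableSet_layer (L T : ℝ) : MeasurableSet (layer L T) :=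
  measurableSet_Ioo.prod measurableSet_Ioo

lemma volume_restrict_layer (L T : ℝ) : (volume : Measure (ℝ × ℝ)).restrict (layer L T) =
    (volume.restrict (Ioo 0 L)).prod (volume.restrict (Ioo 0 T)) := by
  rw [Measure.volume_eq_prod, layer, Measure.prod_restrict]

/-- On almost every vertical line `U` is the primitive of `g` with initial value `E`. -/
def LineRep (L T : ℝ) (U g : ℝ × ℝ → ℝ) (E : ℝ → ℝ) : Prop :=
  ∀ᵐ z ∂volume.restrict (layer L T), U z = E z.1 + ∫ τ in (0 : ℝ)..z.2, g (z.1, τ)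

lemma LineRep.ae_ae {L T : ℝ} {U g : ℝ × ℝ → ℝ} {E : ℝ → ℝ} (h : LineRep L T U g E) :
    ∀ᵐ s ∂volume.restrict (Ioo 0 L), ∀ᵐ t ∂volume.restrict (Ioo 0 T),
      U (s, t) = E s + ∫ τ in (0 : ℝ)..t, g (s, τ) := by
  unfold LineRep at h
  rw [volume_restrict_layer] at h
  exact Measure.ae_ae_of_ae_prod h

lemma LineRep.ae_ae_swap {L T : ℝ} {U g : ℝ × ℝ → ℝ} {E : ℝ → ℝ} (h : LineRep L T U g E) :
    ∀ᵐ t ∂volume.restrict (Ioo 0 T), ∀ᵐ s ∂volume.restrict (Ioo 0 L),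
      U (s, t) = E s + ∫ τ in (0 : ℝ)..t, g (s, τ) := by
  unfold LineRep at h
  rw [volume_restrict_layer] at h
  exact Measure.ae_ae_of_ae_prod (Measure.measurePreserving_swap.quasiMeasurePreserving.ae h)

/-- Cauchy–Schwarz against the constant `1`. If `f` is not integrable, its integral is `0` by
convention and nothing is to be shown. -/
lemma enorm_integral_sq_le {f : ℝ → ℝ} {t : ℝ} (ht : 0 ≤ t) :
    ‖∫ τ in (0 : ℝ)..t, f τ‖ₑ ^ 2 ≤ ENNReal.ofReal t * ∫⁻ τ in Ioo 0 t, ‖f τ‖ₑ ^ 2 := by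
  rw [intervalIntegral.integral_of_le ht, integral_Ioc_eq_integral_Ioo]
  by_cases hf : Integrable f (volume.restrict (Ioo 0 t))
  swap
  · rw [integral_undef hf]; simp
  have h1 := enorm_integral_le_lintegral_enorm (μ := volume.restrict (Ioo 0 t)) f
  have h2 := ENNReal.lintegral_mul_le_Lp_mul_Lq (volume.restrict (Ioo 0 t))
    (Real.HolderConjugate.two_two) (f := fun _ => 1) (g := fun τ => ‖f τ‖ₑ)
    aemeasurable_const hf.aestronglyMeasurable.enorm
  simp only [Pi.mul_apply, one_mul, ENNReal.one_rpow, lintegral_const, Measure.restrict_apply_univ,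
    Real.volume_Ioo, sub_zero] at h2
  have h3 := pow_le_pow_left' (h1.trans h2) 2
  refine h3.trans (le_of_eq ?_)
  rw [mul_pow, ← ENNReal.rpow_natCast, ← ENNReal.rpow_mul, ← ENNReal.rpow_natCast,
    ← ENNReal.rpow_mul]
  norm_num

lemma LineRep.ae_enorm_sub_le {L T : ℝ} {U g : ℝ × ℝ → ℝ} {E : ℝ → ℝ} (h : LineRep L T U g E) :
    ∀ᵐ t ∂volume.restrict (Ioo 0 T), ∀ᵐ s ∂volume.restrict (Ioo 0 L),
      ‖U (s, t) - E s‖ₑ ^ 2 ≤ ENNReal.ofReal t * ∫⁻ τ in Ioo 0 T, ‖g (s, τ)‖ₑ ^ 2 := by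
  filter_upwards [h.ae_ae_swap, ae_restrict_mem measurableSet_Ioo] with t ht htT
  filter_upwards [ht] with s hs
  rw [hs, add_sub_cancel_left]
  refine (enorm_integral_sq_le htT.1.le).trans ?_
  gcongr
  exact htT.2.le

lemma lintegral_layer_eq {L T : ℝ} {w : ℝ × ℝ → ℝ≥0∞}
    (hw : AEMeasurable w (volume.restrict (layer L T))) :
    ∫⁻ s in Ioo 0 L, ∫⁻ τ in Ioo 0 T, w (s, τ) = ∫⁻ z in layer L T, w z := by
  rw [volume_restrict_layer] at hw ⊢
  rw [lintegral_prod _ hw]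

lemma aemeasurable_lintegral_layer {L T : ℝ} {w : ℝ × ℝ → ℝ≥0∞}
    (hw : AEMeasurable w (volume.restrict (layer L T))) :
    AEMeasurable (fun s => ∫⁻ τ in Ioo 0 T, w (s, τ)) (volume.restrict (Ioo 0 L)) := by
  rw [volume_restrict_layer] at hw
  exact hw.lintegral_prod_right'

lemma lintegral_enorm_sq_lt_top {α : Type*} [MeasurableSpace α] {E : Type*} [NormedAddCommGroup E]
    {μ : Measure α} {w : α → E} (hw : MemLp w 2 μ) : ∫⁻ z, ‖w z‖ₑ ^ 2 ∂μ < ⊤ := by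
  have := hw.eLpNorm_lt_top
  rw [eLpNorm_lt_top_iff_lintegral_rpow_enorm_lt_top two_ne_zero ENNReal.ofNat_ne_top] at this
  simpa using this

lemma memLp_two_of_lintegral {α : Type*} [MeasurableSpace α] {E : Type*} [NormedAddCommGroup E]
    {μ : Measure α} {w : α → E}
    (hm : AEStronglyMeasurable w μ) (hw : ∫⁻ z, ‖w z‖ₑ ^ 2 ∂μ < ⊤) : MemLp w 2 μ := by
  refine ⟨hm, ?_⟩
  rw [eLpNorm_lt_top_iff_lintegral_rpow_enorm_lt_top two_ne_zero ENNReal.ofNat_ne_top]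
  simpa using hw

/-- A primitive in a layer attains its initial value in the mean square sense. -/
lemma LineRep.tendsto {L T : ℝ} (hT : 0 < T) {U g : ℝ × ℝ → ℝ} {E : ℝ → ℝ}
    (h : LineRep L T U g E) (hg : MemLp g 2 (volume.restrict (layer L T))) :
    Tendsto (fun d : ℝ => (ENNReal.ofReal d)⁻¹ *
      ∫⁻ t in Ioo 0 d, ∫⁻ s in Ioo 0 L, ‖U (s, t) - E s‖ₑ ^ 2) (𝓝[>] 0) (𝓝 0) := by
  have hgm : AEMeasurable (fun z => ‖g z‖ₑ ^ 2) (volume.restrict (layer L T)) :=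
    hg.1.enorm.pow_const 2
  set A := ∫⁻ z in layer L T, ‖g z‖ₑ ^ 2
  have hA : A < ⊤ := lintegral_enorm_sq_lt_top hg
  have hlim : Tendsto (fun d : ℝ => ENNReal.ofReal d * A) (𝓝[>] 0) (𝓝 0) := by
    have h1 : Tendsto (fun d : ℝ => ENNReal.ofReal d) (𝓝[>] 0) (𝓝 0) := by
      have := (ENNReal.continuous_ofReal.tendsto 0).mono_left (nhdsWithin_le_nhds (s := Ioi 0))
      simpa using this
    simpa using ENNReal.Tendsto.mul_const h1 (Or.inr hA.ne)
  refine tendsto_of_tendsto_of_tendsto_of_le_of_le' tendsto_const_nhds hlim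
    (Eventually.of_forall fun _ => zero_le) ?_
  filter_upwards [Ioo_mem_nhdsGT hT] with d hd
  have hd0 : ENNReal.ofReal d ≠ 0 := by simpa using hd.1
  rw [mul_comm, ← div_eq_mul_inv]
  apply ENNReal.div_le_of_le_mul
  calc ∫⁻ t in Ioo 0 d, ∫⁻ s in Ioo 0 L, ‖U (s, t) - E s‖ₑ ^ 2
      ≤ ∫⁻ t in Ioo 0 d, ENNReal.ofReal d * A := by
        apply lintegral_mono_ae
        have hsub := ae_restrict_of_ae_restrict_of_subset
          (Ioo_subset_Ioo_right hd.2.le) h.ae_enorm_sub_le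
        filter_upwards [hsub, ae_restrict_mem measurableSet_Ioo] with t ht htd
        calc ∫⁻ s in Ioo 0 L, ‖U (s, t) - E s‖ₑ ^ 2
            ≤ ∫⁻ s in Ioo 0 L, ENNReal.ofReal t * ∫⁻ τ in Ioo 0 T, ‖g (s, τ)‖ₑ ^ 2 :=
              lintegral_mono_ae ht
          _ = ENNReal.ofReal t * A := by
              rw [lintegral_const_mul'' _ (aemeasurable_lintegral_layer hgm),
                lintegral_layer_eq hgm]
          _ ≤ _ := by gcongr; exact htd.2.le
    _ = ENNReal.ofReal d * A * ENNReal.ofReal d := by simp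

lemma enorm_sub_sq_le (a b c : ℝ) : ‖a - c‖ₑ ^ 2 ≤ 2 * ‖b - c‖ₑ ^ 2 + 2 * ‖b - a‖ₑ ^ 2 := by
  have h : (a - c) ^ 2 ≤ 2 * (b - c) ^ 2 + 2 * (b - a) ^ 2 := by nlinarith [sq_nonneg (2 * b - a - c)]
  have e : ∀ x : ℝ, ‖x‖ₑ ^ 2 = ENNReal.ofReal (x ^ 2) := fun x => by
    rw [← ofReal_norm, ← ENNReal.ofReal_pow (norm_nonneg _), Real.norm_eq_abs, sq_abs]
  rw [e, e, e, show (2 : ℝ≥0∞) = ENNReal.ofReal 2 by simp, ← ENNReal.ofReal_mul (by norm_num),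
    ← ENNReal.ofReal_mul (by norm_num), ← ENNReal.ofReal_add (by positivity) (by positivity)]
  exact ENNReal.ofReal_le_ofReal h

/-- `E` is recovered from one generic height `t` as `U (·, t)` minus the integral of `g` up to `t`;
such a height exists because the layer has positive thickness. -/
lemma LineRep.aestronglyMeasurable {L T : ℝ} (hT : 0 < T) {U g : ℝ × ℝ → ℝ} {E : ℝ → ℝ}
    (h : LineRep L T U g E) (hg : MemLp g 2 (volume.restrict (layer L T)))
    (hU : AEStronglyMeasurable U (volume.restrict (layer L T))) :
    AEStronglyMeasurable E (volume.restrict (Ioo 0 L)) := by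
  have hU' : ∀ᵐ t ∂volume.restrict (Ioo 0 T),
      AEStronglyMeasurable (fun s => U (s, t)) (volume.restrict (Ioo 0 L)) := by
    rw [volume_restrict_layer] at hU
    have := hU.prod_swap.prodMk_left
    simpa using this
  have : NeZero (volume.restrict (Ioo (0 : ℝ) T)) := ⟨by
    rw [Ne, Measure.restrict_eq_zero, Real.volume_Ioo]; simpa using hT⟩
  obtain ⟨t, ht1, ht2, ht3⟩ :=
    (h.ae_ae_swap.and (hU'.and (ae_restrict_mem measurableSet_Ioo))).exists
  have hI : AEStronglyMeasurable (fun s => ∫ τ in (0 : ℝ)..t, g (s, τ))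
      (volume.restrict (Ioo 0 L)) := by
    have hg' : AEStronglyMeasurable g (volume.restrict (layer L t)) :=
      hg.1.mono_measure (Measure.restrict_mono (prod_mono le_rfl (Ioo_subset_Ioo_right ht3.2.le)) le_rfl)
    rw [volume_restrict_layer] at hg'
    refine hg'.integral_prod_right'.congr (ae_of_all _ fun s => ?_)
    simp only
    rw [intervalIntegral.integral_of_le ht3.1.le, integral_Ioc_eq_integral_Ioo]
  refine (ht2.sub hI).congr ?_
  filter_upwards [ht1] with s hs
  simp only [Pi.sub_apply, hs]
  ring

/-- Uniqueness of the initial value in the mean square sense. -/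
lemma LineRep.ae_eq_of_tendsto {L T : ℝ} (hT : 0 < T) {U g : ℝ × ℝ → ℝ} {E g₀ : ℝ → ℝ}
    (h : LineRep L T U g E) (hg : MemLp g 2 (volume.restrict (layer L T)))
    (hU : AEStronglyMeasurable U (volume.restrict (layer L T)))
    (hg₀ : AEStronglyMeasurable g₀ (volume.restrict (Ioo 0 L)))
    (ht : Tendsto (fun d : ℝ => (ENNReal.ofReal d)⁻¹ *
      ∫⁻ t in Ioo 0 d, ∫⁻ s in Ioo 0 L, ‖U (s, t) - g₀ s‖ₑ ^ 2) (𝓝[>] 0) (𝓝 0)) :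
    ∀ᵐ s ∂volume.restrict (Ioo 0 L), E s = g₀ s := by
  have hgm : AEMeasurable (fun z => ‖g z‖ₑ ^ 2) (volume.restrict (layer L T)) :=
    hg.1.enorm.pow_const 2
  have hE := h.aestronglyMeasurable hT hg hU
  set A := ∫⁻ z in layer L T, ‖g z‖ₑ ^ 2
  have hA : A < ⊤ := lintegral_enorm_sq_lt_top hg
  set B := ∫⁻ s in Ioo 0 L, ‖E s - g₀ s‖ₑ ^ 2
  have hlim : Tendsto (fun d : ℝ => 2 * ((ENNReal.ofReal d)⁻¹ *
      ∫⁻ t in Ioo 0 d, ∫⁻ s in Ioo 0 L, ‖U (s, t) - g₀ s‖ₑ ^ 2) + 2 * (ENNReal.ofReal d * A))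
      (𝓝[>] 0) (𝓝 0) := by
    have h1 : Tendsto (fun d : ℝ => ENNReal.ofReal d) (𝓝[>] 0) (𝓝 0) := by
      have := (ENNReal.continuous_ofReal.tendsto 0).mono_left (nhdsWithin_le_nhds (s := Ioi 0))
      simpa using this
    have h2 := ENNReal.Tendsto.mul_const h1 (Or.inr hA.ne)
    have h3 := (ENNReal.Tendsto.const_mul ht (a := 2) (Or.inr (by simp))).add
      (ENNReal.Tendsto.const_mul h2 (a := 2) (Or.inr (by simp)))
    simpa using h3
  have hB : B ≤ 0 := by
    refine ge_of_tendsto hlim ?_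
    filter_upwards [Ioo_mem_nhdsGT hT] with d hd
    have hd0 : ENNReal.ofReal d ≠ 0 := by simpa using hd.1
    -- Both initial values are compared with `U (·, t)`. Averaging over `0 < t < d` leaves twice the
    -- trace quotient plus a multiple of `d`, and both tend to zero.
    have hle : ∀ᵐ t ∂volume.restrict (Ioo 0 d),
        B ≤ 2 * (∫⁻ s in Ioo 0 L, ‖U (s, t) - g₀ s‖ₑ ^ 2) + 2 * (ENNReal.ofReal d * A) := by
      have hsub := ae_restrict_of_ae_restrict_of_subset
        (Ioo_subset_Ioo_right hd.2.le) h.ae_enorm_sub_le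
      filter_upwards [hsub, ae_restrict_mem measurableSet_Ioo] with t ht htd
      have hm : AEMeasurable (fun s => 2 * (ENNReal.ofReal t * ∫⁻ τ in Ioo 0 T, ‖g (s, τ)‖ₑ ^ 2))
          (volume.restrict (Ioo 0 L)) :=
        ((aemeasurable_lintegral_layer hgm).const_mul _).const_mul _
      calc B ≤ ∫⁻ s in Ioo 0 L, (2 * ‖U (s, t) - g₀ s‖ₑ ^ 2 +
            2 * (ENNReal.ofReal t * ∫⁻ τ in Ioo 0 T, ‖g (s, τ)‖ₑ ^ 2)) := by
            apply lintegral_mono_ae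
            filter_upwards [ht] with s hs
            refine (enorm_sub_sq_le (E s) (U (s, t)) (g₀ s)).trans ?_
            gcongr
        _ = 2 * (∫⁻ s in Ioo 0 L, ‖U (s, t) - g₀ s‖ₑ ^ 2) + 2 * (ENNReal.ofReal t * A) := by
            rw [lintegral_add_right' _ hm, lintegral_const_mul' _ _ (by simp),
              lintegral_const_mul' _ _ (by simp), lintegral_const_mul' _ _ (by simp),
              lintegral_layer_eq hgm]
        _ ≤ _ := by gcongr; exact htd.2.le
    have h1 : B * ENNReal.ofReal d ≤ 2 * (∫⁻ t in Ioo 0 d, ∫⁻ s in Ioo 0 L,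
        ‖U (s, t) - g₀ s‖ₑ ^ 2) + 2 * (ENNReal.ofReal d * A) * ENNReal.ofReal d := by
      calc B * ENNReal.ofReal d = ∫⁻ t in Ioo 0 d, B := by simp
        _ ≤ ∫⁻ t in Ioo 0 d, (2 * (∫⁻ s in Ioo 0 L, ‖U (s, t) - g₀ s‖ₑ ^ 2) +
            2 * (ENNReal.ofReal d * A)) := lintegral_mono_ae hle
        _ = _ := by
            rw [lintegral_add_right _ measurable_const, lintegral_const_mul' _ _ (by simp)]
            simp
    calc B = B * ENNReal.ofReal d * (ENNReal.ofReal d)⁻¹ := by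
          rw [mul_assoc, ENNReal.mul_inv_cancel hd0 ENNReal.ofReal_ne_top, mul_one]
      _ ≤ _ := mul_le_mul' h1 le_rfl
      _ = _ := by
          rw [add_mul, mul_assoc _ (ENNReal.ofReal d) (ENNReal.ofReal d)⁻¹,
            ENNReal.mul_inv_cancel hd0 ENNReal.ofReal_ne_top, mul_one]
          ring
  have hB0 : B = 0 := le_antisymm hB zero_le
  have := (lintegral_eq_zero_iff' ((hE.sub hg₀).enorm.pow_const 2)).1 hB0
  filter_upwards [this] with s hs
  simpa [sub_eq_zero] using hs

lemma LineRep.congr_init {L T : ℝ} {U g : ℝ × ℝ → ℝ} {E g₀ : ℝ → ℝ} (h : LineRep L T U g E)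
    (he : ∀ᵐ s ∂volume.restrict (Ioo 0 L), E s = g₀ s) : LineRep L T U g g₀ := by
  unfold LineRep at h ⊢
  rw [volume_restrict_layer] at h ⊢
  filter_upwards [h, Measure.quasiMeasurePreserving_fst.ae he] with z hz hz'
  rw [hz, hz']

/-! ### Representation of weakly differentiable functions in a layer along a graph -/

/-- The map `(s, t) ↦ (s, h s + σ t)`. -/
def graphMap (h : ℝ → ℝ) (σ : ℝ) (z : ℝ × ℝ) : ℝ × ℝ := (z.1, h z.1 + σ * z.2)

lemma measurePreserving_graphMap {h : ℝ → ℝ} (hh : Measurable h) {σ : ℝ} (hσ : σ = 1 ∨ σ = -1) :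
    MeasurePreserving (graphMap h σ) volume volume := measurePreserving_vshear hh hσ

lemma measurePreserving_graphMap_restrict {h : ℝ → ℝ} (hh : Measurable h) {σ : ℝ}
    (hσ : σ = 1 ∨ σ = -1) {A : Set (ℝ × ℝ)} (hA : MeasurableSet A) :
    MeasurePreserving (graphMap h σ) (volume.restrict (graphMap h σ ⁻¹' A)) (volume.restrict A) :=
  (measurePreserving_graphMap hh hσ).restrict_preimage hA

/-- Values along vertical lines in a layer along a graph. -/
lemma exists_lineRep {h : ℝ → ℝ} (hh : Measurable h) {σ : ℝ} (hσ : σ = 1 ∨ σ = -1)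
    {L T : ℝ} (hT : 0 < T) (hD : IsOpen D) (hs : IsVertStar D) (hu : IsWeakGradient D u G)
    (hS : ∀ z ∈ layer L T, graphMap h σ z ∈ D)
    (hG : MemLp (fun z => (G (graphMap h σ z)).2) 2 (volume.restrict (layer L T))) :
    ∃ E, LineRep L T (fun z => u (graphMap h σ z)) (fun z => σ * (G (graphMap h σ z)).2) E := by
  obtain ⟨c, hc⟩ := exists_vertPrim_rep hD hs hu.locallyIntegrableOn hu.locallyIntegrableOn_snd
    hu.snd
  have hc' := (measurePreserving_graphMap hh hσ).quasiMeasurePreserving.ae hc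
  have hσ0 : σ ≠ 0 := by rcases hσ with rfl | rfl <;> norm_num
  have hσ1 : σ⁻¹ = σ := by rcases hσ with rfl | rfl <;> norm_num
  let g : ℝ × ℝ → ℝ := fun x => (G x).2
  -- The wall itself need not belong to `D`, so the initial value is extrapolated from the middle of
  -- the layer: the value at depth `T / 2` minus the integral of the derivative from `0` to `T / 2`.
  refine ⟨fun s => c s + (∫ z in (1 / 2 : ℝ)..(h s + σ * (T / 2)), g (s, z)) -
    ∫ τ in (0 : ℝ)..(T / 2), σ * g (s, h s + σ * τ), ?_⟩
  have hfin : IsFiniteMeasure (volume.restrict (layer L T)) := by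
    rw [volume_restrict_layer]; infer_instance
  have hGi : Integrable (fun z => (G (graphMap h σ z)).2) (volume.restrict (layer L T)) :=
    hG.integrable (by norm_num)
  have hloc := ae_locallyIntegrableOn_fiber hD hu.locallyIntegrableOn_snd
  unfold LineRep
  have h1 : ∀ᵐ z ∂volume.restrict (layer L T),
      IntegrableOn (fun τ => g (z.1, h z.1 + σ * τ)) (Ioo 0 T) := by
    rw [volume_restrict_layer] at hGi ⊢
    exact Measure.quasiMeasurePreserving_fst.ae hGi.prod_right_ae
  have h2 : ∀ᵐ z ∂volume.restrict (layer L T),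
      LocallyIntegrableOn (fun y => (G (z.1, y)).2) {y | (z.1, y) ∈ D} := by
    rw [volume_restrict_layer]
    exact Measure.quasiMeasurePreserving_fst.ae (ae_restrict_of_ae hloc)
  filter_upwards [h1, h2, ae_restrict_of_ae hc', ae_restrict_mem (measurableSet_layer L T)]
    with z hz1 hz2 hz3 hz4
  have hI : ∀ a b, a ∈ Icc 0 T → b ∈ Icc 0 T →
      IntervalIntegrable (fun τ => g (z.1, h z.1 + σ * τ)) volume a b := by
    intro a b ha hb
    rw [← integrableOn_Icc_iff_integrableOn_Ioo] at hz1
    exact (hz1.mono_set (uIcc_subset_Icc ha hb)).intervalIntegrable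
  have hJ : ∀ a b, (z.1, a) ∈ D → (z.1, b) ∈ D →
      IntervalIntegrable (fun y => g (z.1, y)) volume a b := by
    intro a b ha hb
    exact (hz2.integrableOn_compact_subset ((hs.ordConnected z.1).uIcc_subset ha hb)
      isCompact_uIcc).intervalIntegrable
  have hsub : ∀ a b, ∫ y in (h z.1 + σ * a)..(h z.1 + σ * b), g (z.1, y) =
      ∫ τ in a..b, σ * g (z.1, h z.1 + σ * τ) := by
    intro a b
    have := intervalIntegral.integral_comp_add_mul (a := a) (b := b)
      (fun y => g (z.1, y)) hσ0 (h z.1)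
    rw [intervalIntegral.integral_const_mul, this, hσ1, smul_eq_mul, ← mul_assoc]
    have : σ * σ = 1 := by rcases hσ with rfl | rfl <;> norm_num
    rw [this, one_mul]
  have hmid : (z.1, h z.1 + σ * (T / 2)) ∈ D :=
    hS (z.1, T / 2) ⟨hz4.1, by constructor <;> simp only <;> linarith⟩
  have hend : (z.1, h z.1 + σ * z.2) ∈ D := hS z hz4
  have hhalf : (z.1, (1 / 2 : ℝ)) ∈ D := hs.mem_half hmid
  rw [hz3 (hS z hz4)]
  have hz22 := hz4.2
  change c z.1 + (∫ y in (1 / 2)..(h z.1 + σ * z.2), g (z.1, y)) = _ + ∫ τ in (0 : ℝ)..z.2, σ * g (z.1, h z.1 + σ * τ)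
  rw [← intervalIntegral.integral_add_adjacent_intervals (hJ _ _ hhalf hmid) (hJ _ _ hmid hend),
    hsub, ← intervalIntegral.integral_add_adjacent_intervals
      (a := 0) (b := T / 2) (c := z.2)
      ((hI _ _ ⟨le_rfl, hT.le⟩ ⟨by linarith, by linarith⟩).const_mul σ)
      ((hI _ _ ⟨by linarith, by linarith⟩ ⟨hz22.1.le, hz22.2.le⟩).const_mul σ)]
  ring

lemma memLp_comp_graphMap {E : Type*} [NormedAddCommGroup E] {w : ℝ × ℝ → E}
    {h : ℝ → ℝ} (hh : Measurable h) {σ : ℝ} (hσ : σ = 1 ∨ σ = -1)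
    {A Q : Set (ℝ × ℝ)} (hA : MeasurableSet A) (hS : ∀ z ∈ Q, graphMap h σ z ∈ A)
    (hw : MemLp w 2 (volume.restrict A)) :
    MemLp (fun z => w (graphMap h σ z)) 2 (volume.restrict Q) :=
  (hw.comp_measurePreserving (measurePreserving_graphMap_restrict hh hσ hA)).mono_measure
    (Measure.restrict_mono hS le_rfl)

lemma aestronglyMeasurable_comp_graphMap {E : Type*} [NormedAddCommGroup E] {w : ℝ × ℝ → E}
    {h : ℝ → ℝ} (hh : Measurable h) {σ : ℝ} (hσ : σ = 1 ∨ σ = -1)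
    {A Q : Set (ℝ × ℝ)} (hA : MeasurableSet A) (hS : ∀ z ∈ Q, graphMap h σ z ∈ A)
    (hw : AEStronglyMeasurable w (volume.restrict A)) :
    AEStronglyMeasurable (fun z => w (graphMap h σ z)) (volume.restrict Q) :=
  (hw.comp_measurePreserving (measurePreserving_graphMap_restrict hh hσ hA)).mono_measure
    (Measure.restrict_mono hS le_rfl)

/-- The data that describe a layer along a graph inside a domain. -/
structure IsLayer (D : Set (ℝ × ℝ)) (L T σ : ℝ) (h : ℝ → ℝ) : Prop where
  isOpen : IsOpen D
  star : IsVertStar D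
  measurable : Measurable h
  sign : σ = 1 ∨ σ = -1
  pos : 0 < T
  mem : ∀ z ∈ layer L T, graphMap h σ z ∈ D

lemma IsLayer.mem_periodCell {L T σ : ℝ} {h : ℝ → ℝ} (hl : IsLayer D L T σ h) :
    ∀ z ∈ layer L T, graphMap h σ z ∈ periodCell D L := fun z hz => ⟨hl.mem z hz, hz.1⟩

lemma measurableSet_periodCell (hD : IsOpen D) (L : ℝ) : MeasurableSet (periodCell D L) :=
  hD.measurableSet.inter (measurable_fst measurableSet_Ioo)

lemma IsLayer.memLp_snd {L T σ : ℝ} {h : ℝ → ℝ} (hl : IsLayer D L T σ h)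
    (hG : MemLp G 2 (volume.restrict (periodCell D L))) :
    MemLp (fun z => (G (graphMap h σ z)).2) 2 (volume.restrict (layer L T)) :=
  memLp_comp_graphMap (w := fun x => (G x).2) hl.measurable hl.sign
    (measurableSet_periodCell hl.isOpen L) hl.mem_periodCell hG.snd

/-- A trace is the initial value of the primitives on vertical lines. -/
theorem HasTrace.lineRep {L T σ : ℝ} {h g₀ : ℝ → ℝ} (hl : IsLayer D L T σ h)
    (hu : IsWeakGradient D u G) (hG : MemLp G 2 (volume.restrict (periodCell D L)))
    (ht : HasTrace L σ h u g₀) :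
    LineRep L T (fun z => u (graphMap h σ z)) (fun z => σ * (G (graphMap h σ z)).2) g₀ := by
  have hG' := hl.memLp_snd hG
  obtain ⟨E, hE⟩ := exists_lineRep hl.measurable hl.sign hl.pos hl.isOpen hl.star hu hl.mem hG'
  refine hE.congr_init (hE.ae_eq_of_tendsto hl.pos (hG'.const_mul σ) ?_ ht.memLp.1 ht.tendsto)
  exact aestronglyMeasurable_comp_graphMap hl.measurable hl.sign hl.isOpen.measurableSet hl.mem
    hu.locallyIntegrableOn.aestronglyMeasurable

theorem LineRep.hasTrace {L T σ : ℝ} {h g₀ : ℝ → ℝ} (hl : IsLayer D L T σ h)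
    (hG : MemLp G 2 (volume.restrict (periodCell D L)))
    (hg₀ : MemLp g₀ 2 (volume.restrict (Ioo 0 L)))
    (hr : LineRep L T (fun z => u (graphMap h σ z)) (fun z => σ * (G (graphMap h σ z)).2) g₀) :
    HasTrace L σ h u g₀ :=
  ⟨hg₀, hr.tendsto hl.pos ((hl.memLp_snd hG).const_mul σ)⟩

end WallLaw

namespace WallLaw

variable {D : Set (ℝ × ℝ)} {u v w : ℝ × ℝ → ℝ} {G H : ℝ × ℝ → ℝ × ℝ} {f : ℝ → ℝ}

/-! ### Elementary facts on traces -/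

lemma hasTrace_zero_of_layer_eq_zero {L σ d₀ : ℝ} {h : ℝ → ℝ} (hd₀ : 0 < d₀)
    (hv : ∀ s ∈ Ioo 0 L, ∀ t ∈ Ioo 0 d₀, v (s, h s + σ * t) = 0) : HasTrace L σ h v 0 := by
  refine ⟨MemLp.zero, ?_⟩
  refine tendsto_const_nhds.congr' ?_
  filter_upwards [Ioo_mem_nhdsGT hd₀] with d hd
  have : ∫⁻ t in Ioo 0 d, ∫⁻ s in Ioo 0 L, ‖v (s, h s + σ * t) - (0 : ℝ → ℝ) s‖ₑ ^ 2 = 0 := by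
    rw [setLIntegral_congr_fun measurableSet_Ioo (g := fun _ => 0), lintegral_zero]
    intro t ht
    simp only
    rw [setLIntegral_congr_fun measurableSet_Ioo (g := fun _ => 0), lintegral_zero]
    intro s hs
    simp [hv s hs t ⟨ht.1, ht.2.trans hd.2⟩]
  rw [this, mul_zero]

lemma HasTrace.zero_of_le {L σ d₀ M : ℝ} {h g₀ : ℝ → ℝ} (hd₀ : 0 < d₀) (hM : 0 ≤ M)
    (ht : HasTrace L σ h u g₀)
    (hv : ∀ s ∈ Ioo 0 L, ∀ t ∈ Ioo 0 d₀,
      |v (s, h s + σ * t)| ≤ M * |u (s, h s + σ * t) - g₀ s|) :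
    HasTrace L σ h v 0 := by
  refine ⟨MemLp.zero, ?_⟩
  have hlim := ENNReal.Tendsto.const_mul ht.tendsto (a := ENNReal.ofReal M ^ 2)
    (Or.inr (by simp))
  rw [mul_zero] at hlim
  refine tendsto_of_tendsto_of_tendsto_of_le_of_le' tendsto_const_nhds hlim
    (Eventually.of_forall fun _ => zero_le) ?_
  filter_upwards [Ioo_mem_nhdsGT hd₀] with d hd
  rw [mul_left_comm]
  gcongr
  rw [← lintegral_const_mul' _ _ (by simp)]
  apply setLIntegral_mono_ae' measurableSet_Ioo
  refine ae_of_all _ fun t ht => ?_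
  rw [← lintegral_const_mul' _ _ (by simp)]
  apply setLIntegral_mono_ae' measurableSet_Ioo
  refine ae_of_all _ fun s hs => ?_
  rw [← mul_pow]
  gcongr
  have := hv s hs t ⟨ht.1, ht.2.trans hd.2⟩
  rw [Pi.zero_apply, sub_zero, ← ofReal_norm, ← ofReal_norm, ← ENNReal.ofReal_mul hM]
  exact ENNReal.ofReal_le_ofReal (by simpa using this)

/-- The inverse of a graph map is the graph map of `-σ h` with the same sign, hence also measure
preserving. -/
lemma ae_of_ae_graphMap {h : ℝ → ℝ} (hh : Measurable h) {σ : ℝ} (hσ : σ = 1 ∨ σ = -1)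
    {p : ℝ × ℝ → Prop} (hp : ∀ᵐ z, p (graphMap h σ z)) : ∀ᵐ x, p x := by
  have hm : Measurable fun s => -(σ * h s) := by fun_prop
  have := (measurePreserving_graphMap hm hσ).quasiMeasurePreserving.ae hp
  filter_upwards [this] with x hx
  have hσσ : σ * σ = 1 := by rcases hσ with rfl | rfl <;> norm_num
  have e : graphMap h σ (graphMap (fun s => -(σ * h s)) σ x) = x := by
    ext
    · rfl
    · simp only [graphMap]
      linear_combination (x.2 - h x.1) * hσσ
  rwa [e] at hx

/-! ### The profile and its layers -/

lemma IsRoughProfile.lt_zero (hf : IsRoughProfile f) (s : ℝ) : f s < 0 := (hf.mem_Ico s).2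

lemma IsRoughProfile.continuous (hf : IsRoughProfile f) : Continuous f :=
  let ⟨_, h⟩ := hf.lipschitz
  h.continuous

lemma IsRoughProfile.isOpen (hf : IsRoughProfile f) : IsOpen (cellDomain f) :=
  isOpen_cellDomain hf.continuous

lemma isLayer_graph {h : ℝ → ℝ} (hh : Continuous h) (hneg : ∀ s, h s < 0) {L T : ℝ} (hT : 0 < T) :
    IsLayer (cellDomain h) L T 1 h where
  isOpen := isOpen_cellDomain hh
  star := isVertStar_cellDomain hneg
  measurable := hh.measurable
  sign := Or.inl rfl
  pos := hT
  mem := fun z hz => by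
    change h z.1 < h z.1 + 1 * z.2
    have := hz.2.1
    linarith

lemma isLayer_zero {h : ℝ → ℝ} (hh : Continuous h) (hneg : ∀ s, h s < 0) {L T : ℝ} (hT : 0 < T) :
    IsLayer (cellDomain h) L T 1 (fun _ => 0) where
  isOpen := isOpen_cellDomain hh
  star := isVertStar_cellDomain hneg
  measurable := measurable_const
  sign := Or.inl rfl
  pos := hT
  mem := fun z hz => by
    change h z.1 < 0 + 1 * z.2
    have := hz.2.1
    linarith [hneg z.1]

/-! ### Weak maximum principle for the cell problem -/

/-- The weak equation of the cell problem. -/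
def CellEq (f : ℝ → ℝ) (G : ℝ × ℝ → ℝ × ℝ) : Prop :=
  ∀ v H, MemD12 (cellDomain f) (2 * Real.pi) v H → HasTrace (2 * Real.pi) 1 f v 0 →
    dirichletForm (periodCell (cellDomain f) (2 * Real.pi)) G H = 0

/-- A bounded continuous function that is positive exactly on `(0, ∞)`. -/
def ramp (t : ℝ) : ℝ := min (max t 0) 1

lemma continuous_ramp : Continuous ramp := by unfold ramp; fun_prop

lemma ramp_nonneg (t : ℝ) : 0 ≤ ramp t := le_min (le_max_right _ _) zero_le_one

lemma ramp_le_one (t : ℝ) : ramp t ≤ 1 := min_le_right _ _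

lemma ramp_of_nonpos {t : ℝ} (h : t ≤ 0) : ramp t = 0 := by simp [ramp, h]

lemma ramp_pos {t : ℝ} (h : 0 < t) : 0 < ramp t := lt_min (lt_max_of_lt_left h) one_pos

/-- The primitive of `ramp`. -/
def softPos (t : ℝ) : ℝ := ∫ s in (0 : ℝ)..t, ramp s

lemma hasDerivAt_softPos (t : ℝ) : HasDerivAt softPos (ramp t) t :=
  intervalIntegral.integral_hasDerivAt_right (continuous_ramp.intervalIntegrable _ _)
    (continuous_ramp.stronglyMeasurableAtFilter _ _) continuous_ramp.continuousAt

lemma abs_ramp_le (t : ℝ) : |ramp t| ≤ 1 := by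
  rw [abs_of_nonneg (ramp_nonneg t)]; exact ramp_le_one t

lemma softPos_of_nonpos {t : ℝ} (h : t ≤ 0) : softPos t = 0 := by
  unfold softPos
  rw [intervalIntegral.integral_symm, intervalIntegral.integral_of_le h, neg_eq_zero]
  exact setIntegral_eq_zero_of_forall_eq_zero fun s hs => ramp_of_nonpos hs.2

lemma softPos_pos {t : ℝ} (h : 0 < t) : 0 < softPos t :=
  intervalIntegral.intervalIntegral_pos_of_pos_on (continuous_ramp.intervalIntegrable _ _)
    (fun _ hs => ramp_pos hs.1) h

lemma abs_softPos_sub_le (x y : ℝ) : |softPos x - softPos y| ≤ |x - y| := by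
  simpa using lipschitz_of_hasDerivAt_le hasDerivAt_softPos abs_ramp_le x y

lemma MemD12.aestronglyMeasurable {L : ℝ} (h : MemD12 D L u G) :
    AEStronglyMeasurable u (volume.restrict (periodCell D L)) :=
  h.isWeakGradient.locallyIntegrableOn.aestronglyMeasurable.mono_measure
    (Measure.restrict_mono (fun _ hx => hx.1) le_rfl)

/-- If the boundary values are nonpositive, so is the solution of the cell problem. -/
theorem cell_nonpos (hf : IsRoughProfile f) (hw : MemD12 (cellDomain f) (2 * Real.pi) w G)
    {g₀ : ℝ → ℝ} (ht : HasTrace (2 * Real.pi) 1 f w g₀) (hg₀ : ∀ s, g₀ s ≤ 0)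
    (heq : CellEq f G) :
    ∀ᵐ x ∂volume.restrict (periodCell (cellDomain f) (2 * Real.pi)), w x ≤ 0 := by
  obtain ⟨K, hK⟩ := hf.lipschitz
  set D := cellDomain f
  set A := periodCell D (2 * Real.pi)
  have hDo : IsOpen D := hf.isOpen
  have hA : MeasurableSet A := measurableSet_periodCell hDo _
  -- The test function is a `C¹` substitute for the positive part: its bounded continuous derivative
  -- admits the chain rule, and it vanishes exactly where `w ≤ 0`.
  have hwg : IsWeakGradient D (fun x => softPos (w x)) (fun x => ramp (w x) • G x) :=
    hw.isWeakGradient.comp_of_lipschitz hK hf.lt_zero hasDerivAt_softPos continuous_ramp abs_ramp_le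
  have hm : AEStronglyMeasurable (fun x => ramp (w x)) (volume.restrict A) :=
    continuous_ramp.comp_aestronglyMeasurable hw.aestronglyMeasurable
  have hLp : MemLp (fun x => ramp (w x) • G x) 2 (volume.restrict A) := by
    refine hw.memLp_grad.of_le (hm.smul hw.memLp_grad.1) (ae_of_all _ fun x => ?_)
    rw [norm_smul, Real.norm_eq_abs]
    exact mul_le_of_le_one_left (norm_nonneg _) (abs_ramp_le _)
  have hv : MemD12 D (2 * Real.pi) (fun x => softPos (w x)) (fun x => ramp (w x) • G x) := by
    refine ⟨hwg, ?_, ?_, hLp⟩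
    · filter_upwards [hw.periodic] with x hx
      rw [hx]
    · filter_upwards [hw.periodic, hw.periodic_grad] with x hx hx'
      rw [hx, hx']
  have htv : HasTrace (2 * Real.pi) 1 f (fun x => softPos (w x)) 0 := by
    refine ht.zero_of_le (d₀ := 1) (M := 1) one_pos zero_le_one fun s _ t _ => ?_
    -- `softPos` is 1-Lipschitz and vanishes at the nonpositive boundary value, so it is at most the
    -- distance of `w` to its trace.
    have := abs_softPos_sub_le (w (s, f s + 1 * t)) (g₀ s)
    rwa [softPos_of_nonpos (hg₀ s), sub_zero, ← one_mul |w _ - _|] at this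
  have h0 := heq _ _ hv htv
  -- The tested equation says that the integral of `ramp w |∇w|²` vanishes, so `softPos w` has zero
  -- gradient. The vertical component is all that is used.
  have hint : ∀ᵐ x ∂volume.restrict A, ramp (w x) * (G x).2 = 0 := by
    unfold dirichletForm at h0
    have hi : Integrable (fun x => (G x).1 * (ramp (w x) • G x).1 +
        (G x).2 * (ramp (w x) • G x).2) (volume.restrict A) :=
      (hw.memLp_grad.fst.integrable_mul hLp.fst).add (hw.memLp_grad.snd.integrable_mul hLp.snd)
    rw [integral_eq_zero_iff_of_nonneg_ae (ae_of_all _ fun x => ?_) hi] at h0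
    · filter_upwards [h0] with x hx
      simp only [Prod.smul_fst, Prod.smul_snd, smul_eq_mul, Pi.zero_apply] at hx
      have h1 : ramp (w x) * ((G x).1 ^ 2 + (G x).2 ^ 2) = 0 := by linarith
      rcases mul_eq_zero.1 h1 with h2 | h2
      · rw [h2, zero_mul]
      · have : (G x).2 = 0 := by nlinarith [sq_nonneg (G x).1, sq_nonneg (G x).2]
        rw [this, mul_zero]
    · simp only [Prod.smul_fst, Prod.smul_snd, smul_eq_mul, Pi.zero_apply]
      have : 0 ≤ ramp (w x) * ((G x).1 ^ 2 + (G x).2 ^ 2) :=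
        mul_nonneg (ramp_nonneg _) (by positivity)
      linarith
  -- With zero trace on the wall and zero vertical derivative, `softPos w` vanishes on vertical
  -- lines. The heights `n + 1` exhaust the unbounded cell.
  have hlay : ∀ n : ℕ, ∀ᵐ z ∂volume.restrict (layer (2 * Real.pi) (n + 1)),
      softPos (w (graphMap f 1 z)) = 0 := by
    intro n
    have hl : IsLayer D (2 * Real.pi) (n + 1) 1 f :=
      isLayer_graph hf.continuous hf.lt_zero (by positivity)
    have hr := htv.lineRep hl hwg hLp
    have h1 : ∀ᵐ z ∂volume.restrict (layer (2 * Real.pi) (n + 1)),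
        ramp (w (graphMap f 1 z)) * (G (graphMap f 1 z)).2 = 0 :=
      ae_restrict_of_ae_restrict_of_subset hl.mem_periodCell
        ((measurePreserving_graphMap_restrict hl.measurable hl.sign hA).quasiMeasurePreserving.ae hint)
    have h2 : ∀ᵐ z ∂volume.restrict (layer (2 * Real.pi) (n + 1)),
        ∀ᵐ τ ∂volume.restrict (Ioo (0 : ℝ) (n + 1)),
          ramp (w (graphMap f 1 (z.1, τ))) * (G (graphMap f 1 (z.1, τ))).2 = 0 := by
      rw [volume_restrict_layer] at h1 ⊢
      exact Measure.quasiMeasurePreserving_fst.ae (Measure.ae_ae_of_ae_prod h1)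
    filter_upwards [hr, h2, ae_restrict_mem (measurableSet_layer _ _)] with z hz1 hz2 hz3
    rw [hz1, Pi.zero_apply, zero_add, intervalIntegral.integral_of_le hz3.2.1.le,
      integral_Ioc_eq_integral_Ioo]
    apply integral_eq_zero_of_ae
    have := ae_restrict_of_ae_restrict_of_subset (Ioo_subset_Ioo_right hz3.2.2.le) hz2
    filter_upwards [this] with τ hτ
    simpa using hτ
  rw [ae_restrict_iff' hA]
  have hall : ∀ᵐ z, ∀ n : ℕ, z ∈ layer (2 * Real.pi) (n + 1) → softPos (w (graphMap f 1 z)) = 0 :=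
    ae_all_iff.2 fun n => (ae_restrict_iff' (measurableSet_layer _ _)).1 (hlay n)
  refine ae_of_ae_graphMap hf.continuous.measurable (Or.inl rfl) ?_
  filter_upwards [hall] with z hz hzA
  obtain ⟨n, hn⟩ := exists_nat_gt z.2
  have hzD : f z.1 < f z.1 + 1 * z.2 := hzA.1
  have h1 := hz n ⟨hzA.2, by constructor <;> linarith⟩
  by_contra hcon
  exact (softPos_pos (not_le.1 hcon)).ne' h1

end WallLaw

namespace WallLaw

variable {D : Set (ℝ × ℝ)} {u v w β : ℝ × ℝ → ℝ} {G H : ℝ × ℝ → ℝ × ℝ} {f : ℝ → ℝ}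

/-! ### Horizontal means of cell solutions -/

lemma memLp_prodMk {α : Type*} [MeasurableSpace α] {μ : Measure α} {a b : α → ℝ}
    (ha : MemLp a 2 μ) (hb : MemLp b 2 μ) : MemLp (fun x => (a x, b x)) 2 μ := by
  refine (ha.norm.add hb.norm).of_le (ha.1.prodMk hb.1) (ae_of_all _ fun x => ?_)
  simp only [Prod.norm_def, Pi.add_apply, Real.norm_eq_abs]
  refine le_trans ?_ (le_abs_self _)
  exact max_le (le_add_of_nonneg_right (abs_nonneg _)) (le_add_of_nonneg_left (abs_nonneg _))

/-- The upper half of a period cell, above the interface. -/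
def upperCell : Set (ℝ × ℝ) := Ioo 0 (2 * Real.pi) ×ˢ Ioi 0

lemma measurableSet_upperCell : MeasurableSet upperCell := measurableSet_Ioo.prod measurableSet_Ioi

lemma volume_restrict_upperCell : (volume : Measure (ℝ × ℝ)).restrict upperCell =
    (volume.restrict (Ioo 0 (2 * Real.pi))).prod (volume.restrict (Ioi 0)) := by
  rw [Measure.volume_eq_prod, upperCell, Measure.prod_restrict]

lemma upperCell_subset (hf : IsRoughProfile f) :
    upperCell ⊆ periodCell (cellDomain f) (2 * Real.pi) := fun x hx =>
  ⟨(hf.lt_zero x.1).trans hx.2, hx.1⟩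

lemma contDiff_primitive {a : ℝ → ℝ} (ha : ContDiff ℝ ∞ a) :
    ContDiff ℝ ∞ (fun y => ∫ s in (0 : ℝ)..y, a s) ∧
      ∀ y, deriv (fun y => ∫ s in (0 : ℝ)..y, a s) y = a y := by
  have hd : ∀ y, HasDerivAt (fun y => ∫ s in (0 : ℝ)..y, a s) (a y) y := fun y =>
    intervalIntegral.integral_hasDerivAt_right (ha.continuous.intervalIntegrable _ _)
      (ha.continuous.stronglyMeasurableAtFilter _ _) ha.continuous.continuousAt
  have hd' : deriv (fun y => ∫ s in (0 : ℝ)..y, a s) = a := funext fun y => (hd y).deriv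
  refine ⟨?_, fun y => (hd y).deriv⟩
  rw [contDiff_infty_iff_deriv]
  exact ⟨fun y => (hd y).differentiableAt, by rw [hd']; exact ha⟩

/-- The vertical flux of a cell solution through horizontal lines above the interface vanishes. -/
lemma cell_flux_eq_zero (hf : IsRoughProfile f)
    (hG : MemLp G 2 (volume.restrict (periodCell (cellDomain f) (2 * Real.pi))))
    (heq : CellEq f G) :
    ∀ᵐ t, t ∈ Ioi (0 : ℝ) → ∫ s in Ioo 0 (2 * Real.pi), (G (s, t)).2 = 0 := by
  set A := periodCell (cellDomain f) (2 * Real.pi)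
  have hG2 : MemLp (fun x => (G x).2) 2 (volume.restrict upperCell) :=
    hG.snd.mono_measure (Measure.restrict_mono (upperCell_subset hf) le_rfl)
  apply isOpen_Ioi.ae_eq_zero_of_integral_contDiff_smul_eq_zero
  · intro t ht
    refine ⟨Ioo 0 (t + 1), mem_nhdsWithin_of_mem_nhds (Ioo_mem_nhds ht (by linarith)), ?_⟩
    have h1 : MemLp (fun x => (G x).2) 2 (volume.restrict (layer (2 * Real.pi) (t + 1))) :=
      hG2.mono_measure (Measure.restrict_mono (Set.prod_mono le_rfl Ioo_subset_Ioi_self) le_rfl)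
    have hfin : IsFiniteMeasure (volume.restrict (layer (2 * Real.pi) (t + 1))) := by
      rw [volume_restrict_layer]; infer_instance
    have h2 : Integrable (fun x => (G x).2) (volume.restrict (layer (2 * Real.pi) (t + 1))) :=
      h1.integrable (by norm_num)
    rw [volume_restrict_layer] at h2
    exact h2.integral_prod_right
  intro a ha hac has
  obtain ⟨hA1, hA2⟩ := contDiff_primitive ha
  -- The test function `P y₂` is zero below the interface and constant above the support of `a`. It
  -- need not be square integrable, but its gradient is, and only that is required of test functions
  -- in the cell.
  set P : ℝ → ℝ := fun y => ∫ s in (0 : ℝ)..y, a s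
  have ha0 : ∀ y, y ≤ 0 → a y = 0 := fun y hy => by
    by_contra h
    exact absurd (has (subset_tsupport a h)) (not_lt.2 hy)
  have hP0 : ∀ y, y ≤ 0 → P y = 0 := fun y hy => by
    simp only [P]
    rw [intervalIntegral.integral_symm, intervalIntegral.integral_of_le hy, neg_eq_zero]
    exact setIntegral_eq_zero_of_forall_eq_zero fun s hs => ha0 s hs.2
  have haL : MemLp (fun x : ℝ × ℝ => a x.2) 2 (volume.restrict A) := by
    have h1 : MemLp a 2 (volume : Measure ℝ) := ha.continuous.memLp_of_hasCompactSupport hac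
    have h2 := h1.comp_snd (volume.restrict (Ioo (0 : ℝ) (2 * Real.pi)))
    have h3 : (volume.restrict (Ioo (0 : ℝ) (2 * Real.pi))).prod (volume : Measure ℝ) =
        (volume : Measure (ℝ × ℝ)).restrict (Ioo 0 (2 * Real.pi) ×ˢ univ) := by
      rw [Measure.volume_eq_prod, ← Measure.prod_restrict, Measure.restrict_univ]
    rw [h3] at h2
    have hsub : A ⊆ Ioo 0 (2 * Real.pi) ×ˢ univ := fun x hx => ⟨hx.2, trivial⟩
    exact h2.mono_measure (Measure.restrict_mono hsub le_rfl)
  have hmem : MemD12 (cellDomain f) (2 * Real.pi) (fun x => P x.2) (fun x => (0, a x.2)) := by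
    have hw := isWeakGradient_comp_snd (D := cellDomain f) hA1
    simp only [hA2] at hw
    exact ⟨hw, ae_of_all _ fun _ => rfl, ae_of_all _ fun _ => rfl,
      memLp_prodMk (MemLp.zero (ε := ℝ)) haL⟩
  obtain ⟨δ, hδ, hfδ⟩ := hf.away
  have htr : HasTrace (2 * Real.pi) 1 f (fun x => P x.2) 0 :=
    hasTrace_zero_of_layer_eq_zero hδ fun s _ t ht => hP0 _ (by linarith [hfδ s, ht.2])
  have h0 := heq _ _ hmem htr
  unfold dirichletForm at h0
  simp only [mul_zero, zero_add] at h0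
  have haU : MemLp (fun x : ℝ × ℝ => a x.2) 2 (volume.restrict upperCell) :=
    haL.mono_measure (Measure.restrict_mono (upperCell_subset hf) le_rfl)
  have hsub : ∫ x in A, (G x).2 * a x.2 = ∫ x in upperCell, (G x).2 * a x.2 := by
    refine setIntegral_eq_of_subset_of_forall_sdiff_eq_zero
      (measurableSet_periodCell hf.isOpen _) (upperCell_subset hf) fun x hx => ?_
    rw [ha0, mul_zero]
    by_contra hcon
    exact hx.2 ⟨hx.1.2, not_le.1 hcon⟩
  have hi : Integrable (fun x => (G x).2 * a x.2) (volume.restrict upperCell) :=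
    hG2.integrable_mul haU
  rw [hsub, volume_restrict_upperCell] at h0
  rw [volume_restrict_upperCell] at hi
  rw [integral_prod_symm _ hi] at h0
  have : ∫ t in Ioi (0 : ℝ), a t • ∫ s in Ioo 0 (2 * Real.pi), (G (s, t)).2 =
      ∫ t, a t • ∫ s in Ioo 0 (2 * Real.pi), (G (s, t)).2 := by
    refine setIntegral_eq_integral_of_forall_compl_eq_zero fun t ht => ?_
    rw [ha0 t (not_lt.1 ht), zero_smul]
  rw [← this]
  refine Eq.trans ?_ h0
  refine integral_congr_ae (ae_of_all _ fun t => ?_)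
  simp only
  rw [integral_mul_const, smul_eq_mul, mul_comm]

lemma graphMap_zero_one (z : ℝ × ℝ) : graphMap (fun _ => 0) 1 z = z := by simp [graphMap]

/-- The horizontal means of a cell solution above the interface are constant. -/
lemma cell_mean (hf : IsRoughProfile f) (hβ : MemD12 (cellDomain f) (2 * Real.pi) β G)
    (heq : CellEq f G) {m : ℝ} (hm : IsInterfaceMean β m) :
    ∀ᵐ t, t ∈ Ioi (0 : ℝ) → ∫ s in Ioo 0 (2 * Real.pi), β (s, t) = 2 * Real.pi * m := by
  obtain ⟨η, hη, hmη⟩ := hm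
  have hpi : (0 : ℝ) < 2 * Real.pi := by positivity
  have hηm : ∫ s in Ioo 0 (2 * Real.pi), η s = 2 * Real.pi * m := by
    rw [hmη, intervalIntegral.integral_of_le hpi.le, integral_Ioc_eq_integral_Ioo]
    field_simp
  have hflux := cell_flux_eq_zero hf hβ.memLp_grad heq
  have hn : ∀ n : ℕ, ∀ᵐ t, t ∈ Ioo (0 : ℝ) (n + 1) →
      ∫ s in Ioo 0 (2 * Real.pi), β (s, t) = 2 * Real.pi * m := by
    intro n
    have hl : IsLayer (cellDomain f) (2 * Real.pi) (n + 1) 1 (fun _ => 0) :=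
      isLayer_zero hf.continuous hf.lt_zero (by positivity)
    have hr := hη.lineRep hl hβ.isWeakGradient hβ.memLp_grad
    have hGl := hl.memLp_snd hβ.memLp_grad
    simp only [graphMap_zero_one, one_mul] at hr hGl
    have h1 := (ae_restrict_iff' measurableSet_Ioo).1 hr.ae_ae_swap
    filter_upwards [h1] with t ht htn
    have h2 : MemLp (fun z => (G z).2) 2 (volume.restrict (layer (2 * Real.pi) t)) :=
      hGl.mono_measure (Measure.restrict_mono
        (Set.prod_mono le_rfl (Ioo_subset_Ioo_right htn.2.le)) le_rfl)
    have hfin : IsFiniteMeasure (volume.restrict (layer (2 * Real.pi) t)) := by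
      rw [volume_restrict_layer]; infer_instance
    have h3 : Integrable (fun z => (G z).2) (volume.restrict (layer (2 * Real.pi) t)) :=
      h2.integrable (by norm_num)
    rw [volume_restrict_layer] at h3
    have hηi : Integrable η (volume.restrict (Ioo 0 (2 * Real.pi))) :=
      hη.memLp.integrable (by norm_num)
    have e1 : ∀ s, ∫ τ in (0 : ℝ)..t, (G (s, τ)).2 = ∫ τ in Ioo 0 t, (G (s, τ)).2 := fun s => by
      rw [intervalIntegral.integral_of_le htn.1.le, integral_Ioc_eq_integral_Ioo]
    -- The representation from the interface is integrated over one period; after Fubini the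
    -- derivative term is the integral of the fluxes, which vanish.
    calc ∫ s in Ioo 0 (2 * Real.pi), β (s, t)
        = ∫ s in Ioo 0 (2 * Real.pi), (η s + ∫ τ in Ioo 0 t, (G (s, τ)).2) := by
          apply integral_congr_ae
          filter_upwards [ht htn] with s hs
          rw [hs, e1]
      _ = (∫ s in Ioo 0 (2 * Real.pi), η s) +
          ∫ s in Ioo 0 (2 * Real.pi), ∫ τ in Ioo 0 t, (G (s, τ)).2 :=
          integral_add hηi h3.integral_prod_left
      _ = 2 * Real.pi * m := by
          rw [hηm, integral_integral_swap h3]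
          have : ∫ τ in Ioo 0 t, ∫ s in Ioo 0 (2 * Real.pi), (G (s, τ)).2 = 0 := by
            apply integral_eq_zero_of_ae
            filter_upwards [ae_restrict_of_ae hflux, ae_restrict_mem measurableSet_Ioo] with τ hτ hτ'
            exact hτ hτ'.1
          rw [this, add_zero]
  filter_upwards [ae_all_iff.2 hn] with t ht ht0
  obtain ⟨n, hn⟩ := exists_nat_gt t
  exact ht n ⟨ht0, by linarith⟩

/-- A Poincaré inequality for primitives on an interval. -/
lemma wirtinger_interval {g b : ℝ → ℝ} {l c m : ℝ} (hl : 1 / 2 < l)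
    (hg : IntegrableOn g (Ioo 0 l))
    (hb : ∀ᵐ s ∂volume.restrict (Ioo 0 l), b s = c + ∫ x in (1 / 2 : ℝ)..s, g x)
    (hm : ∫ s in Ioo 0 l, b s = l * m) :
    ∀ᵐ s ∂volume.restrict (Ioo 0 l),
      ‖b s - m‖ₑ ^ 2 ≤ ENNReal.ofReal l * ∫⁻ x in Ioo 0 l, ‖g x‖ₑ ^ 2 := by
  have hl0 : 0 < l := by linarith
  set J := ∫ x in (0 : ℝ)..l, ‖g x‖
  have hgI : ∀ s ∈ Icc 0 l, ∀ s' ∈ Icc 0 l, IntervalIntegrable g volume s s' := by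
    intro s hs s' hs'
    rw [← integrableOn_Icc_iff_integrableOn_Ioo] at hg
    exact (hg.mono_set (uIcc_subset_Icc hs hs')).intervalIntegrable
  have hJ : ∀ s ∈ Ioo 0 l, ∀ s' ∈ Ioo 0 l,
      |(∫ x in (1 / 2 : ℝ)..s, g x) - ∫ x in (1 / 2 : ℝ)..s', g x| ≤ J := by
    intro s hs s' hs'
    have hh : (1 / 2 : ℝ) ∈ Icc 0 l := ⟨by norm_num, hl.le⟩
    rw [intervalIntegral.integral_interval_sub_left (hgI _ hh _ ⟨hs.1.le, hs.2.le⟩)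
      (hgI _ hh _ ⟨hs'.1.le, hs'.2.le⟩)]
    have h1 := intervalIntegral.norm_integral_le_integral_norm_uIoc (f := g) (a := s') (b := s)
      (μ := volume)
    rw [Real.norm_eq_abs] at h1
    refine h1.trans ?_
    simp only [J]
    rw [intervalIntegral.integral_of_le hl0.le]
    refine setIntegral_mono_set ?_ (ae_of_all _ fun _ => norm_nonneg _) ?_
    · exact (hgI 0 ⟨le_rfl, hl0.le⟩ l ⟨hl0.le, le_rfl⟩).norm.1
    · refine LE.le.eventuallyLE ?_
      refine Ioc_subset_Ioc ?_ ?_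
      · exact le_min hs'.1.le hs.1.le
      · exact max_le hs'.2.le hs.2.le
  have hbi : IntegrableOn b (Ioo 0 l) := by
    have hcont : ContinuousOn (fun s => c + ∫ x in (1 / 2 : ℝ)..s, g x) (uIcc 0 l) := by
      refine continuousOn_const.add ?_
      refine intervalIntegral.continuousOn_primitive_interval' (hgI 0 ⟨le_rfl, hl0.le⟩ l ⟨hl0.le, le_rfl⟩) ?_
      rw [uIcc_of_le hl0.le]; exact ⟨by norm_num, hl.le⟩
    have h1 : IntegrableOn (fun s => c + ∫ x in (1 / 2 : ℝ)..s, g x) (Ioo 0 l) := by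
      rw [uIcc_of_le hl0.le] at hcont
      exact (hcont.integrableOn_compact isCompact_Icc).mono_set Ioo_subset_Icc_self
    exact h1.congr (hb.mono fun s hs => hs.symm)
  have hvol : (volume.restrict (Ioo 0 l)).real univ = l := by
    simp [hl0.le]
  have key : ∀ᵐ s ∂volume.restrict (Ioo 0 l), |b s - m| ≤ J := by
    filter_upwards [hb, ae_restrict_mem measurableSet_Ioo] with s hs hsl
    -- `b s - m` is the mean over `s'` of `b s - b s'`, hence bounded by the oscillation `J`.
    have h1 : l * (b s - m) = ∫ s' in Ioo 0 l, (b s - b s') := by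
      rw [integral_sub (integrable_const _) hbi, hm, integral_const, hvol, smul_eq_mul]
      ring
    have h2 : ‖∫ s' in Ioo 0 l, (b s - b s')‖ ≤ J * (volume.restrict (Ioo 0 l)).real univ := by
      apply norm_integral_le_of_norm_le_const
      filter_upwards [hb, ae_restrict_mem measurableSet_Ioo] with s' hs' hsl'
      rw [hs, hs', Real.norm_eq_abs, add_sub_add_left_eq_sub]
      exact hJ s hsl s' hsl'
    rw [hvol, ← h1, Real.norm_eq_abs, abs_mul, abs_of_pos hl0] at h2
    nlinarith
  filter_upwards [key] with s hs
  have h1 := enorm_integral_sq_le (f := fun x => ‖g x‖) hl0.le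
  simp only [enorm_norm] at h1
  refine le_trans ?_ h1
  gcongr
  rw [← ofReal_norm, ← ofReal_norm]
  exact ENNReal.ofReal_le_ofReal (by
    rw [Real.norm_eq_abs, Real.norm_eq_abs]
    exact hs.trans (le_abs_self _))

/-- Cell solutions are close to their interface mean in mean square above the interface. -/
lemma cell_sub_mean_memLp (hf : IsRoughProfile f) (hβ : MemD12 (cellDomain f) (2 * Real.pi) β G)
    (heq : CellEq f G) {m : ℝ} (hm : IsInterfaceMean β m) :
    MemLp (fun x => β x - m) 2 (volume.restrict upperCell) := by
  -- The base point `1/2` of the primitives has to lie inside the period.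
  have hpi : (1 / 2 : ℝ) < 2 * Real.pi := by linarith [Real.pi_gt_three]
  have hmean := cell_mean hf hβ heq hm
  have hG1 : MemLp (fun x => (G x).1) 2 (volume.restrict upperCell) :=
    hβ.memLp_grad.fst.mono_measure (Measure.restrict_mono (upperCell_subset hf) le_rfl)
  have hβm : AEStronglyMeasurable (fun x => β x - m) (volume.restrict upperCell) :=
    (hβ.aestronglyMeasurable.mono_measure
      (Measure.restrict_mono (upperCell_subset hf) le_rfl)).sub aestronglyMeasurable_const
  refine memLp_two_of_lintegral hβm ?_
  -- representation on horizontal lines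
  let D' : Set (ℝ × ℝ) := {x | 0 < x.1}
  have hD' : IsOpen D' := isOpen_lt continuous_const continuous_fst
  have hstar : IsVertStar D' := fun x hx s _ z _ => hx
  let U : Set (ℝ × ℝ) := {x | 0 < x.2}
  have hU : IsOpen U := isOpen_lt continuous_const continuous_snd
  have hUD : U ⊆ cellDomain f := fun x hx => (hf.lt_zero x.1).trans hx
  have hw := hβ.isWeakGradient.mono hUD
  have hswap : Measure.map (Prod.swap : ℝ × ℝ → ℝ × ℝ) volume =
      (1 : ℝ≥0∞) • (volume : Measure (ℝ × ℝ)) := by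
    rw [one_smul]; exact measurePreserving_swap.map_eq
  have d1 : HasWeakDeriv D' (fun x => β x.swap) (fun x => (G x.swap).1) (0, 1) :=
    HasWeakDeriv.comp_affine (ContinuousLinearEquiv.prodComm ℝ ℝ ℝ) 0 (T := Prod.swap)
      (g := fun x => (G x).1) (D := U) (fun x => by simp) hswap (by simpa using hw.fst)
  have l0 : LocallyIntegrableOn (fun x => β x.swap) D' :=
    locallyIntegrableOn_comp_homeomorph hU (Homeomorph.prodComm ℝ ℝ) ENNReal.one_ne_top hswap
      hw.locallyIntegrableOn
  have l1 : LocallyIntegrableOn (fun x => (G x.swap).1) D' :=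
    locallyIntegrableOn_comp_homeomorph (w := fun x => (G x).1) hU (Homeomorph.prodComm ℝ ℝ)
      ENNReal.one_ne_top hswap hw.locallyIntegrableOn_fst
  obtain ⟨c, hc⟩ := exists_vertPrim_rep hD' hstar l0 l1 d1
  rw [Measure.volume_eq_prod] at hc
  have hc' := Measure.ae_ae_of_ae_prod hc
  have hloc := ae_locallyIntegrableOn_fiber hD' l1
  -- The mean on almost every horizontal line is the same `m`, so the Poincaré inequality holds with
  -- a constant independent of the height and integrates over the whole half strip.
  have hline : ∀ᵐ t ∂volume.restrict (Ioi (0 : ℝ)), ∫⁻ s in Ioo 0 (2 * Real.pi),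
      ‖β (s, t) - m‖ₑ ^ 2 ≤ ENNReal.ofReal (2 * Real.pi) ^ 2 *
        ∫⁻ s in Ioo 0 (2 * Real.pi), ‖(G (s, t)).1‖ₑ ^ 2 := by
    rw [ae_restrict_iff' measurableSet_Ioi]
    filter_upwards [hc', hloc, hmean] with t ht1 ht2 ht3 ht
    have hli : IntegrableOn (fun s => (G (s, t)).1) (Ioo 0 (2 * Real.pi)) :=
      (ht2.integrableOn_compact_subset (t := Icc 0 (2 * Real.pi)) (fun s _ => ht)
        isCompact_Icc).mono_set Ioo_subset_Icc_self
    have hb : ∀ᵐ s ∂volume.restrict (Ioo 0 (2 * Real.pi)),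
        β (s, t) = c t + ∫ x in (1 / 2 : ℝ)..s, (G (x, t)).1 := by
      filter_upwards [ae_restrict_of_ae ht1] with s hs
      exact hs ht
    have h1 := wirtinger_interval hpi hli hb (ht3 ht)
    calc ∫⁻ s in Ioo 0 (2 * Real.pi), ‖β (s, t) - m‖ₑ ^ 2
        ≤ ∫⁻ _ in Ioo 0 (2 * Real.pi), ENNReal.ofReal (2 * Real.pi) *
          ∫⁻ x in Ioo 0 (2 * Real.pi), ‖(G (x, t)).1‖ₑ ^ 2 := lintegral_mono_ae h1
      _ = _ := by
        simp only [lintegral_const, Measure.restrict_apply_univ, Real.volume_Ioo, sub_zero]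
        ring
  have m1 : AEMeasurable (fun x => ‖β x - m‖ₑ ^ 2) (volume.restrict upperCell) :=
    hβm.enorm.pow_const 2
  have m2 : AEMeasurable (fun x => ‖(G x).1‖ₑ ^ 2) (volume.restrict upperCell) :=
    hG1.1.enorm.pow_const 2
  have hfin := lintegral_enorm_sq_lt_top hG1
  rw [volume_restrict_upperCell] at m1 m2 hfin ⊢
  rw [lintegral_prod_symm _ m2] at hfin
  rw [lintegral_prod_symm _ m1]
  refine (lintegral_mono_ae hline).trans_lt ?_
  have hne : ENNReal.ofReal (2 * Real.pi) ^ 2 ≠ ⊤ := ENNReal.pow_ne_top ENNReal.ofReal_ne_top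
  rw [lintegral_const_mul' _ _ hne]
  exact ENNReal.mul_lt_top hne.lt_top hfin

end WallLaw

namespace WallLaw

variable {D : Set (ℝ × ℝ)} {u v w β : ℝ × ℝ → ℝ} {G H : ℝ × ℝ → ℝ × ℝ} {f : ℝ → ℝ}

/-! ### Cutoff functions -/

lemma exists_deriv_smoothTransition_le : ∃ M, 0 ≤ M ∧ ∀ t, |deriv Real.smoothTransition t| ≤ M := by
  have hc : Continuous (deriv Real.smoothTransition) :=
    (Real.smoothTransition.contDiff (n := 1)).continuous_deriv (by simp)
  obtain ⟨M, hM⟩ := isCompact_Icc.exists_bound_of_continuousOn (s := Icc (0 : ℝ) 1) hc.continuousOn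
  refine ⟨max M 0, le_max_right _ _, fun t => ?_⟩
  rcases lt_or_ge t 0 with h | h
  · have : Real.smoothTransition =ᶠ[𝓝 t] fun _ => 0 := by
      filter_upwards [Iio_mem_nhds h] with y hy
      exact Real.smoothTransition.zero_of_nonpos (le_of_lt hy)
    rw [this.deriv_eq]; simp
  rcases lt_or_ge 1 t with h' | h'
  · have : Real.smoothTransition =ᶠ[𝓝 t] fun _ => 1 := by
      filter_upwards [Ioi_mem_nhds h'] with y hy
      exact Real.smoothTransition.one_of_one_le (le_of_lt hy)
    rw [this.deriv_eq]; simp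
  · exact (hM t ⟨h, h'⟩).trans (le_max_left _ _)

lemma hasDerivAt_smoothTransition_comp (a b t : ℝ) :
    HasDerivAt (fun t => Real.smoothTransition (a * t + b))
      (deriv Real.smoothTransition (a * t + b) * a) t := by
  have h1 := ((Real.smoothTransition.contDiff (n := 1)).differentiable (by simp)
    (a * t + b)).hasDerivAt
  have h2 : HasDerivAt (fun t : ℝ => a * t + b) a t := by
    simpa using ((hasDerivAt_id t).const_mul a).add_const b
  exact h1.comp t h2

/-- In the variable `4εy - 1` the transition takes place between the heights `1/(4ε)` and `1/(2ε)`,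
so the slope is `O(ε)` with `M` independent of `ε`. This slope is the source of the factor `ε²` in
the energy decay. -/
lemma exists_cutoff_above : ∃ M : ℝ, 0 ≤ M ∧ ∀ ε : ℝ, 0 < ε → ∃ η η' : ℝ → ℝ, (∀ y, HasDerivAt η (η' y) y) ∧
    ContDiff ℝ ∞ η ∧ (∀ y, 0 ≤ η y ∧ η y ≤ 1) ∧ (∀ y, y ≤ 0 → η y = 0) ∧
    (∀ y, 1 / (2 * ε) < y → η y = 1) ∧ (∀ y, |η' y| ≤ 4 * M * ε) ∧ Continuous η' := by
  obtain ⟨M, hM0, hM⟩ := exists_deriv_smoothTransition_le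
  refine ⟨M, hM0, fun ε hε => ?_⟩
  let η : ℝ → ℝ := fun y => Real.smoothTransition ((4 * ε) * y + (-1))
  let η' : ℝ → ℝ := fun y => deriv Real.smoothTransition ((4 * ε) * y + (-1)) * (4 * ε)
  have hηd : ∀ y, HasDerivAt η (η' y) y := hasDerivAt_smoothTransition_comp _ _
  have hηs : ContDiff ℝ ∞ η := Real.smoothTransition.contDiff.comp (by fun_prop)
  refine ⟨η, η', hηd, hηs, fun y =>
    ⟨Real.smoothTransition.nonneg _, Real.smoothTransition.le_one _⟩,
    fun y hy => Real.smoothTransition.zero_of_nonpos (by nlinarith), fun y hy => ?_, fun y => ?_, ?_⟩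
  · apply Real.smoothTransition.one_of_one_le
    rw [div_lt_iff₀ (by positivity)] at hy
    linarith
  · simp only [η', abs_mul, abs_of_pos hε]
    have := hM (4 * ε * y + -1)
    rw [abs_of_pos (by norm_num : (0 : ℝ) < 4)]
    nlinarith
  · have : η' = deriv η := funext fun y => (hηd y).deriv.symm
    rw [this]; exact hηs.continuous_deriv (by simp)

/-! ### Decay of cell solutions -/

lemma memLp_restrict_of_eq_zero {E : Type*} [NormedAddCommGroup E] {W : ℝ × ℝ → E}
    {A B : Set (ℝ × ℝ)} (hB : MeasurableSet B) (hW : MemLp W 2 (volume.restrict B))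
    (hA : MeasurableSet A) (h0 : ∀ x ∈ A, x ∉ B → W x = 0) : MemLp W 2 (volume.restrict A) := by
  have h1 : MemLp (indicator B W) 2 (volume.restrict A) :=
    ((memLp_indicator_iff_restrict hB).2 hW).restrict A
  refine h1.ae_eq ?_
  filter_upwards [ae_restrict_mem hA] with x hx
  by_cases hxu : x ∈ B
  · rw [indicator_of_mem hxu]
  · rw [indicator_of_notMem hxu, h0 x hx hxu]

/-- A Caccioppoli inequality: the energy of a cell solution at height `1/(2ε)` is `O(ε²)`. -/
lemma cell_energy_decay (hf : IsRoughProfile f) (hβ : MemD12 (cellDomain f) (2 * Real.pi) β G)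
    (heq : CellEq f G) {m : ℝ} (hβm : MemLp (fun x => β x - m) 2 (volume.restrict upperCell)) :
    ∃ K, 0 ≤ K ∧ ∀ ε : ℝ, 0 < ε →
      ∫ x in Ioo 0 (2 * Real.pi) ×ˢ Ioi (1 / (2 * ε)), ((G x).1 ^ 2 + (G x).2 ^ 2) ≤ K * ε ^ 2 := by
  obtain ⟨M, hM0, hM⟩ := exists_cutoff_above
  set A := periodCell (cellDomain f) (2 * Real.pi)
  have hA : MeasurableSet A := measurableSet_periodCell hf.isOpen _
  set J := ∫ x in upperCell, (β x - m) ^ 2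
  have hJ : 0 ≤ J := integral_nonneg fun x => sq_nonneg _
  refine ⟨4 * (4 * M) ^ 2 * J, by positivity, fun ε hε => ?_⟩
  obtain ⟨η, η', hηd, hηs, hη01, hη0, hη1, hη', hη'c⟩ := hM ε hε
  have hsq : ContDiff ℝ ∞ (fun y => η y ^ 2) := hηs.pow 2
  have hsqd : ∀ y, deriv (fun y => η y ^ 2) y = 2 * η y * η' y := fun y => by
    have := ((hηd y).fun_pow 2).deriv
    simpa using this
  have hcw : IsWeakGradient (cellDomain f) (fun x => β x - m) G := by
    have h1 := hβ.isWeakGradient.add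
      (isWeakGradient_comp_snd (D := cellDomain f) (P := fun _ => -m) contDiff_const)
    have e : (fun x => G x + ((0 : ℝ), deriv (fun _ : ℝ => -m) x.2)) = G := by ext x <;> simp
    rw [e] at h1
    exact h1
  have hvw := hcw.cutoff_mul hsq hf.isOpen (fun x hx _ => hx)
  simp only [hsqd] at hvw
  have mc : ∀ {p : ℝ → ℝ}, Continuous p → ∀ μ : Measure (ℝ × ℝ),
      AEStronglyMeasurable (fun x : ℝ × ℝ => p x.2) μ := fun hp μ =>
    (hp.comp continuous_snd).aestronglyMeasurable
  have e1 : MemLp (fun x => η x.2 ^ 2 • G x) 2 (volume.restrict A) := by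
    refine hβ.memLp_grad.of_le ((mc hsq.continuous _).smul hβ.memLp_grad.1) (ae_of_all _ fun x => ?_)
    rw [norm_smul, Real.norm_eq_abs, abs_of_nonneg (sq_nonneg _)]
    have := hη01 x.2
    exact mul_le_of_le_one_left (norm_nonneg _) (by nlinarith)
  have hzero : ∀ x ∈ A, x ∉ upperCell → x.2 ≤ 0 := fun x hx hxu => by
    by_contra hcon
    exact hxu ⟨hx.2, not_le.1 hcon⟩
  have e2 : MemLp (fun x => η' x.2 * (β x - m)) 2 (volume.restrict upperCell) := by
    refine (hβm.const_mul (4 * M * ε)).of_le ((mc hη'c _).mul hβm.1) (ae_of_all _ fun x => ?_)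
    rw [norm_mul, norm_mul, Real.norm_eq_abs, Real.norm_eq_abs,
      Real.norm_eq_abs, abs_of_nonneg (by positivity : 0 ≤ 4 * M * ε)]
    gcongr
    exact hη' _
  have e3 : MemLp (fun x => 2 * η x.2 * η' x.2 * (β x - m)) 2 (volume.restrict A) := by
    refine memLp_restrict_of_eq_zero measurableSet_upperCell ?_ hA fun x hx hxu => by
      rw [hη0 _ (hzero x hx hxu)]; ring
    refine (e2.const_mul 2).of_le (((mc (by fun_prop : Continuous fun y => 2 * η y * η' y) _).mul
      hβm.1)) (ae_of_all _ fun x => ?_)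
    have h1 := hη01 x.2
    rw [show 2 * η x.2 * η' x.2 * (β x - m) = η x.2 * (2 * (η' x.2 * (β x - m))) by ring, norm_mul,
      Real.norm_eq_abs, abs_of_nonneg h1.1]
    exact mul_le_of_le_one_left (norm_nonneg _) h1.2
  have hHL : MemLp (fun x => η x.2 ^ 2 • G x + (0, 2 * η x.2 * η' x.2 * (β x - m))) 2
      (volume.restrict A) := e1.add (memLp_prodMk (MemLp.zero (ε := ℝ)) e3)
  -- The test function is `η² (β - m)`. As `η` vanishes below the interface, its trace on the wall
  -- is zero and square integrability of `β - m` is needed only above the interface.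
  have hmem : MemD12 (cellDomain f) (2 * Real.pi) (fun x => η x.2 ^ 2 * (β x - m))
      (fun x => η x.2 ^ 2 • G x + (0, 2 * η x.2 * η' x.2 * (β x - m))) := by
    refine ⟨hvw, ?_, ?_, hHL⟩
    · filter_upwards [hβ.periodic] with x hx
      simp only [hx]
    · filter_upwards [hβ.periodic, hβ.periodic_grad] with x hx hx'
      simp only [hx, hx']
  obtain ⟨δ, hδ, hfδ⟩ := hf.away
  have htr : HasTrace (2 * Real.pi) 1 f (fun x => η x.2 ^ 2 * (β x - m)) 0 :=
    hasTrace_zero_of_layer_eq_zero hδ fun s _ t ht => by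
      rw [hη0 _ (by linarith [hfδ s, ht.2])]; ring
  have h0 := heq _ _ hmem htr
  unfold dirichletForm at h0
  simp only [Prod.fst_add, Prod.snd_add, Prod.smul_fst, Prod.smul_snd, smul_eq_mul, add_zero] at h0
  have iG1 := hβ.memLp_grad.fst
  have iG2 := hβ.memLp_grad.snd
  have iX : Integrable (fun x => η x.2 ^ 2 * ((G x).1 ^ 2 + (G x).2 ^ 2)) (volume.restrict A) := by
    refine ((iG1.integrable_mul e1.fst).add (iG2.integrable_mul e1.snd)).congr
      (ae_of_all _ fun x => ?_)
    simp only [Pi.add_apply, Pi.mul_apply, Prod.smul_fst, Prod.smul_snd, smul_eq_mul]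
    ring
  have iY : Integrable (fun x => (G x).2 * (2 * η x.2 * η' x.2 * (β x - m))) (volume.restrict A) :=
    iG2.integrable_mul e3
  have iZ0 : Integrable (fun x => (β x - m) ^ 2) (volume.restrict upperCell) := hβm.integrable_sq
  have iZ : Integrable (indicator upperCell fun x => (β x - m) ^ 2) (volume.restrict A) :=
    ((integrable_indicator_iff measurableSet_upperCell).2 iZ0).restrict
  have hZ : ∫ x in A, indicator upperCell (fun x => (β x - m) ^ 2) x = J := by
    rw [integral_indicator measurableSet_upperCell,
      Measure.restrict_restrict measurableSet_upperCell,
      inter_eq_self_of_subset_left (upperCell_subset hf)]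
  set X := ∫ x in A, η x.2 ^ 2 * ((G x).1 ^ 2 + (G x).2 ^ 2)
  have hXY : X + ∫ x in A, (G x).2 * (2 * η x.2 * η' x.2 * (β x - m)) = 0 := by
    rw [← integral_add iX iY, ← h0]
    congr 1; ext x; ring
  -- Young's inequality: half of the weighted energy is absorbed on the left, and the rest is
  -- controlled by the squared slope of `η` times the integral of `(β - m)²`.
  have hY : -∫ x in A, (G x).2 * (2 * η x.2 * η' x.2 * (β x - m)) ≤
      1 / 2 * X + 2 * (4 * M * ε) ^ 2 * J := by
    rw [← integral_neg, ← hZ, ← integral_const_mul, ← integral_const_mul,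
      ← integral_add (iX.const_mul _) (iZ.const_mul _)]
    refine setIntegral_mono_on iY.neg ((iX.const_mul _).add (iZ.const_mul _)) hA fun x hx => ?_
    by_cases hxu : x ∈ upperCell
    · rw [indicator_of_mem hxu]
      have h1 : (η' x.2 * (β x - m)) ^ 2 ≤ (4 * M * ε) ^ 2 * (β x - m) ^ 2 := by
        rw [mul_pow]
        exact mul_le_mul_of_nonneg_right (sq_le_sq' (by linarith [(abs_le.1 (hη' x.2)).1])
          (abs_le.1 (hη' x.2)).2) (sq_nonneg _)
      nlinarith [sq_nonneg (η x.2 * (G x).2 + 2 * (η' x.2 * (β x - m))), sq_nonneg (η x.2 * (G x).1)]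
    · rw [indicator_of_notMem hxu, hη0 _ (hzero x hx hxu)]
      simp
  have hX : X ≤ 4 * (4 * M) ^ 2 * J * ε ^ 2 := by nlinarith
  refine le_trans ?_ hX
  have hsub : Ioo 0 (2 * Real.pi) ×ˢ Ioi (1 / (2 * ε)) ⊆ A := fun x hx =>
    upperCell_subset hf ⟨hx.1, lt_trans (by positivity : 0 < 1 / (2 * ε)) hx.2⟩
  calc ∫ x in Ioo 0 (2 * Real.pi) ×ˢ Ioi (1 / (2 * ε)), ((G x).1 ^ 2 + (G x).2 ^ 2)
      = ∫ x in Ioo 0 (2 * Real.pi) ×ˢ Ioi (1 / (2 * ε)),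
          η x.2 ^ 2 * ((G x).1 ^ 2 + (G x).2 ^ 2) := by
        refine setIntegral_congr_fun (measurableSet_Ioo.prod measurableSet_Ioi) fun x hx => ?_
        rw [hη1 _ hx.2]; ring
    _ ≤ X := setIntegral_mono_set iX (ae_of_all _ fun x => by positivity) hsub.eventuallyLE

/-! ### Signs of the interface means -/

lemma HasTrace.const_sub {L σ : ℝ} {h g₀ : ℝ → ℝ} (a : ℝ) (ht : HasTrace L σ h u g₀) :
    HasTrace L σ h (fun x => a - u x) (fun s => a - g₀ s) := by
  refine ⟨(memLp_const a).sub ht.memLp, ?_⟩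
  have : ∀ x y : ℝ, ‖a - x - (a - y)‖ₑ = ‖x - y‖ₑ := fun x y => by
    rw [sub_sub_sub_cancel_left, ← enorm_neg, neg_sub]
  simp only [this]
  exact ht.tendsto

/-- The maximum principle gives `β ≤ 0` almost everywhere, and almost every horizontal line above
the interface carries the mean `m`; one line with both properties decides the sign. -/
lemma interfaceMean_nonpos (hf : IsRoughProfile f) (hβ : MemD12 (cellDomain f) (2 * Real.pi) β G)
    (heq : CellEq f G) {m : ℝ} (hm : IsInterfaceMean β m) {g₀ : ℝ → ℝ}
    (ht : HasTrace (2 * Real.pi) 1 f β g₀) (hg₀ : ∀ s, g₀ s ≤ 0) : m ≤ 0 := by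
  have h1 := ae_restrict_of_ae_restrict_of_subset (upperCell_subset hf) (cell_nonpos hf hβ ht hg₀ heq)
  rw [volume_restrict_upperCell] at h1
  have h2 := Measure.ae_ae_of_ae_prod (Measure.measurePreserving_swap.quasiMeasurePreserving.ae h1)
  have h3 := (ae_restrict_iff' measurableSet_Ioi).2 (cell_mean hf hβ heq hm)
  have : NeZero (volume.restrict (Ioi (0 : ℝ))) := ⟨by
    rw [Ne, Measure.restrict_eq_zero, Real.volume_Ioi]; simp⟩
  obtain ⟨t, ht1, ht2⟩ := (h2.and h3).exists
  have h4 : ∫ s in Ioo 0 (2 * Real.pi), β (s, t) ≤ 0 := integral_nonpos_of_ae ht1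
  rw [ht2] at h4
  have := Real.pi_pos
  nlinarith

lemma isInterfaceMean_const_sub {m : ℝ} (a : ℝ) (hm : IsInterfaceMean β m) :
    IsInterfaceMean (fun x => a - β x) (a - m) := by
  obtain ⟨η, hη, hmη⟩ := hm
  refine ⟨fun s => a - η s, hη.const_sub a, ?_⟩
  have hpi : (0 : ℝ) < 2 * Real.pi := by positivity
  have hi : IntervalIntegrable η volume 0 (2 * Real.pi) := by
    rw [intervalIntegrable_iff_integrableOn_Ioo_of_le hpi.le]
    exact hη.memLp.integrable (by norm_num)
  rw [intervalIntegral.integral_sub (by simp) hi, hmη, intervalIntegral.integral_const]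
  simp only [sub_zero, smul_eq_mul]
  field_simp

/-- The function `δ - β` has boundary values `δ + f < 0`, so the maximum principle yields `m ≥ δ`.
The strict sign matters because `1/(ε m)` is the coefficient of the wall laws. -/
lemma interfaceMean_pos (hf : IsRoughProfile f) (hβ : MemD12 (cellDomain f) (2 * Real.pi) β G)
    (heq : CellEq f G) {m : ℝ} (hm : IsInterfaceMean β m)
    (ht : HasTrace (2 * Real.pi) 1 f β (fun s => -f s)) : 0 < m := by
  obtain ⟨δ, hδ, hfδ⟩ := hf.away
  have hw : MemD12 (cellDomain f) (2 * Real.pi) (fun x => δ - β x) (fun x => (-1 : ℝ) • G x) := by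
    have h1 := (hβ.isWeakGradient.const_mul (-1)).add
      (isWeakGradient_comp_snd (D := cellDomain f) (P := fun _ => δ) contDiff_const)
    refine ⟨?_, ?_, ?_, hβ.memLp_grad.const_smul (-1 : ℝ)⟩
    · convert h1 using 2 with x x
      · ring
      · simp
    · filter_upwards [hβ.periodic] with x hx
      rw [hx]
    · filter_upwards [hβ.periodic_grad] with x hx
      rw [hx]
  have heq' : CellEq f (fun x => (-1 : ℝ) • G x) := by
    intro v H hv htv
    have h1 := heq v H hv htv
    unfold dirichletForm at h1 ⊢
    rw [← neg_eq_zero, ← integral_neg, ← h1]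
    congr 1; ext x
    simp only [Prod.smul_fst, Prod.smul_snd, smul_eq_mul]
    ring
  have h2 := interfaceMean_nonpos hf hw heq' (isInterfaceMean_const_sub δ hm) (ht.const_sub δ)
    (fun s => by linarith [hfδ s])
  linarith

end WallLaw

namespace WallLaw

variable {D : Set (ℝ × ℝ)} {u v w : ℝ × ℝ → ℝ} {G H : ℝ × ℝ → ℝ × ℝ} {h k : ℝ → ℝ} {L : ℝ}

/-! ### Fubini in a period cell -/

lemma restrict_periodCell (hD : MeasurableSet D) (L : ℝ) :
    (volume : Measure (ℝ × ℝ)).restrict (periodCell D L) =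
      ((volume.restrict (Ioo 0 L)).prod volume).restrict D := by
  have e : periodCell D L = D ∩ (Ioo 0 L ×ˢ univ) := by
    ext x; simp only [periodCell, mem_inter_iff, mem_prod, mem_univ, and_true]; rfl
  rw [e, ← Measure.restrict_restrict hD, Measure.volume_eq_prod, ← Measure.prod_restrict,
    Measure.restrict_univ]

lemma measurableSet_fiber (hD : MeasurableSet D) (s : ℝ) : MeasurableSet {z | (s, z) ∈ D} :=
  measurable_prodMk_left hD

lemma ae_fiber_of_ae_periodCell (hD : MeasurableSet D) {p : ℝ × ℝ → Prop}
    (hp : ∀ᵐ x ∂volume.restrict (periodCell D L), p x) :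
    ∀ᵐ s ∂volume.restrict (Ioo 0 L), ∀ᵐ z ∂volume.restrict {z | (s, z) ∈ D}, p (s, z) := by
  rw [restrict_periodCell hD, ae_restrict_iff' hD] at hp
  filter_upwards [Measure.ae_ae_of_ae_prod hp] with s hs
  exact (ae_restrict_iff' (measurableSet_fiber hD s)).2 hs

lemma indicator_fiber {E : Type*} [Zero E] (w : ℝ × ℝ → E) (s z : ℝ) :
    indicator D w (s, z) = indicator {z | (s, z) ∈ D} (fun z => w (s, z)) z := rfl

lemma lintegral_periodCell (hD : MeasurableSet D) {w : ℝ × ℝ → ℝ≥0∞}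
    (hw : AEMeasurable w (volume.restrict (periodCell D L))) :
    ∫⁻ x in periodCell D L, w x = ∫⁻ s in Ioo 0 L, ∫⁻ z in {z | (s, z) ∈ D}, w (s, z) := by
  rw [restrict_periodCell hD] at hw ⊢
  rw [← lintegral_indicator hD, lintegral_prod _ ((aemeasurable_indicator_iff hD).2 hw)]
  refine lintegral_congr fun s => ?_
  simp_rw [indicator_fiber]
  rw [lintegral_indicator (measurableSet_fiber hD s)]

lemma integral_periodCell (hD : MeasurableSet D)
    (hw : Integrable w (volume.restrict (periodCell D L))) :
    ∫ x in periodCell D L, w x = ∫ s in Ioo 0 L, ∫ z in {z | (s, z) ∈ D}, w (s, z) := by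
  rw [restrict_periodCell hD] at hw ⊢
  rw [← integral_indicator hD, integral_prod _ ((integrable_indicator_iff hD).2 hw)]
  refine integral_congr_ae (ae_of_all _ fun s => ?_)
  simp_rw [indicator_fiber]
  rw [integral_indicator (measurableSet_fiber hD s)]

lemma integrable_fiber_periodCell (hD : MeasurableSet D)
    (hw : Integrable w (volume.restrict (periodCell D L))) :
    ∀ᵐ s ∂volume.restrict (Ioo 0 L), IntegrableOn (fun z => w (s, z)) {z | (s, z) ∈ D} := by
  rw [restrict_periodCell hD] at hw
  filter_upwards [((integrable_indicator_iff hD).2 hw).prod_right_ae] with s hs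
  simp_rw [indicator_fiber] at hs
  exact (integrable_indicator_iff (measurableSet_fiber hD s)).1 hs

/-! ### Strips -/

/-- The region between the graph of `h` and the height `1`. -/
def stripDomain (h : ℝ → ℝ) : Set (ℝ × ℝ) := {x | h x.1 < x.2 ∧ x.2 < 1}

lemma isOpen_stripDomain (hh : Continuous h) : IsOpen (stripDomain h) :=
  (isOpen_lt (hh.comp continuous_fst) continuous_snd).inter
    (isOpen_lt continuous_snd continuous_const)

lemma isVertStar_stripDomain (h0 : ∀ s, h s ≤ 0) : IsVertStar (stripDomain h) := by
  intro x hx s hs z hz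
  rw [mem_uIcc] at hz
  have := h0 x.1
  have h1 : h x.1 < x.2 := hx.1
  have h2 : x.2 < 1 := hx.2
  constructor
  · change h x.1 < z
    rcases hz with hz | hz <;> linarith [hs.1, hs.2, hz.1, hz.2]
  · change z < 1
    rcases hz with hz | hz <;> linarith [hs.1, hs.2, hz.1, hz.2]

lemma isLayer_strip_top (hh : Continuous h) (h0 : ∀ s, h s ≤ 0) :
    IsLayer (stripDomain h) L 1 (-1) (fun _ => 1) where
  isOpen := isOpen_stripDomain hh
  star := isVertStar_stripDomain h0
  measurable := measurable_const
  sign := Or.inr rfl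
  pos := one_pos
  mem := fun z hz => by
    have h1 := hz.2.1
    have h2 := hz.2.2
    have := h0 z.1
    constructor
    · change h z.1 < 1 + -1 * z.2
      linarith
    · change 1 + -1 * z.2 < 1
      linarith

lemma isLayer_strip_bot (hh : Continuous h) (h0 : ∀ s, h s ≤ 0) :
    IsLayer (stripDomain h) L 1 1 h where
  isOpen := isOpen_stripDomain hh
  star := isVertStar_stripDomain h0
  measurable := hh.measurable
  sign := Or.inl rfl
  pos := one_pos
  mem := fun z hz => by
    have h1 := hz.2.1
    have h2 := hz.2.2
    have := h0 z.1
    constructor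
    · change h z.1 < h z.1 + 1 * z.2
      linarith
    · change h z.1 + 1 * z.2 < 1
      linarith

lemma volume_periodCell_strip_lt_top {M : ℝ} (hM : ∀ s, -M ≤ h s) :
    volume (periodCell (stripDomain h) L) < ⊤ := by
  have hsub : periodCell (stripDomain h) L ⊆ Ioo 0 L ×ˢ Ioo (-M) 1 := fun x hx =>
    ⟨hx.2, lt_of_le_of_lt (hM x.1) hx.1.1, hx.1.2⟩
  refine (measure_mono hsub).trans_lt ?_
  rw [Measure.volume_eq_prod, Measure.prod_prod, Real.volume_Ioo, Real.volume_Ioo]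
  exact ENNReal.mul_lt_top ENNReal.ofReal_lt_top ENNReal.ofReal_lt_top

lemma ae_intervalIntegrable_strip {M : ℝ} (hh : Continuous h) (h0 : ∀ s, h s ≤ 0)
    (hM : ∀ s, -M ≤ h s) (hw : MemLp w 2 (volume.restrict (periodCell (stripDomain h) L))) :
    ∀ᵐ s ∂volume.restrict (Ioo 0 L), IntervalIntegrable (fun z => w (s, z)) volume (h s) 1 := by
  have : IsFiniteMeasure (volume.restrict (periodCell (stripDomain h) L)) :=
    ⟨by rw [Measure.restrict_apply_univ]; exact volume_periodCell_strip_lt_top hM⟩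
  filter_upwards [integrable_fiber_periodCell (isOpen_stripDomain hh).measurableSet
    (hw.integrable (by norm_num))] with s hs
  rw [intervalIntegrable_iff_integrableOn_Ioo_of_le (by linarith [h0 s])]
  exact hs

/-- On almost every vertical line, `u` is the primitive of its derivative that vanishes at the
top. -/
lemma strip_fiber_top {M : ℝ} (hh : Continuous h) (h0 : ∀ s, h s ≤ 0) (hM : ∀ s, -M ≤ h s)
    (hu : IsWeakGradient (stripDomain h) u G)
    (hG : MemLp G 2 (volume.restrict (periodCell (stripDomain h) L)))
    (ht : HasTrace L (-1) (fun _ => 1) u 0) :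
    ∀ᵐ s ∂volume.restrict (Ioo 0 L), ∀ᵐ z ∂volume.restrict (Ioo (h s) 1),
      u (s, z) = -∫ y in z..1, (G (s, y)).2 := by
  have hD := isOpen_stripDomain hh
  obtain ⟨c, hc⟩ := exists_vertPrim_rep hD (isVertStar_stripDomain h0) hu.locallyIntegrableOn
    hu.locallyIntegrableOn_snd hu.snd
  have hc' : ∀ᵐ x ∂volume.restrict (periodCell (stripDomain h) L),
      u x = c x.1 + vertPrim (fun x => (G x).2) x := by
    filter_upwards [ae_restrict_of_ae hc, ae_restrict_mem (measurableSet_periodCell hD L)]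
      with x hx hx'
    exact hx hx'.1
  have h1 := ae_fiber_of_ae_periodCell hD.measurableSet hc'
  have h2 := (ht.lineRep (isLayer_strip_top hh h0) hu hG).ae_ae
  filter_upwards [h1, h2, ae_intervalIntegrable_strip hh h0 hM hG.snd] with s hs1 hs2 hi
  change ∀ᵐ z ∂volume.restrict (Ioo (h s) 1), _ at hs1
  have hs0 := h0 s
  have hii : ∀ a ∈ Icc (h s) 1, ∀ b ∈ Icc (h s) 1,
      IntervalIntegrable (fun z => (G (s, z)).2) volume a b := fun a ha b hb =>
    hi.mono_set (by rw [uIcc_of_le (by linarith : h s ≤ 1)]; exact uIcc_subset_Icc ha hb)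
  have hs1' : ∀ᵐ z, z ∈ Ioo (h s) 1 → u (s, z) = c s + ∫ y in (1 / 2 : ℝ)..z, (G (s, y)).2 :=
    (ae_restrict_iff' measurableSet_Ioo).1 hs1
  have hs3 := (Measure.measurePreserving_sub_left volume (1 : ℝ)).quasiMeasurePreserving.ae hs1'
  have : NeZero (volume.restrict (Ioo (0 : ℝ) 1)) := ⟨by
    rw [Ne, Measure.restrict_eq_zero, Real.volume_Ioo]; simp⟩
  -- The representation from the top is available at depths below `1`, the one from height `1/2` on
  -- the whole fibre. Comparing them at one generic depth fixes the constant `c s`.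
  obtain ⟨t, ht1, ht2, ht3⟩ := (hs2.and ((ae_restrict_of_ae hs3).and
    (ae_restrict_mem measurableSet_Ioo))).exists
  have ht2' := ht2 ⟨by linarith [ht3.2], by linarith [ht3.1]⟩
  have e1 : ∫ τ in (0 : ℝ)..t, -1 * (G (graphMap (fun _ => 1) (-1) (s, τ))).2 =
      -∫ y in (1 - t)..1, (G (s, y)).2 := by
    have := intervalIntegral.integral_comp_sub_left (a := 0) (b := t)
      (fun y => (G (s, y)).2) 1
    rw [sub_zero] at this
    rw [← this, ← intervalIntegral.integral_neg]
    congr 1; ext τ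
    simp only [graphMap]
    ring_nf
  have e2 : u (graphMap (fun _ => 1) (-1) (s, t)) = u (s, 1 - t) := by
    simp only [graphMap]; ring_nf
  rw [e1, e2, ht2'] at ht1
  simp only [Pi.zero_apply, zero_add] at ht1
  have mhalf : (1 / 2 : ℝ) ∈ Icc (h s) 1 := ⟨by linarith, by norm_num⟩
  have m1 : (1 : ℝ) ∈ Icc (h s) 1 := ⟨by linarith, le_rfl⟩
  have mt : 1 - t ∈ Icc (h s) 1 := ⟨by linarith [ht3.2], by linarith [ht3.1]⟩
  filter_upwards [hs1, ae_restrict_mem measurableSet_Ioo] with z hz hz'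
  have mz : z ∈ Icc (h s) 1 := ⟨hz'.1.le, hz'.2.le⟩
  rw [hz]
  change c s + ∫ y in (1 / 2 : ℝ)..z, (G (s, y)).2 = _
  have a1 := intervalIntegral.integral_add_adjacent_intervals (hii _ mhalf _ mz) (hii _ mz _ m1)
  have a2 := intervalIntegral.integral_add_adjacent_intervals (hii _ mhalf _ mt) (hii _ mt _ m1)
  linarith

/-- On almost every fibre one generic height lies in both representations, the one from the wall and
the one from the top; equating them there identifies the trace on the wall. -/
lemma strip_fiber_bot {M : ℝ} (hh : Continuous h) (h0 : ∀ s, h s ≤ 0) (hM : ∀ s, -M ≤ h s)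
    (hu : IsWeakGradient (stripDomain h) u G)
    (hG : MemLp G 2 (volume.restrict (periodCell (stripDomain h) L)))
    (ht : HasTrace L (-1) (fun _ => 1) u 0) (hb : HasTrace L 1 h u k) :
    ∀ᵐ s ∂volume.restrict (Ioo 0 L), k s = -∫ y in (h s)..1, (G (s, y)).2 := by
  have h2 := (hb.lineRep (isLayer_strip_bot hh h0) hu hG).ae_ae
  filter_upwards [strip_fiber_top hh h0 hM hu hG ht, h2,
    ae_intervalIntegrable_strip hh h0 hM hG.snd] with s hs1 hs2 hi
  have hs0 := h0 s
  have hs1' := (ae_restrict_iff' measurableSet_Ioo).1 hs1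
  have hs3 := (measurePreserving_add_left volume (h s)).quasiMeasurePreserving.ae hs1'
  have : NeZero (volume.restrict (Ioo (0 : ℝ) 1)) := ⟨by
    rw [Ne, Measure.restrict_eq_zero, Real.volume_Ioo]; simp⟩
  obtain ⟨t, ht1, ht2, ht3⟩ := (hs2.and ((ae_restrict_of_ae hs3).and
    (ae_restrict_mem measurableSet_Ioo))).exists
  have ht2' := ht2 ⟨by linarith [ht3.1], by linarith [ht3.2]⟩
  have e1 : ∫ τ in (0 : ℝ)..t, 1 * (G (graphMap h 1 (s, τ))).2 =
      ∫ y in (h s)..(h s + t), (G (s, y)).2 := by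
    have := intervalIntegral.integral_comp_add_left (a := 0) (b := t)
      (fun y => (G (s, y)).2) (h s)
    rw [add_zero] at this
    rw [← this]
    simp only [graphMap, one_mul]
  have e2 : u (graphMap h 1 (s, t)) = u (s, h s + t) := by simp only [graphMap, one_mul]
  rw [e1, e2, ht2'] at ht1
  have mt : h s + t ∈ uIcc (h s) 1 := by
    rw [uIcc_of_le (by linarith)]; exact ⟨by linarith [ht3.1], by linarith [ht3.2]⟩
  have a1 := intervalIntegral.integral_add_adjacent_intervals
    (hi.mono_set (uIcc_subset_uIcc_left mt)) (hi.mono_set (uIcc_subset_uIcc_right mt))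
  linarith

/-- Poincaré's inequality for functions on a strip that vanish at the top. -/
lemma strip_poincare {M : ℝ} (hM0 : 0 ≤ M) (hh : Continuous h) (h0 : ∀ s, h s ≤ 0)
    (hM : ∀ s, -M ≤ h s) (hu : IsWeakGradient (stripDomain h) u G)
    (hG : MemLp G 2 (volume.restrict (periodCell (stripDomain h) L)))
    (ht : HasTrace L (-1) (fun _ => 1) u 0) :
    ∫⁻ x in periodCell (stripDomain h) L, ‖u x‖ₑ ^ 2 ≤
      ENNReal.ofReal ((1 + M) ^ 2) * ∫⁻ x in periodCell (stripDomain h) L, ‖(G x).2‖ₑ ^ 2 := by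
  have hD := isOpen_stripDomain hh
  have hum : AEStronglyMeasurable u (volume.restrict (periodCell (stripDomain h) L)) :=
    hu.locallyIntegrableOn.aestronglyMeasurable.mono_measure
      (Measure.restrict_mono (fun _ hx => hx.1) le_rfl)
  rw [lintegral_periodCell hD.measurableSet (hum.enorm.pow_const 2),
    lintegral_periodCell hD.measurableSet (hG.snd.1.enorm.pow_const 2),
    ← lintegral_const_mul' _ _ ENNReal.ofReal_ne_top]
  refine lintegral_mono_ae ?_
  filter_upwards [strip_fiber_top hh h0 hM hu hG ht] with s hs
  change ∫⁻ z in Ioo (h s) 1, _ ≤ _ * ∫⁻ z in Ioo (h s) 1, _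
  set B := ∫⁻ z in Ioo (h s) 1, ‖(G (s, z)).2‖ₑ ^ 2
  have hMs := hM s
  -- Cauchy–Schwarz on an interval of length at most `1 + M`; integrating over the fibre costs a
  -- second factor `1 + M`.
  have key : ∀ z ∈ Ioo (h s) 1, ‖-∫ y in z..1, (G (s, y)).2‖ₑ ^ 2 ≤ ENNReal.ofReal (1 + M) * B := by
    intro z hz
    have e := intervalIntegral.integral_comp_sub_left (a := 0) (b := 1 - z)
      (fun y => (G (s, y)).2) 1
    rw [sub_zero, sub_sub_cancel] at e
    rw [enorm_neg, ← e]
    refine (enorm_integral_sq_le (by linarith [hz.2])).trans ?_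
    refine mul_le_mul' (ENNReal.ofReal_le_ofReal (by linarith [hz.1])) ?_
    have hp : MeasurePreserving (fun y : ℝ => 1 - y) (volume.restrict (Ioo 0 (1 - z)))
        (volume.restrict (Ioo z 1)) := by
      have := (Measure.measurePreserving_sub_left volume (1 : ℝ)).restrict_preimage
        (measurableSet_Ioo (a := z) (b := 1))
      convert this using 2
      ext y; simp only [mem_Ioo, mem_preimage]
      constructor <;> rintro ⟨a, b⟩ <;> constructor <;> linarith
    have e3 := hp.lintegral_comp_emb (MeasurableEquiv.subLeft (1 : ℝ)).measurableEmbedding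
      (fun y => ‖(G (s, y)).2‖ₑ ^ 2)
    rw [e3]
    exact lintegral_mono_set (Ioo_subset_Ioo_left hz.1.le)
  calc ∫⁻ z in Ioo (h s) 1, ‖u (s, z)‖ₑ ^ 2
      ≤ ∫⁻ z in Ioo (h s) 1, ENNReal.ofReal (1 + M) * B := by
        refine lintegral_mono_ae ?_
        filter_upwards [hs, ae_restrict_mem measurableSet_Ioo] with z hz hz'
        rw [hz]
        exact key z hz'
    _ ≤ ENNReal.ofReal ((1 + M) ^ 2) * B := by
        rw [setLIntegral_const, Real.volume_Ioo, mul_right_comm, pow_two,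
          ENNReal.ofReal_mul (by linarith)]
        gcongr
        linarith

lemma strip_memLp {M : ℝ} (hM0 : 0 ≤ M) (hh : Continuous h) (h0 : ∀ s, h s ≤ 0)
    (hM : ∀ s, -M ≤ h s) (hu : IsWeakGradient (stripDomain h) u G)
    (hG : MemLp G 2 (volume.restrict (periodCell (stripDomain h) L)))
    (ht : HasTrace L (-1) (fun _ => 1) u 0) :
    MemLp u 2 (volume.restrict (periodCell (stripDomain h) L)) :=
  memLp_two_of_lintegral
    (hu.locallyIntegrableOn.aestronglyMeasurable.mono_measure
      (Measure.restrict_mono (fun _ hx => hx.1) le_rfl))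
    ((strip_poincare hM0 hh h0 hM hu hG ht).trans_lt
      (ENNReal.mul_lt_top ENNReal.ofReal_lt_top (lintegral_enorm_sq_lt_top hG.snd)))

/-- Green's formula on a strip, for the quadratic polynomials of the height. -/
lemma strip_green {M : ℝ} (hM0 : 0 ≤ M) (hh : Continuous h) (h0 : ∀ s, h s ≤ 0)
    (hM : ∀ s, -M ≤ h s) (hu : IsWeakGradient (stripDomain h) u G)
    (hG : MemLp G 2 (volume.restrict (periodCell (stripDomain h) L)))
    (ht : HasTrace L (-1) (fun _ => 1) u 0) (hb : HasTrace L 1 h u k) (a C : ℝ) :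
    ∫ x in periodCell (stripDomain h) L, (a - C * x.2) * (G x).2 =
      (∫ x in periodCell (stripDomain h) L, C * u x) -
        ∫ s in Ioo 0 L, (a - C * h s) * k s := by
  have hD := isOpen_stripDomain hh
  set A := periodCell (stripDomain h) L
  have hA : MeasurableSet A := measurableSet_periodCell hD L
  have hfin : IsFiniteMeasure (volume.restrict A) :=
    ⟨by rw [Measure.restrict_apply_univ]; exact volume_periodCell_strip_lt_top hM⟩
  have hui : Integrable u (volume.restrict A) :=
    (strip_memLp hM0 hh h0 hM hu hG ht).integrable (by norm_num)
  have hGi : Integrable (fun x => (a - C * x.2) * (G x).2) (volume.restrict A) := by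
    refine (hG.snd.integrable (by norm_num)).bdd_mul (c := |a| + |C| * (1 + M))
      (Continuous.aestronglyMeasurable (by fun_prop)) ?_
    filter_upwards [ae_restrict_mem hA] with x hx
    have h1 : -M < x.2 := lt_of_le_of_lt (hM _) hx.1.1
    have h2 : x.2 < 1 := hx.1.2
    have h3 : |x.2| ≤ 1 + M := abs_le.2 ⟨by linarith, by linarith⟩
    calc ‖a - C * x.2‖ ≤ |a| + |C * x.2| := abs_sub _ _
      _ ≤ |a| + |C| * (1 + M) := by rw [abs_mul]; gcongr
  have hk : Integrable (fun s => (a - C * h s) * k s) (volume.restrict (Ioo 0 L)) := by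
    refine (hb.memLp.integrable (by norm_num)).bdd_mul (c := |a| + |C| * (1 + M))
      (Continuous.aestronglyMeasurable (by fun_prop)) (ae_of_all _ fun s => ?_)
    have h3 : |h s| ≤ 1 + M := abs_le.2 ⟨by linarith [hM s], by linarith [h0 s]⟩
    calc ‖a - C * h s‖ ≤ |a| + |C * h s| := abs_sub _ _
      _ ≤ |a| + |C| * (1 + M) := by rw [abs_mul]; gcongr
  have hCu := hui.const_mul C
  rw [eq_sub_iff_add_eq, integral_periodCell hD.measurableSet hGi,
    integral_periodCell hD.measurableSet hCu, ← integral_add _ hk]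
  swap
  · rw [restrict_periodCell hD.measurableSet] at hGi
    refine ((integrable_indicator_iff hD.measurableSet).2 hGi).integral_prod_left.congr
      (ae_of_all _ fun s => ?_)
    simp_rw [indicator_fiber]
    rw [integral_indicator (measurableSet_fiber hD.measurableSet s)]
  refine integral_congr_ae ?_
  filter_upwards [strip_fiber_top hh h0 hM hu hG ht, strip_fiber_bot hh h0 hM hu hG ht hb,
    ae_intervalIntegrable_strip hh h0 hM hG.snd] with s hs1 hs2 hi
  change (∫ z in Ioo (h s) 1, _) + _ = ∫ z in Ioo (h s) 1, _
  have hle : h s ≤ 1 := by linarith [h0 s]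
  have e1 : ∫ z in Ioo (h s) 1, C * u (s, z) =
      ∫ z in (h s)..1, C * (k s + ∫ y in (h s)..z, (G (s, y)).2) := by
    rw [intervalIntegral.integral_of_le hle, integral_Ioc_eq_integral_Ioo]
    refine integral_congr_ae ?_
    filter_upwards [hs1, ae_restrict_mem measurableSet_Ioo] with z hz hz'
    have mz : z ∈ uIcc (h s) 1 := by rw [uIcc_of_le hle]; exact ⟨hz'.1.le, hz'.2.le⟩
    have a1 := intervalIntegral.integral_add_adjacent_intervals
      (hi.mono_set (uIcc_subset_uIcc_left mz)) (hi.mono_set (uIcc_subset_uIcc_right mz))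
    rw [hz]
    congr 1
    linarith
  -- The weight depends on the height only, so Green's formula is an integration by parts on each
  -- fibre. The boundary term at height `1` drops out because the primitive vanishes there.
  have key := intervalIntegral_comp_primitive_mul_deriv (φ := fun x => x) (φ' := fun _ => 1)
    (c := k s) (ψ := fun z => a - C * z) (M := 1) (fun x => hasDerivAt_id x) (by simp) hi
    left_mem_uIcc (by fun_prop)
  have hder : ∀ z, deriv (fun z => a - C * z) z = -C := fun z => by
    simp
  simp only [hder, intervalIntegral.integral_same, add_zero, one_mul] at key
  have hz : k s + ∫ y in (h s)..1, (G (s, y)).2 = 0 := by linarith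
  rw [hz] at key
  rw [e1, ← integral_Ioc_eq_integral_Ioo, ← intervalIntegral.integral_of_le hle]
  have e2 : ∫ z in (h s)..1, C * (k s + ∫ y in (h s)..z, (G (s, y)).2) =
      -∫ z in (h s)..1, (k s + ∫ y in (h s)..z, (G (s, y)).2) * -C := by
    rw [← intervalIntegral.integral_neg]
    congr 1; ext z; ring
  have e3 : ∫ z in (h s)..1, (a - C * z) * (G (s, z)).2 =
      ∫ z in (h s)..1, (G (s, z)).2 * (a - C * z) := by
    congr 1; ext z; ring
  rw [e2, key, e3]
  ring

end WallLaw

namespace WallLaw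

variable {D : Set (ℝ × ℝ)} {u v w : ℝ × ℝ → ℝ} {G H : ℝ × ℝ → ℝ × ℝ} {h g k : ℝ → ℝ} {L : ℝ}

/-! ### Linearity of traces -/

lemma ae_intervalIntegrable_layer {T : ℝ} {w : ℝ × ℝ → ℝ}
    (hw : MemLp w 2 (volume.restrict (layer L T))) :
    ∀ᵐ z ∂volume.restrict (layer L T), IntervalIntegrable (fun τ => w (z.1, τ)) volume 0 z.2 := by
  have hfin : IsFiniteMeasure (volume.restrict (layer L T)) := by
    rw [volume_restrict_layer]; infer_instance
  have hi : Integrable w (volume.restrict (layer L T)) := hw.integrable (by norm_num)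
  rw [volume_restrict_layer] at hi
  have h1 : ∀ᵐ z ∂(volume.restrict (Ioo 0 L)).prod (volume.restrict (Ioo 0 T)),
      Integrable (fun τ => w (z.1, τ)) (volume.restrict (Ioo 0 T)) :=
    Measure.quasiMeasurePreserving_fst.ae hi.prod_right_ae
  rw [← volume_restrict_layer] at h1
  filter_upwards [h1, ae_restrict_mem (measurableSet_layer L T)] with z hz hz'
  rw [intervalIntegrable_iff_integrableOn_Ioo_of_le hz'.2.1.le]
  exact IntegrableOn.mono_set hz (Ioo_subset_Ioo_right hz'.2.2.le)

lemma LineRep.add {T : ℝ} {U V p q : ℝ × ℝ → ℝ} {E F : ℝ → ℝ}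
    (hp : MemLp p 2 (volume.restrict (layer L T))) (hq : MemLp q 2 (volume.restrict (layer L T)))
    (hU : LineRep L T U p E) (hV : LineRep L T V q F) :
    LineRep L T (fun z => U z + V z) (fun z => p z + q z) (fun s => E s + F s) := by
  unfold LineRep at *
  filter_upwards [hU, hV, ae_intervalIntegrable_layer hp, ae_intervalIntegrable_layer hq]
    with z h1 h2 h3 h4
  rw [h1, h2, intervalIntegral.integral_add h3 h4]
  ring

/-- Traces are initial values of primitives on vertical lines, and those representations add. -/
lemma HasTrace.add {T σ : ℝ} (hl : IsLayer D L T σ h) (hu : IsWeakGradient D u G)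
    (hG : MemLp G 2 (volume.restrict (periodCell D L))) (hv : IsWeakGradient D v H)
    (hH : MemLp H 2 (volume.restrict (periodCell D L))) (tu : HasTrace L σ h u g)
    (tv : HasTrace L σ h v k) : HasTrace L σ h (fun x => u x + v x) (fun s => g s + k s) := by
  refine LineRep.hasTrace (G := fun x => G x + H x) hl (hG.add hH) (tu.memLp.add tv.memLp) ?_
  have := (tu.lineRep hl hu hG).add ((hl.memLp_snd hG).const_mul σ)
    ((hl.memLp_snd hH).const_mul σ) (tv.lineRep hl hv hH)
  simpa only [Prod.snd_add, mul_add] using this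

lemma HasTrace.const_mul {σ : ℝ} (c : ℝ) (tu : HasTrace L σ h u g) :
    HasTrace L σ h (fun x => c * u x) (fun s => c * g s) := by
  refine ⟨tu.memLp.const_mul c, ?_⟩
  have e : ∀ a b : ℝ, ‖c * a - c * b‖ₑ ^ 2 = ‖c‖ₑ ^ 2 * ‖a - b‖ₑ ^ 2 := fun a b => by
    rw [← mul_sub, enorm_mul, mul_pow]
  have hc : ‖c‖ₑ ^ 2 ≠ ⊤ := by simp
  have h1 := ENNReal.Tendsto.const_mul tu.tendsto (a := ‖c‖ₑ ^ 2) (Or.inr hc)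
  rw [mul_zero] at h1
  refine h1.congr fun d => ?_
  simp only [e]
  simp_rw [lintegral_const_mul' _ _ hc]
  ring

/-- A smooth function of the height has the obvious traces. -/
lemma hasTrace_comp_snd {P : ℝ → ℝ} (hP : ContDiff ℝ ∞ P) (hh : Continuous h) (L σ : ℝ) :
    HasTrace L σ h (fun x => P x.2) (fun s => P (h s)) := by
  have hP' : Continuous (deriv P) := hP.continuous_deriv (by simp)
  have hfin : IsFiniteMeasure (volume.restrict (layer L 1)) := by
    rw [volume_restrict_layer]; infer_instance
  have hc1 : Continuous fun s => P (h s) := hP.continuous.comp hh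
  have hc2 : Continuous fun z : ℝ × ℝ => σ * deriv P (h z.1 + σ * z.2) := by fun_prop
  refine ⟨?_, LineRep.tendsto (T := 1) (U := fun z => P (h z.1 + σ * z.2)) one_pos
    (g := fun z => σ * deriv P (h z.1 + σ * z.2)) (ae_of_all _ fun z => ?_) ?_⟩
  · obtain ⟨B, hB⟩ := isCompact_Icc.exists_bound_of_continuousOn (s := Icc 0 L) hc1.continuousOn
    refine MemLp.of_bound hc1.aestronglyMeasurable B ?_
    filter_upwards [ae_restrict_mem measurableSet_Ioo] with s hs
    exact hB s (Ioo_subset_Icc_self hs)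
  · have hd : ∀ τ ∈ uIcc 0 z.2, HasDerivAt (fun τ => P (h z.1 + σ * τ))
        (σ * deriv P (h z.1 + σ * τ)) τ := fun τ _ => by
      have h1 := ((hP.differentiable (by simp)) (h z.1 + σ * τ)).hasDerivAt
      have h2 : HasDerivAt (fun τ : ℝ => h z.1 + σ * τ) σ τ := by
        simpa using ((hasDerivAt_id τ).const_mul σ).const_add (h z.1)
      rw [mul_comm]
      exact h1.comp τ h2
    have := intervalIntegral.integral_eq_sub_of_hasDerivAt hd
      (Continuous.intervalIntegrable (by fun_prop) _ _)
    simp only [mul_zero, add_zero] at this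
    simp only [this]
    ring
  · obtain ⟨B, hB⟩ := (isCompact_Icc.prod isCompact_Icc).exists_bound_of_continuousOn
      (s := Icc 0 L ×ˢ Icc 0 1) hc2.continuousOn
    refine MemLp.of_bound hc2.aestronglyMeasurable B ?_
    filter_upwards [ae_restrict_mem (measurableSet_layer L 1)] with z hz
    exact hB z ⟨Ioo_subset_Icc_self hz.1, Ioo_subset_Icc_self hz.2⟩

/-! ### The quadratic profiles -/

/-- The solution `C/2 (1 - t) (t + a)` of `-P'' = C` that vanishes at height `1`. -/
def profile (C a t : ℝ) : ℝ := C / 2 * (1 - t) * (t + a)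

lemma contDiff_profile (C a : ℝ) : ContDiff ℝ ∞ (profile C a) := by
  unfold profile; fun_prop

lemma deriv_profile (C a t : ℝ) : deriv (profile C a) t = C / 2 * (1 - a) - C * t := by
  have h1 : HasDerivAt (fun t : ℝ => C / 2 * (1 - t)) (-(C / 2)) t := by
    simpa using ((hasDerivAt_id t).const_sub 1).const_mul (C / 2)
  have h2 : HasDerivAt (fun t : ℝ => t + a) 1 t := (hasDerivAt_id t).add_const a
  have h3 : HasDerivAt (profile C a) _ t := h1.fun_mul h2
  rw [h3.deriv]
  ring

lemma smoothDomain_eq : smoothDomain = stripDomain fun _ => 0 := rfl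

lemma memLp_comp_snd {P : ℝ → ℝ} {M : ℝ} (hP : Continuous P) (hM : ∀ s, -M ≤ h s)
    (hh : Continuous h) :
    MemLp (fun x : ℝ × ℝ => P x.2) 2 (volume.restrict (periodCell (stripDomain h) L)) := by
  have hfin : IsFiniteMeasure (volume.restrict (periodCell (stripDomain h) L)) :=
    ⟨by rw [Measure.restrict_apply_univ]; exact volume_periodCell_strip_lt_top hM⟩
  obtain ⟨B, hB⟩ := isCompact_Icc.exists_bound_of_continuousOn (s := Icc (-M) 1) hP.continuousOn
  refine MemLp.of_bound (hP.comp continuous_snd).aestronglyMeasurable B ?_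
  filter_upwards [ae_restrict_mem (measurableSet_periodCell (isOpen_stripDomain hh) L)] with x hx
  exact hB _ ⟨(hM _).trans hx.1.1.le, hx.1.2.le⟩

/-- The profile vanishes at height `1`, so the difference stays in the test space and can be
inserted into the equation of `u`. -/
lemma MemSmooth.sub_profile (hu : MemSmooth L u G g) (C a : ℝ) :
    MemSmooth L (fun x => u x + -1 * profile C a x.2)
      (fun x => G x + (-1 : ℝ) • ((0 : ℝ), deriv (profile C a) x.2))
      (fun s => g s + -1 * profile C a 0) := by
  have hw := (isWeakGradient_comp_snd (D := smoothDomain) (contDiff_profile C a)).const_mul (-1)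
  have hPd : Continuous (deriv (profile C a)) := (contDiff_profile C a).continuous_deriv (by simp)
  have hz : Continuous fun _ : ℝ => (0 : ℝ) := continuous_const
  have hm : MemLp (fun x : ℝ × ℝ => (-1 : ℝ) • ((0 : ℝ), deriv (profile C a) x.2)) 2
      (volume.restrict (periodCell smoothDomain L)) :=
    MemLp.const_smul (f := fun x : ℝ × ℝ => ((0 : ℝ), deriv (profile C a) x.2))
      (memLp_prodMk (MemLp.zero (ε := ℝ)) (memLp_comp_snd (M := 0) hPd (by simp) hz)) (-1 : ℝ)
  refine ⟨⟨⟨hu.memH1.isWeakGradient.add hw, ?_, ?_, hu.memH1.memLp_grad.add hm⟩, ?_⟩, ?_, ?_⟩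
  · filter_upwards [hu.memH1.periodic] with x hx
    simp only [hx]
  · filter_upwards [hu.memH1.periodic_grad] with x hx
    simp only [hx]
  · exact hu.memH1.memLp.add
      ((memLp_comp_snd (M := 0) (contDiff_profile C a).continuous (by simp) hz).const_mul (-1))
  · have h1 := hu.trace_top.add (isLayer_strip_top hz fun _ => le_rfl) hu.memH1.isWeakGradient
      hu.memH1.memLp_grad hw hm
      ((hasTrace_comp_snd (contDiff_profile C a) (continuous_const (y := 1)) L (-1)).const_mul (-1))
    convert h1 using 1
    ext s; simp [profile]
  · exact hu.trace_bot.add (isLayer_strip_bot hz fun _ => le_rfl) hu.memH1.isWeakGradient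
      hu.memH1.memLp_grad hw hm
      ((hasTrace_comp_snd (contDiff_profile C a) hz L 1).const_mul (-1))

/-- The energy identity of a wall law forces the difference to the quadratic profile to vanish. -/
lemma MemSmooth.ae_eq_zero (hL : 0 < L) (hv : MemSmooth L v H k) {C a c d S : ℝ} (hc : 0 ≤ c)
    (hS : 0 ≤ S) (hcd : c * (C / 2 * a) = C / 2 * (1 - a) + d)
    (hg : ∀ s, g s = k s + C / 2 * a)
    (hG : ∀ x, G x = H x + (0, C / 2 * (1 - a) - C * x.2))
    (heq : c * (∫ s in (0 : ℝ)..L, g s * k s) + dirichletForm (periodCell smoothDomain L) G H + S =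
      (∫ x in periodCell smoothDomain L, C * v x) + d * ∫ s in (0 : ℝ)..L, k s) :
    ∀ᵐ x ∂volume.restrict (periodCell smoothDomain L), v x = 0 := by
  have hz : Continuous fun _ : ℝ => (0 : ℝ) := continuous_const
  have hgreen := strip_green (M := 0) le_rfl hz (fun _ => le_rfl) (by simp)
    hv.memH1.isWeakGradient hv.memH1.memLp_grad hv.trace_top hv.trace_bot (C / 2 * (1 - a)) C
  rw [← smoothDomain_eq] at hgreen
  simp only [mul_zero, sub_zero] at hgreen
  rw [integral_const_mul (C / 2 * (1 - a)), ← integral_Ioc_eq_integral_Ioo,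
    ← intervalIntegral.integral_of_le hL.le] at hgreen
  set A := periodCell smoothDomain L
  have hki : MemLp k 2 (volume.restrict (Ioo 0 L)) := hv.trace_bot.memLp
  have hki1 : IntervalIntegrable k volume 0 L := by
    rw [intervalIntegrable_iff_integrableOn_Ioo_of_le hL.le]
    exact hki.integrable (by norm_num)
  have hki2 : IntervalIntegrable (fun s => k s ^ 2) volume 0 L := by
    rw [intervalIntegrable_iff_integrableOn_Ioo_of_le hL.le]
    exact hki.integrable_sq
  have e1 : ∫ s in (0 : ℝ)..L, g s * k s =
      (∫ s in (0 : ℝ)..L, k s ^ 2) + C / 2 * a * ∫ s in (0 : ℝ)..L, k s := by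
    rw [← intervalIntegral.integral_const_mul, ← intervalIntegral.integral_add hki2
      (hki1.const_mul _)]
    congr 1; ext s
    rw [hg]
    ring
  have hH1 := hv.memH1.memLp_grad.fst
  have hH2 := hv.memH1.memLp_grad.snd
  have i1 : Integrable (fun x => (H x).1 ^ 2 + (H x).2 ^ 2) (volume.restrict A) :=
    hH1.integrable_sq.add hH2.integrable_sq
  have i2 : Integrable (fun x => (C / 2 * (1 - a) - C * x.2) * (H x).2) (volume.restrict A) := by
    have hm : MemLp (fun x : ℝ × ℝ => C / 2 * (1 - a) - C * x.2) 2 (volume.restrict A) :=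
      memLp_comp_snd (h := fun _ => 0) (P := fun t => C / 2 * (1 - a) - C * t) (M := 0)
        (by fun_prop) (by simp) hz
    exact hm.integrable_mul hH2
  have e2 : dirichletForm A G H = (∫ x in A, ((H x).1 ^ 2 + (H x).2 ^ 2)) +
      ∫ x in A, (C / 2 * (1 - a) - C * x.2) * (H x).2 := by
    rw [dirichletForm, ← integral_add i1 i2]
    congr 1; ext x
    simp only [hG, Prod.fst_add, Prod.snd_add]
    ring
  rw [e1, e2, hgreen] at heq
  have hk0 : 0 ≤ ∫ s in (0 : ℝ)..L, k s ^ 2 :=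
    intervalIntegral.integral_nonneg hL.le fun s _ => sq_nonneg _
  have hX0 : 0 ≤ ∫ x in A, ((H x).1 ^ 2 + (H x).2 ^ 2) := integral_nonneg fun x => by positivity
  -- The hypothesis `hcd` is the wall law for the profile, `c P(0) = P'(0) + d`. It cancels all
  -- terms linear in `k`, and what remains is a vanishing sum of nonnegative terms.
  have hX : ∫ x in A, ((H x).1 ^ 2 + (H x).2 ^ 2) = 0 := by
    have hck := mul_nonneg hc hk0
    have : c * (∫ s in (0 : ℝ)..L, k s ^ 2) + (∫ x in A, ((H x).1 ^ 2 + (H x).2 ^ 2)) + S =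
        (C / 2 * (1 - a) + d - c * (C / 2 * a)) * ∫ s in (0 : ℝ)..L, k s := by
      linear_combination heq
    rw [hcd, sub_self, zero_mul] at this
    linarith
  have hH0 : ∀ᵐ x ∂volume.restrict A, (H x).2 = 0 := by
    filter_upwards [(integral_eq_zero_iff_of_nonneg (fun x => by positivity) i1).1 hX] with x hx
    simp only [Pi.zero_apply] at hx
    nlinarith [sq_nonneg (H x).1, sq_nonneg (H x).2]
  -- A vanishing vertical derivative suffices, since the difference is zero at the top.
  have hp := strip_poincare (M := 0) le_rfl hz (fun _ => le_rfl) (by simp)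
    hv.memH1.isWeakGradient hv.memH1.memLp_grad hv.trace_top
  have hp0 : ∫⁻ x in A, ‖(H x).2‖ₑ ^ 2 = 0 := by
    rw [lintegral_congr_ae (g := fun _ => 0) (by filter_upwards [hH0] with x hx; simp [hx]),
      lintegral_zero]
  rw [← smoothDomain_eq, hp0, mul_zero, nonpos_iff_eq_zero, lintegral_eq_zero_iff' (hv.memH1.memLp.1.enorm.pow_const 2)] at hp
  filter_upwards [hp] with x hx
  simpa using hx

/-- The parameter solves `a = ε m (1 - a)`, that is, P(0) = ε m P'(0). Uniqueness is the energy
identity with `S = 0`; `m > 0` makes the boundary term nonnegative. -/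
lemma IsRobinSolution.ae_eq {C ε m : ℝ} (hL : 0 < L) (hε : 0 < ε) (hm : 0 < m)
    (hu : IsRobinSolution L C ε m u) :
    ∀ᵐ x ∂volume.restrict (periodCell smoothDomain L),
      u x = profile C (ε * m / (1 + ε * m)) x.2 := by
  obtain ⟨G, g, hmem, heq⟩ := hu
  have hp : 0 < ε * m := by positivity
  set a := ε * m / (1 + ε * m) with ha
  have hz := (hmem.sub_profile C a).ae_eq_zero hL (c := 1 / (ε * m)) (C := C) (a := a) (d := 0)
    (S := 0) (g := g) (G := G) (by positivity) le_rfl (by rw [ha]; field_simp; ring)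
    (fun s => by simp only [profile]; ring) (fun x => by ext <;> simp [deriv_profile]; ring)
    (by rw [heq _ _ _ (hmem.sub_profile C a)]; ring)
  filter_upwards [hz] with x hx
  linarith

lemma MemH1Line.add_const {g' : ℝ → ℝ} (hg : MemH1Line L g g') (c : ℝ) :
    MemH1Line L (fun s => g s + c) g' where
  locallyIntegrable := hg.locallyIntegrable.add (locallyIntegrable_const c)
  locallyIntegrable_deriv := hg.locallyIntegrable_deriv
  integral := fun φ hφ hs => by
    have hd : Continuous (deriv φ) := hφ.continuous_deriv (by simp)
    have i1 : Integrable fun s => g s * deriv φ s := by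
      simpa only [smul_eq_mul, mul_comm] using
        hg.locallyIntegrable.integrable_smul_left_of_hasCompactSupport hd hs.deriv
    have i2 : Integrable fun s => c * deriv φ s :=
      (hd.integrable_of_hasCompactSupport hs.deriv).const_mul c
    simp only [add_mul]
    rw [integral_add i1 i2, hg.integral φ hφ hs, integral_const_mul,
      integral_eq_zero_of_hasDerivAt_of_integrable
        (fun x => ((hφ.differentiable (by simp)) x).hasDerivAt)
        (hd.integrable_of_hasCompactSupport hs.deriv)
        (hφ.continuous.integrable_of_hasCompactSupport hs)]
    ring
  periodic := by filter_upwards [hg.periodic] with s hs; rw [hs]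
  periodic_deriv := hg.periodic_deriv
  memLp := hg.memLp.add (memLp_const c)
  memLp_deriv := hg.memLp_deriv

/-- Since P'' = -C, the law P(0) = ε m P'(0) + (ε²/2) n P''(0) reads `a (1 + ε m) = ε m - ε² n`. The
profile is constant along `Γ⁰`, so the difference has the tangential derivative `g'`, and the
tangential term is a nonnegative `S` precisely because `n ≤ 0`. -/
lemma IsWentzellSolution.ae_eq {C ε m n : ℝ} (hL : 0 < L) (hε : 0 < ε) (hm : 0 < m) (hn : n ≤ 0)
    (hu : IsWentzellSolution L C ε m n u) :
    ∀ᵐ x ∂volume.restrict (periodCell smoothDomain L),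
      u x = profile C ((ε * m - ε ^ 2 * n) / (1 + ε * m)) x.2 := by
  obtain ⟨G, g, g', hmem, hline, heq⟩ := hu
  have hp : 0 < ε * m := by positivity
  set a := (ε * m - ε ^ 2 * n) / (1 + ε * m) with ha
  have hS : 0 ≤ -(ε * (n / (2 * m)) * ∫ s in (0 : ℝ)..L, g' s * g' s) := by
    have h1 : 0 ≤ ∫ s in (0 : ℝ)..L, g' s * g' s :=
      intervalIntegral.integral_nonneg hL.le fun s _ => mul_self_nonneg _
    have h2 : n / (2 * m) ≤ 0 := div_nonpos_of_nonpos_of_nonneg hn (by positivity)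
    have h3 : ε * (n / (2 * m)) ≤ 0 := mul_nonpos_of_nonneg_of_nonpos hε.le h2
    linarith [mul_nonpos_of_nonpos_of_nonneg h3 h1]
  have hz := (hmem.sub_profile C a).ae_eq_zero hL (c := 1 / (ε * m)) (C := C) (a := a)
    (d := -(ε * (n / (2 * m)) * C)) (g := g) (G := G) (by positivity) hS
    (by rw [ha]; field_simp; ring)
    (fun s => by simp only [profile]; ring) (fun x => by ext <;> simp [deriv_profile]; ring)
    (by
      have h1 := heq _ _ _ _ (hmem.sub_profile C a) (hline.add_const _)
      rw [intervalIntegral.integral_const_mul C] at h1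
      linarith)
  filter_upwards [hz] with x hx
  linarith

end WallLaw

namespace WallLaw

variable {D : Set (ℝ × ℝ)} {u v w β : ℝ × ℝ → ℝ} {G H : ℝ × ℝ → ℝ × ℝ} {f h g k : ℝ → ℝ}
  {L ε : ℝ} {N : ℕ}

/-! ### Decomposition of a macroscopic period into microscopic cells -/

/-- The set `D` is `2π`-periodic in the first variable. -/
def IsCellPeriodic (D : Set (ℝ × ℝ)) : Prop := ∀ x, (x.1 + 2 * Real.pi, x.2) ∈ D ↔ x ∈ D

lemma IsCellPeriodic.nat (hD : IsCellPeriodic D) (n : ℕ) (x : ℝ × ℝ) :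
    (x.1 + 2 * Real.pi * n, x.2) ∈ D ↔ x ∈ D := by
  induction n with
  | zero => simp
  | succ n ih =>
    rw [← ih, ← hD (x.1 + 2 * Real.pi * n, x.2)]
    push_cast
    ring_nf

lemma dil_inv_dil (hε : 0 < ε) (n : ℕ) (y : ℝ × ℝ) :
    dil ε⁻¹ 0 (dil ε (2 * Real.pi * ε * n) y) = (y.1 + 2 * Real.pi * n, y.2) := by
  ext
  · simp only [dil]; field_simp; ring
  · simp only [dil]; field_simp

lemma measurableEmbedding_dil (hε : 0 < ε) (a : ℝ) : MeasurableEmbedding (dil ε a) :=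
  (dilHomeo ε a hε.ne').measurableEmbedding

/-- Lebesgue measure on a macroscopic period is the sum of the scaled copies of Lebesgue measure on
a cell. -/
lemma restrict_periodCell_dil (hε : 0 < ε) (hL : L = 2 * Real.pi * ε * N) (hD : MeasurableSet D)
    (hp : IsCellPeriodic D) :
    volume.restrict (periodCell (dil ε⁻¹ 0 ⁻¹' D) L) =
      ∑ n : Fin N, ENNReal.ofReal (ε ^ 2) •
        Measure.map (dil ε (2 * Real.pi * ε * (n : ℕ))) (volume.restrict (periodCell D (2 * Real.pi))) := by
  set c := 2 * Real.pi * ε with hc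
  have hc0 : 0 < c := by have := Real.pi_pos; positivity
  -- The column over the `n`-th microscopic period. The columns are disjoint and exhaust the
  -- macroscopic period up to the vertical lines between them, which are null.
  let A : Fin N → Set (ℝ × ℝ) := fun n =>
    dil ε⁻¹ 0 ⁻¹' D ∩ Prod.fst ⁻¹' (Ioo (c * (n : ℕ)) (c * ((n : ℕ) + 1)))
  have hDm : MeasurableSet (dil ε⁻¹ 0 ⁻¹' D) :=
    (measurableEmbedding_dil (inv_pos.2 hε) 0).measurable hD
  have hA : ∀ n, MeasurableSet (A n) := fun n => hDm.inter (measurable_fst measurableSet_Ioo)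
  have hterm : ∀ n : Fin N, ENNReal.ofReal (ε ^ 2) •
      Measure.map (dil ε (c * (n : ℕ))) (volume.restrict (periodCell D (2 * Real.pi))) =
        volume.restrict (A n) := by
    intro n
    have hpre : dil ε (c * (n : ℕ)) ⁻¹' (A n) = periodCell D (2 * Real.pi) := by
      ext y
      simp only [A, mem_preimage, mem_inter_iff, periodCell, mem_ofPred_eq]
      rw [hc, dil_inv_dil hε, hp.nat]
      refine and_congr_right fun _ => ?_
      simp only [dil, mem_Ioo]
      constructor
      · rintro ⟨h1, h2⟩
        exact ⟨by nlinarith, by nlinarith⟩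
      · rintro ⟨h1, h2⟩
        exact ⟨by nlinarith, by nlinarith⟩
    rw [← hpre, ← Measure.restrict_map (measurableEmbedding_dil hε _).measurable (hA n),
      map_dil hε, Measure.restrict_smul, smul_smul, ← ENNReal.ofReal_mul (by positivity),
      mul_inv_cancel₀ (by positivity), ENNReal.ofReal_one, one_smul]
  simp_rw [hterm]
  have hdisj : Pairwise (Function.onFun Disjoint A) := by
    have key : ∀ i j : Fin N, i < j → Disjoint (A i) (A j) := by
      intro i j hij
      rw [Set.disjoint_left]
      rintro x ⟨-, h1⟩ ⟨-, h2⟩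
      have h3 : ((i : ℕ) : ℝ) + 1 ≤ (j : ℕ) := by exact_mod_cast hij
      have h4 : x.1 < c * ((i : ℕ) + 1) := h1.2
      have h5 : c * (j : ℕ) < x.1 := h2.1
      nlinarith
    intro i j hij
    rcases lt_or_gt_of_ne hij with hh | hh
    · exact key i j hh
    · exact (key j i hh).symm
  rw [← Measure.sum_fintype, ← Measure.restrict_iUnion hdisj hA]
  apply Measure.restrict_congr_set
  have hae : ∀ᵐ x : ℝ × ℝ, ∀ n : ℕ, x.1 ≠ c * n := by
    rw [ae_all_iff]
    intro n
    have h1 : ∀ᵐ s : ℝ, s ≠ c * n := by simp [ae_iff]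
    rw [Measure.volume_eq_prod]
    exact Measure.quasiMeasurePreserving_fst.ae h1
  filter_upwards [hae] with x hx
  apply propext
  change (x ∈ dil ε⁻¹ 0 ⁻¹' D ∧ x.1 ∈ Ioo 0 L) ↔ x ∈ ⋃ n, A n
  rw [mem_iUnion]
  constructor
  · rintro ⟨h1, h2⟩
    have hfl := Nat.floor_le (div_nonneg h2.1.le hc0.le)
    have hfl' := Nat.lt_floor_add_one (x.1 / c)
    rw [le_div_iff₀ hc0, mul_comm] at hfl
    rw [div_lt_iff₀ hc0, mul_comm] at hfl'
    have hlt : ⌊x.1 / c⌋₊ < N := by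
      rw [Nat.floor_lt (div_nonneg h2.1.le hc0.le), div_lt_iff₀ hc0, mul_comm, ← hL]
      exact h2.2
    exact ⟨⟨_, hlt⟩, h1, lt_of_le_of_ne hfl (hx _).symm, hfl'⟩
  · rintro ⟨n, h1, h2⟩
    have h3 : ((n : ℕ) : ℝ) + 1 ≤ N := by exact_mod_cast n.2
    have h4 : (0 : ℝ) ≤ (n : ℕ) := by positivity
    refine ⟨h1, lt_of_le_of_lt (by positivity) h2.1, lt_of_lt_of_le h2.2 ?_⟩
    rw [hL]
    exact mul_le_mul_of_nonneg_left h3 hc0.le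

lemma ofReal_sq_ne_zero (hε : 0 < ε) : ENNReal.ofReal (ε ^ 2) ≠ 0 := by
  rw [Ne, ENNReal.ofReal_eq_zero, not_le]; positivity

lemma ae_periodCell_dil_iff (hε : 0 < ε) (hL : L = 2 * Real.pi * ε * N) (hD : MeasurableSet D)
    (hp : IsCellPeriodic D) {p : ℝ × ℝ → Prop} :
    (∀ᵐ x ∂volume.restrict (periodCell (dil ε⁻¹ 0 ⁻¹' D) L), p x) ↔
      ∀ n : Fin N, ∀ᵐ y ∂volume.restrict (periodCell D (2 * Real.pi)),
        p (dil ε (2 * Real.pi * ε * (n : ℕ)) y) := by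
  rw [restrict_periodCell_dil hε hL hD hp, ← Measure.sum_fintype, Measure.ae_sum_iff]
  refine forall_congr' fun n => ?_
  rw [Measure.ae_ennreal_smul_measure_iff (ofReal_sq_ne_zero hε),
    (measurableEmbedding_dil hε _).ae_map_iff]

lemma integrable_periodCell_dil_iff (hε : 0 < ε) (hL : L = 2 * Real.pi * ε * N)
    (hD : MeasurableSet D) (hp : IsCellPeriodic D) :
    Integrable w (volume.restrict (periodCell (dil ε⁻¹ 0 ⁻¹' D) L)) ↔
      ∀ n : Fin N, Integrable (fun y => w (dil ε (2 * Real.pi * ε * (n : ℕ)) y))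
        (volume.restrict (periodCell D (2 * Real.pi))) := by
  rw [restrict_periodCell_dil hε hL hD hp, integrable_finsetSum_measure]
  simp only [Finset.mem_univ, true_imp_iff]
  refine forall_congr' fun n => ?_
  rw [integrable_smul_measure (ofReal_sq_ne_zero hε) ENNReal.ofReal_ne_top,
    (measurableEmbedding_dil hε _).integrable_map_iff]
  rfl

lemma integral_periodCell_dil (hε : 0 < ε) (hL : L = 2 * Real.pi * ε * N)
    (hD : MeasurableSet D) (hp : IsCellPeriodic D)
    (hw : Integrable w (volume.restrict (periodCell (dil ε⁻¹ 0 ⁻¹' D) L))) :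
    ∫ x in periodCell (dil ε⁻¹ 0 ⁻¹' D) L, w x =
      ∑ n : Fin N, ε ^ 2 * ∫ y in periodCell D (2 * Real.pi),
        w (dil ε (2 * Real.pi * ε * (n : ℕ)) y) := by
  rw [restrict_periodCell_dil hε hL hD hp] at hw ⊢
  rw [integral_finsetSum_measure (integrable_finsetSum_measure.1 hw)]
  refine Finset.sum_congr rfl fun n _ => ?_
  rw [integral_smul_measure, (measurableEmbedding_dil hε _).integral_map,
    ENNReal.toReal_ofReal (by positivity), smul_eq_mul]

lemma memLp_comp_dil_cell {E : Type*} [NormedAddCommGroup E] {W : ℝ × ℝ → E} (hε : 0 < ε)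
    (hL : L = 2 * Real.pi * ε * N) (hD : MeasurableSet D) (hp : IsCellPeriodic D)
    (hW : MemLp W 2 (volume.restrict (periodCell (dil ε⁻¹ 0 ⁻¹' D) L))) (n : Fin N) :
    MemLp (fun y => W (dil ε (2 * Real.pi * ε * (n : ℕ)) y)) 2
      (volume.restrict (periodCell D (2 * Real.pi))) := by
  rw [restrict_periodCell_dil hε hL hD hp, ← Measure.sum_fintype] at hW
  have h1 := (hW.mono_measure (Measure.le_sum _ n)).smul_measure
    (c := (ENNReal.ofReal (ε ^ 2))⁻¹) (by simpa using by positivity)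
  rw [smul_smul, ENNReal.inv_mul_cancel (ofReal_sq_ne_zero hε) ENNReal.ofReal_ne_top, one_smul] at h1
  exact (measurableEmbedding_dil hε _).memLp_map_measure_iff.1 h1

/-! ### Periodic functions at the microscopic scale -/

lemma measurePreserving_translate (a : ℝ) :
    MeasurePreserving (fun x : ℝ × ℝ => (x.1 + a, x.2)) volume volume := by
  have := measurePreserving_add_right (volume : Measure (ℝ × ℝ)) (a, 0)
  convert this using 1
  ext x <;> simp

lemma IsPeriodicOn.nat {E : Type*} {W : ℝ × ℝ → E} (hD : MeasurableSet D) (hp : IsCellPeriodic D)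
    (hW : IsPeriodicOn D (2 * Real.pi) W) (n : ℕ) :
    ∀ᵐ x ∂volume.restrict D, W (x.1 + 2 * Real.pi * n, x.2) = W x := by
  induction n with
  | zero => simp
  | succ n ih =>
    unfold IsPeriodicOn at hW
    rw [ae_restrict_iff' hD] at hW
    have h1 := (measurePreserving_translate (2 * Real.pi * n)).quasiMeasurePreserving.ae hW
    filter_upwards [ih, ae_restrict_of_ae h1, ae_restrict_mem hD] with x hx hx' hxD
    rw [← hx, ← hx' ((hp.nat n x).2 hxD)]
    push_cast
    ring_nf

lemma IsPeriodicOn.periodCell_nat {E : Type*} {W : ℝ × ℝ → E} (hD : MeasurableSet D)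
    (hp : IsCellPeriodic D) (hW : IsPeriodicOn D (2 * Real.pi) W) (n : ℕ) :
    ∀ᵐ x ∂volume.restrict (periodCell D (2 * Real.pi)),
      W (x.1 + 2 * Real.pi * n, x.2) = W x :=
  ae_restrict_of_ae_restrict_of_subset (fun _ hx => hx.1) (hW.nat hD hp n)

lemma ae_comp_dil (hε : 0 < ε) (a : ℝ) {p : ℝ × ℝ → Prop} (hpp : ∀ᵐ x, p x) :
    ∀ᵐ x, p (dil ε a x) := by
  rw [← (measurableEmbedding_dil hε a).ae_map_iff, map_dil hε a]
  exact Measure.ae_smul_measure hpp _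

lemma IsPeriodicOn.comp_dil {E : Type*} {W : ℝ × ℝ → E} (hε : 0 < ε)
    (hL : L = 2 * Real.pi * ε * N) (hD : MeasurableSet D)
    (hp : IsCellPeriodic D) (hW : IsPeriodicOn D (2 * Real.pi) W) :
    IsPeriodicOn (dil ε⁻¹ 0 ⁻¹' D) L (fun x => W (dil ε⁻¹ 0 x)) := by
  have h1 := hW.nat hD hp N
  rw [ae_restrict_iff' hD] at h1
  have h2 := ae_comp_dil (inv_pos.2 hε) 0 h1
  unfold IsPeriodicOn
  rw [ae_restrict_iff' ((measurableEmbedding_dil (inv_pos.2 hε) 0).measurable hD)]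
  filter_upwards [h2] with x hx hxD
  rw [← hx hxD, hL]
  congr 1
  ext
  · simp only [dil]; field_simp; ring
  · simp only [dil]

/-- All `N` cells contribute equally by periodicity. Since `N ε² = L ε / (2π)`, functions integrable
over one cell have integral `O(ε)` after scaling, which is where the rate `ε^{1/2}` of the
correctors originates. -/
lemma integral_comp_dil_inv (hε : 0 < ε) (hL : L = 2 * Real.pi * ε * N) (hD : MeasurableSet D)
    (hp : IsCellPeriodic D) (hw : IsPeriodicOn D (2 * Real.pi) w)
    (hi : Integrable w (volume.restrict (periodCell D (2 * Real.pi)))) :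
    Integrable (fun x => w (dil ε⁻¹ 0 x)) (volume.restrict (periodCell (dil ε⁻¹ 0 ⁻¹' D) L)) ∧
      ∫ x in periodCell (dil ε⁻¹ 0 ⁻¹' D) L, w (dil ε⁻¹ 0 x) =
        N * ε ^ 2 * ∫ y in periodCell D (2 * Real.pi), w y := by
  have hae : ∀ n : Fin N, (fun y => w (dil ε⁻¹ 0 (dil ε (2 * Real.pi * ε * (n : ℕ)) y)))
      =ᵐ[volume.restrict (periodCell D (2 * Real.pi))] w := fun n => by
    filter_upwards [hw.periodCell_nat hD hp n] with y hy
    rw [dil_inv_dil hε, hy]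
  have h1 : Integrable (fun x => w (dil ε⁻¹ 0 x))
      (volume.restrict (periodCell (dil ε⁻¹ 0 ⁻¹' D) L)) :=
    (integrable_periodCell_dil_iff hε hL hD hp).2 fun n => hi.congr (hae n).symm
  refine ⟨h1, ?_⟩
  rw [integral_periodCell_dil hε hL hD hp h1,
    Finset.sum_congr rfl fun n _ => by rw [integral_congr_ae (hae n)]]
  simp
  ring

end WallLaw

namespace WallLaw

variable {D : Set (ℝ × ℝ)} {u v w β : ℝ × ℝ → ℝ} {G H : ℝ × ℝ → ℝ × ℝ} {f h g k : ℝ → ℝ}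
  {L ε : ℝ} {N : ℕ}

/-! ### The scaled cell domain -/

lemma cellDomain_wall (hε : 0 < ε) : cellDomain (wall f ε) = dil ε⁻¹ 0 ⁻¹' cellDomain f := by
  ext x
  simp only [cellDomain, wall, mem_preimage, mem_ofPred_eq, dil, add_zero]
  rw [show x.1 / ε = ε⁻¹ * x.1 by ring, show ε⁻¹ * x.2 = x.2 / ε by ring, lt_div_iff₀ hε, mul_comm]

lemma IsRoughProfile.nat (hf : IsRoughProfile f) (n : ℕ) (s : ℝ) :
    f (s + 2 * Real.pi * n) = f s := by
  rw [mul_comm]; exact hf.periodic.nat_mul n s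

lemma IsRoughProfile.isCellPeriodic (hf : IsRoughProfile f) : IsCellPeriodic (cellDomain f) := by
  intro x
  simp only [cellDomain, mem_ofPred_eq]
  rw [hf.periodic]

lemma IsRoughProfile.continuous_wall (hf : IsRoughProfile f) (ε : ℝ) : Continuous (wall f ε) := by
  have := hf.continuous
  unfold wall; fun_prop

lemma IsRoughProfile.wall_neg (hf : IsRoughProfile f) (hε : 0 < ε) (s : ℝ) : wall f ε s < 0 :=
  mul_neg_of_pos_of_neg hε (hf.lt_zero _)

lemma IsRoughProfile.le_wall (hf : IsRoughProfile f) (hε : 0 < ε) (s : ℝ) : -ε ≤ wall f ε s := by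
  have := (hf.mem_Ico (s / ε)).1
  unfold wall; nlinarith

lemma layer_eq_periodCell (L T : ℝ) : layer L T = periodCell {y | y.2 ∈ Ioo 0 T} L := by
  ext x
  exact and_comm

lemma layer_eq_periodCell_dil (hε : 0 < ε) (L : ℝ) :
    layer L ε = periodCell (dil ε⁻¹ 0 ⁻¹' {y | y.2 ∈ Ioo 0 1}) L := by
  rw [layer_eq_periodCell]
  congr 1
  ext x
  simp only [mem_preimage, mem_ofPred_eq, dil, mem_Ioo]
  rw [show ε⁻¹ * x.2 = x.2 / ε by ring, div_lt_one hε]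
  exact and_congr_left fun _ => (div_pos_iff_of_pos_right hε).symm

lemma ae_layer_dil_iff (hε : 0 < ε) (hL : L = 2 * Real.pi * ε * N) {p : ℝ × ℝ → Prop} :
    (∀ᵐ x ∂volume.restrict (layer L ε), p x) ↔
      ∀ n : Fin N, ∀ᵐ y ∂volume.restrict (layer (2 * Real.pi) 1),
        p (dil ε (2 * Real.pi * ε * (n : ℕ)) y) := by
  rw [layer_eq_periodCell_dil hε, layer_eq_periodCell]
  exact ae_periodCell_dil_iff hε hL (measurable_snd measurableSet_Ioo) fun x => Iff.rfl

lemma graphMap_wall_dil (hf : IsRoughProfile f) (hε : 0 < ε) (n : ℕ) (y : ℝ × ℝ) :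
    graphMap (wall f ε) 1 (dil ε (2 * Real.pi * ε * n) y) =
      dil ε (2 * Real.pi * ε * n) (graphMap f 1 y) := by
  have e : (ε * y.1 + 2 * Real.pi * ε * n) / ε = y.1 + 2 * Real.pi * n := by field_simp
  ext
  · rfl
  · simp only [graphMap, dil, wall, e, hf.nat]; ring

/-! ### Scaling of functions on the cell -/

lemma MemD12.comp_dil (hε : 0 < ε) (hL : L = 2 * Real.pi * ε * N) (hD : IsOpen D)
    (hp : IsCellPeriodic D) (hu : MemD12 D (2 * Real.pi) u G) :
    MemD12 (dil ε⁻¹ 0 ⁻¹' D) L (fun x => u (dil ε⁻¹ 0 x)) (fun x => ε⁻¹ • G (dil ε⁻¹ 0 x)) := by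
  have hw := hu.isWeakGradient.comp_dil (inv_pos.2 hε) 0 hD
  have hpg := hu.periodic_grad.comp_dil hε hL hD.measurableSet hp
  refine ⟨hw, hu.periodic.comp_dil hε hL hD.measurableSet hp, ?_, ?_⟩
  · filter_upwards [hpg] with x hx
    rw [hx]
  · have hm : AEStronglyMeasurable (fun x => ε⁻¹ • G (dil ε⁻¹ 0 x))
        (volume.restrict (periodCell (dil ε⁻¹ 0 ⁻¹' D) L)) :=
      hw.locallyIntegrableOn_grad.aestronglyMeasurable.mono_measure
        (Measure.restrict_mono (fun _ hx => hx.1) le_rfl)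
    rw [memLp_two_iff_integrable_sq_norm hm]
    have hq : IsPeriodicOn D (2 * Real.pi) fun y => ‖G y‖ ^ 2 := by
      filter_upwards [hu.periodic_grad] with x hx
      rw [hx]
    have := (integral_comp_dil_inv hε hL hD.measurableSet hp hq
      ((memLp_two_iff_integrable_sq_norm hu.memLp_grad.1).1 hu.memLp_grad)).1
    refine (this.const_mul (ε⁻¹ ^ 2)).congr (ae_of_all _ fun x => ?_)
    simp only [norm_smul, mul_pow, Real.norm_eq_abs, sq_abs]

/-- The line representation in the unit layer along `f` is carried, column by column, to the layer
of thickness `ε` along the scaled wall; the factor `ε⁻¹` of the gradient cancels the Jacobian of the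
vertical variable. -/
lemma HasTrace.comp_dil (hf : IsRoughProfile f) (hε : 0 < ε) (hL : L = 2 * Real.pi * ε * N)
    (hu : MemD12 (cellDomain f) (2 * Real.pi) u G) (hg : Continuous g)
    (hgp : Function.Periodic g (2 * Real.pi)) (ht : HasTrace (2 * Real.pi) 1 f u g) :
    HasTrace L 1 (wall f ε) (fun x => u (dil ε⁻¹ 0 x)) (fun s => g (s / ε)) := by
  have hs := hu.comp_dil hε hL hf.isOpen hf.isCellPeriodic
  rw [← cellDomain_wall hε] at hs
  have hl : IsLayer (cellDomain (wall f ε)) L ε 1 (wall f ε) :=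
    isLayer_graph (hf.continuous_wall ε) (hf.wall_neg hε) hε
  have hl1 : IsLayer (cellDomain f) (2 * Real.pi) 1 1 f :=
    isLayer_graph hf.continuous hf.lt_zero one_pos
  refine LineRep.hasTrace hl hs.memLp_grad ?_ ?_
  · have hc : Continuous fun s => g (s / ε) := by fun_prop
    obtain ⟨B, hB⟩ := isCompact_Icc.exists_bound_of_continuousOn (s := Icc 0 L) hc.continuousOn
    refine MemLp.of_bound hc.aestronglyMeasurable B ?_
    filter_upwards [ae_restrict_mem measurableSet_Ioo] with s hs
    exact hB s (Ioo_subset_Icc_self hs)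
  have hrep := ht.lineRep hl1 hu.isWeakGradient hu.memLp_grad
  unfold LineRep at hrep ⊢
  rw [ae_layer_dil_iff hε hL]
  intro n
  have hper : ∀ {E : Type} (W : ℝ × ℝ → E), IsPeriodicOn (cellDomain f) (2 * Real.pi) W →
      ∀ᵐ y ∂volume.restrict (layer (2 * Real.pi) 1),
        W ((graphMap f 1 y).1 + 2 * Real.pi * (n : ℕ), (graphMap f 1 y).2) = W (graphMap f 1 y) := by
    intro E W hW
    have h1 := hW.nat hf.isOpen.measurableSet hf.isCellPeriodic n
    rw [ae_restrict_iff' hf.isOpen.measurableSet] at h1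
    have h2 := (measurePreserving_graphMap hf.continuous.measurable
      (Or.inl rfl : (1 : ℝ) = 1 ∨ (1 : ℝ) = -1)).quasiMeasurePreserving.ae h1
    filter_upwards [ae_restrict_of_ae h2, ae_restrict_mem (measurableSet_layer _ _)] with y hy hy'
    exact hy (hl1.mem y hy')
  have hG := hper G hu.periodic_grad
  rw [volume_restrict_layer] at hG
  have hG1 := Measure.quasiMeasurePreserving_fst (μ := volume.restrict (Ioo 0 (2 * Real.pi)))
    (ν := volume.restrict (Ioo (0 : ℝ) 1)) |>.ae (Measure.ae_ae_of_ae_prod hG)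
  rw [← volume_restrict_layer] at hG1
  filter_upwards [hrep, hper u hu.periodic, hG1, ae_restrict_mem (measurableSet_layer _ _)]
    with y h1 h2 h3 h4
  rw [graphMap_wall_dil hf hε, dil_inv_dil hε, h2, h1]
  congr 1
  · simp only [dil]
    rw [show (ε * y.1 + 2 * Real.pi * ε * (n : ℕ)) / ε = y.1 + (n : ℕ) * (2 * Real.pi) by
      field_simp]
    exact (hgp.nat_mul n y.1).symm
  · simp only [dil]
    have hsub := intervalIntegral.integral_comp_mul_left (a := 0) (b := y.2)
      (fun τ => 1 * (ε⁻¹ • G (dil ε⁻¹ 0 (graphMap (wall f ε) 1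
        (ε * y.1 + 2 * Real.pi * ε * (n : ℕ), τ)))).2) hε.ne'
    rw [mul_zero, smul_eq_mul, eq_inv_mul_iff_mul_eq₀ hε.ne'] at hsub
    simp only [dil] at hsub
    rw [← hsub, ← intervalIntegral.integral_const_mul]
    refine intervalIntegral.integral_congr_ae ?_
    rw [uIoc_of_le h4.2.1.le]
    rw [ae_restrict_iff' measurableSet_Ioo] at h3
    filter_upwards [h3] with τ hτ hτ'
    have e := graphMap_wall_dil hf hε n (y.1, τ)
    simp only [dil] at e
    rw [e]
    have e2 := dil_inv_dil hε n (graphMap f 1 (y.1, τ))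
    simp only [dil] at e2
    rw [e2, hτ ⟨hτ'.1, hτ'.2.trans_lt h4.2.2⟩]
    simp only [Prod.smul_snd, smul_eq_mul]
    field_simp

/-! ### Folding -/

lemma dil_preimage_cellDomain_wall (hf : IsRoughProfile f) (hε : 0 < ε) (n : ℕ) :
    dil ε (2 * Real.pi * ε * n) ⁻¹' cellDomain (wall f ε) = cellDomain f := by
  rw [cellDomain_wall hε]
  ext y
  simp only [mem_preimage, dil_inv_dil hε]
  exact hf.isCellPeriodic.nat n y

lemma HasTrace.comp_dil_cell (hf : IsRoughProfile f) (hε : 0 < ε) (hL : L = 2 * Real.pi * ε * N)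
    (hv : MemD12 (cellDomain (wall f ε)) L v H) (ht : HasTrace L 1 (wall f ε) v 0) (n : Fin N)
    (hH : MemLp (fun y => ε • H (dil ε (2 * Real.pi * ε * (n : ℕ)) y)) 2
      (volume.restrict (periodCell (cellDomain f) (2 * Real.pi)))) :
    HasTrace (2 * Real.pi) 1 f (fun y => v (dil ε (2 * Real.pi * ε * (n : ℕ)) y)) 0 := by
  have hl : IsLayer (cellDomain (wall f ε)) L ε 1 (wall f ε) :=
    isLayer_graph (hf.continuous_wall ε) (hf.wall_neg hε) hε
  have hl1 : IsLayer (cellDomain f) (2 * Real.pi) 1 1 f :=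
    isLayer_graph hf.continuous hf.lt_zero one_pos
  refine LineRep.hasTrace hl1 hH MemLp.zero ?_
  have hrep := ht.lineRep hl hv.isWeakGradient hv.memLp_grad
  unfold LineRep at hrep ⊢
  rw [ae_layer_dil_iff hε hL] at hrep
  filter_upwards [hrep n] with y hy
  rw [graphMap_wall_dil hf hε] at hy
  rw [hy]
  congr 1
  simp only [dil]
  have hsub := intervalIntegral.integral_comp_mul_left (a := 0) (b := y.2)
    (fun τ => 1 * (H (graphMap (wall f ε) 1
      (ε * y.1 + 2 * Real.pi * ε * (n : ℕ), τ))).2) hε.ne'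
  rw [mul_zero, smul_eq_mul, eq_inv_mul_iff_mul_eq₀ hε.ne'] at hsub
  rw [← hsub, ← intervalIntegral.integral_const_mul]
  congr 1
  ext τ
  have e := graphMap_wall_dil hf hε n (y.1, τ)
  simp only [dil] at e
  rw [e]
  simp only [Prod.smul_snd, smul_eq_mul]
  ring

/-- The scaled cell solutions are weakly harmonic at the macroscopic scale. -/
lemma CellEq.dirichletForm_comp_dil (hf : IsRoughProfile f) (hε : 0 < ε)
    (hL : L = 2 * Real.pi * ε * N) (heq : CellEq f G)
    (hu : MemD12 (cellDomain f) (2 * Real.pi) u G)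
    (hv : MemD12 (cellDomain (wall f ε)) L v H) (ht : HasTrace L 1 (wall f ε) v 0) :
    dirichletForm (periodCell (cellDomain (wall f ε)) L) (fun x => ε⁻¹ • G (dil ε⁻¹ 0 x)) H = 0 := by
  have hDm := hf.isOpen.measurableSet
  have hwo : IsOpen (cellDomain (wall f ε)) := isOpen_cellDomain (hf.continuous_wall ε)
  -- The test function is folded: `V n` is its restriction to the `n`-th column pulled back to the
  -- cell, and the sum over `n` is `2π`-periodic although the single terms are not.
  let V : Fin N → ℝ × ℝ → ℝ := fun n y => v (dil ε (2 * Real.pi * ε * (n : ℕ)) y)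
  let K : Fin N → ℝ × ℝ → ℝ × ℝ := fun n y => ε • H (dil ε (2 * Real.pi * ε * (n : ℕ)) y)
  have hK : ∀ n, MemLp (K n) 2 (volume.restrict (periodCell (cellDomain f) (2 * Real.pi))) := by
    intro n
    have h1 := hv.memLp_grad
    rw [cellDomain_wall hε] at h1
    exact (memLp_comp_dil_cell hε hL hDm hf.isCellPeriodic h1 n).const_smul ε
  have hV : ∀ n, IsWeakGradient (cellDomain f) (V n) (K n) := by
    intro n
    have := hv.isWeakGradient.comp_dil hε (2 * Real.pi * ε * (n : ℕ)) hwo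
    rwa [dil_preimage_cellDomain_wall hf hε] at this
  have hT : ∀ n, HasTrace (2 * Real.pi) 1 f (V n) 0 := fun n =>
    ht.comp_dil_cell hf hε hL hv n (hK n)
  have hl1 : IsLayer (cellDomain f) (2 * Real.pi) 1 1 f :=
    isLayer_graph hf.continuous hf.lt_zero one_pos
  have hsum : ∀ S : Finset (Fin N), IsWeakGradient (cellDomain f) (fun y => ∑ n ∈ S, V n y)
      (fun y => ∑ n ∈ S, K n y) ∧
      MemLp (fun y => ∑ n ∈ S, K n y) 2
        (volume.restrict (periodCell (cellDomain f) (2 * Real.pi))) ∧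
      HasTrace (2 * Real.pi) 1 f (fun y => ∑ n ∈ S, V n y) 0 := by
    intro S
    induction S using Finset.induction_on with
    | empty =>
      have h0 := isWeakGradient_comp_snd (D := cellDomain f) (P := fun _ => 0) contDiff_const
      refine ⟨?_, ?_, hasTrace_zero_of_layer_eq_zero one_pos fun _ _ _ _ => by simp⟩
      · simp only [Finset.sum_empty]
        convert h0 using 1
        ext x <;> simp
      · simp
    | insert a S ha ih =>
      obtain ⟨i1, i2, i3⟩ := ih
      simp only [Finset.sum_insert ha]
      refine ⟨(hV a).add i1, (hK a).add i2, ?_⟩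
      have := (hT a).add hl1 (hV a) (hK a) i1 i2 i3
      convert this using 1
      ext s; simp
  obtain ⟨hV1, hV2, hV3⟩ := hsum Finset.univ
  have hshift : ∀ {E : Type} [AddCommGroup E] (W : ℝ × ℝ → E),
      IsPeriodicOn (cellDomain (wall f ε)) L W →
      IsPeriodicOn (cellDomain f) (2 * Real.pi)
        (fun y => ∑ n : Fin N, W (dil ε (2 * Real.pi * ε * (n : ℕ)) y)) := by
    intro E _ W hW
    unfold IsPeriodicOn at hW ⊢
    rw [ae_restrict_iff' hwo.measurableSet] at hW
    have h1 := ae_comp_dil hε 0 hW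
    filter_upwards [ae_restrict_of_ae h1, ae_restrict_mem hDm] with y hy hyD
    have hy0 : dil ε 0 y ∈ cellDomain (wall f ε) := by
      have := dil_preimage_cellDomain_wall hf hε 0
      rw [← this] at hyD
      simpa using hyD
    have hy1 := hy hy0
    let F : ℕ → E := fun n => W (dil ε (2 * Real.pi * ε * n) y)
    have hF : ∀ n : ℕ, W (dil ε (2 * Real.pi * ε * n) (y.1 + 2 * Real.pi, y.2)) = F (n + 1) := by
      intro n
      simp only [F, dil]
      push_cast
      ring_nf
    -- A shift by one cell permutes the summands cyclically; the last becomes the first by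
    -- `L`-periodicity.
    have hFN : F N = F 0 := by
      simp only [F]
      have e : dil ε (2 * Real.pi * ε * N) y = ((dil ε 0 y).1 + L, (dil ε 0 y).2) := by
        rw [hL]; simp [dil]
      rw [e, hy1]
      simp
    simp only [hF]
    rw [Fin.sum_univ_eq_sum_range (fun n => F (n + 1)) N,
      Fin.sum_univ_eq_sum_range (fun n => W (dil ε (2 * Real.pi * ε * n) y)) N]
    change _ = ∑ n ∈ Finset.range N, F n
    have h2 := Finset.sum_range_succ F N
    rw [Finset.sum_range_succ', hFN] at h2
    exact add_right_cancel h2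
  have hmem : MemD12 (cellDomain f) (2 * Real.pi) (fun y => ∑ n, V n y) (fun y => ∑ n, K n y) := by
    refine ⟨hV1, hshift v hv.periodic, ?_, hV2⟩
    have := hshift H hv.periodic_grad
    unfold IsPeriodicOn at this ⊢
    filter_upwards [this] with y hy
    simp only [K, ← Finset.smul_sum]
    rw [hy]
  have h0 := heq _ _ hmem hV3
  have hs := hu.comp_dil hε hL hf.isOpen hf.isCellPeriodic
  have hvm := hv.memLp_grad
  rw [cellDomain_wall hε] at hvm ⊢
  have hi : Integrable (fun x => (ε⁻¹ • G (dil ε⁻¹ 0 x)).1 * (H x).1 +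
      (ε⁻¹ • G (dil ε⁻¹ 0 x)).2 * (H x).2)
      (volume.restrict (periodCell (dil ε⁻¹ 0 ⁻¹' cellDomain f) L)) :=
    (hs.memLp_grad.fst.integrable_mul hvm.fst).add (hs.memLp_grad.snd.integrable_mul hvm.snd)
  unfold dirichletForm at h0 ⊢
  -- As `G` is `2π`-periodic, the large-scale form splits into cell forms with the same `G`, and
  -- their sum is the cell form tested with the folded function.
  rw [integral_periodCell_dil hε hL hDm hf.isCellPeriodic hi]
  refine Eq.trans ?_ h0
  have hiK : ∀ n, Integrable (fun y => (G y).1 * (K n y).1 + (G y).2 * (K n y).2)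
      (volume.restrict (periodCell (cellDomain f) (2 * Real.pi))) := fun n =>
    (hu.memLp_grad.fst.integrable_mul (hK n).fst).add (hu.memLp_grad.snd.integrable_mul (hK n).snd)
  have e1 : ∀ y, (G y).1 * (∑ n, K n y).1 + (G y).2 * (∑ n, K n y).2 =
      ∑ n, ((G y).1 * (K n y).1 + (G y).2 * (K n y).2) := fun y => by
    rw [Prod.fst_sum, Prod.snd_sum, Finset.mul_sum, Finset.mul_sum, Finset.sum_add_distrib]
  simp_rw [e1]
  rw [integral_finsetSum _ fun n _ => hiK n]
  refine Finset.sum_congr rfl fun n _ => ?_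
  rw [← integral_const_mul]
  refine integral_congr_ae ?_
  filter_upwards [hu.periodic_grad.periodCell_nat hDm hf.isCellPeriodic n] with y hy
  rw [dil_inv_dil hε, hy]
  simp only [K, Prod.smul_fst, Prod.smul_snd, smul_eq_mul]
  field_simp

end WallLaw

namespace WallLaw

variable {D : Set (ℝ × ℝ)} {u v w β b : ℝ × ℝ → ℝ} {G H g : ℝ × ℝ → ℝ × ℝ} {f b₀ : ℝ → ℝ}
  {L ε : ℝ} {N : ℕ}

/-! ### Correctors -/

/-- A boundary layer corrector: a periodic function with prescribed values on the rough wall, weakly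
harmonic above it, and of size `O(ε)` in the square mean. -/
structure IsCorrector (f : ℝ → ℝ) (L ε K : ℝ) (b₀ : ℝ → ℝ) (b : ℝ × ℝ → ℝ)
    (g : ℝ × ℝ → ℝ × ℝ) : Prop where
  memD12 : MemD12 (cellDomain (wall f ε)) L b g
  trace : HasTrace L 1 (wall f ε) b b₀
  harmonic : ∀ v H, MemD12 (cellDomain (wall f ε)) L v H → HasTrace L 1 (wall f ε) v 0 →
    dirichletForm (periodCell (cellDomain (wall f ε)) L) g H = 0
  memLp : MemLp b 2 (volume.restrict (periodCell smoothDomain L))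
  sq_le : ∫ x in periodCell smoothDomain L, b x ^ 2 ≤ K * ε
  grad_sq_le : ∫ x in Ioo 0 L ×ˢ Ioi (1 / 2 : ℝ), ((g x).1 ^ 2 + (g x).2 ^ 2) ≤ K * ε

lemma MemD12.sub_const {P : ℝ} (hu : MemD12 D P u G) (m : ℝ) : MemD12 D P (fun x => u x - m) G := by
  refine ⟨?_, ?_, hu.periodic_grad, hu.memLp_grad⟩
  · have h1 := hu.isWeakGradient.add
      (isWeakGradient_comp_snd (D := D) (P := fun _ => -m) contDiff_const)
    have e : (fun x => G x + ((0 : ℝ), deriv (fun _ : ℝ => -m) x.2)) = G := by ext x <;> simp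
    rw [e] at h1
    exact h1
  · filter_upwards [hu.periodic] with x hx
    rw [hx]

lemma HasTrace.sub_const {σ : ℝ} {h g₀ : ℝ → ℝ} (ht : HasTrace L σ h u g₀) (a : ℝ) :
    HasTrace L σ h (fun x => u x - a) (fun s => g₀ s - a) := by
  refine ⟨ht.memLp.sub (memLp_const a), ?_⟩
  simpa only [sub_sub_sub_cancel_right] using ht.tendsto

lemma isCellPeriodic_Ioi (t : ℝ) : IsCellPeriodic {y | t < y.2} := fun _ => Iff.rfl

lemma measurableSet_lt_snd (t : ℝ) : MeasurableSet {y : ℝ × ℝ | t < y.2} :=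
  measurableSet_lt measurable_const measurable_snd

lemma periodCell_Ioi (P t : ℝ) : periodCell {y | t < y.2} P = Ioo 0 P ×ˢ Ioi t := by
  ext x; exact and_comm

/-- The scaled cell solutions, less their interface means, are correctors. -/
theorem exists_isCorrector (hf : IsRoughProfile f) (hL0 : 0 < L) (hb₀ : Continuous b₀) {m : ℝ}
    (hβ : IsCellSolution f b₀ β) (hm : IsInterfaceMean β m) :
    ∃ K, 0 ≤ K ∧ ∀ (ε : ℝ) (N : ℕ), 0 < ε → L = 2 * Real.pi * ε * N →
      ∃ b g, IsCorrector f L ε K (fun s => b₀ (f (s / ε)) - m) b g := by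
  obtain ⟨G, hmem, htr, heq⟩ := hβ
  have hpi := Real.pi_pos
  have hβm := cell_sub_mean_memLp hf hmem heq hm
  obtain ⟨K₁, hK₁, hdec⟩ := cell_energy_decay hf hmem heq hβm
  set J := ∫ x in upperCell, (β x - m) ^ 2
  have hJ : 0 ≤ J := integral_nonneg fun x => sq_nonneg _
  refine ⟨L / (2 * Real.pi) * (J + K₁), by positivity, fun ε N hε hL =>
    ⟨fun x => β (dil ε⁻¹ 0 x) - m, fun x => ε⁻¹ • G (dil ε⁻¹ 0 x), ?_⟩⟩
  -- This count of cells turns the constant of one cell into the factor `L / (2π) ε`.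
  have hLN : L / (2 * Real.pi) * ε = N * ε ^ 2 := by
    rw [hL]; field_simp
  have hmem' := hmem.sub_const m
  have hs := hmem'.comp_dil hε hL hf.isOpen hf.isCellPeriodic
  rw [← cellDomain_wall hε] at hs
  have hc : Continuous fun s => b₀ (f s) - m := (hb₀.comp hf.continuous).sub continuous_const
  have hcell : ∀ t : ℝ, 0 ≤ t → {y : ℝ × ℝ | t < y.2} ⊆ cellDomain f := fun t ht y hy =>
    (hf.lt_zero y.1).trans_le (ht.trans (le_of_lt hy))
  have hper : ∀ (t : ℝ) (W : ℝ × ℝ → ℝ), 0 ≤ t → IsPeriodicOn (cellDomain f) (2 * Real.pi) W →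
      IsPeriodicOn {y : ℝ × ℝ | t < y.2} (2 * Real.pi) W := fun t W ht hW =>
    ae_restrict_of_ae_restrict_of_subset (hcell t ht) hW
  have hsub : periodCell smoothDomain L ⊆ periodCell (dil ε⁻¹ 0 ⁻¹' {y | 0 < y.2}) L := by
    rintro x ⟨h1, h2⟩
    refine ⟨?_, h2⟩
    change 0 < ε⁻¹ * x.2
    have : 0 < x.2 := h1.1
    positivity
  have h1 := integral_comp_dil_inv hε hL (measurableSet_lt_snd 0) (isCellPeriodic_Ioi 0)
    (w := fun y => (β y - m) ^ 2)
    (hper 0 _ le_rfl (by filter_upwards [hmem.periodic] with x hx; rw [hx]))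
    (by rw [periodCell_Ioi]; exact hβm.integrable_sq)
  rw [periodCell_Ioi (2 * Real.pi)] at h1
  have hsub' : periodCell smoothDomain L ⊆ periodCell (cellDomain (wall f ε)) L := fun x hx =>
    ⟨(hf.wall_neg hε x.1).trans hx.1.1, hx.2⟩
  have hbm : AEStronglyMeasurable (fun x => β (dil ε⁻¹ 0 x) - m)
      (volume.restrict (periodCell smoothDomain L)) :=
    hs.aestronglyMeasurable.mono_measure (Measure.restrict_mono hsub' le_rfl)
  refine ⟨hs, ?_, ?_, ?_, ?_, ?_⟩
  · exact (htr.sub_const m).comp_dil hf hε hL hmem' hc fun s => by simp only [hf.periodic s]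
  · exact fun v H hv ht => CellEq.dirichletForm_comp_dil hf hε hL heq hmem hv ht
  · rw [memLp_two_iff_integrable_sq hbm]
    exact IntegrableOn.mono_set h1.1 hsub
  · calc ∫ x in periodCell smoothDomain L, (β (dil ε⁻¹ 0 x) - m) ^ 2
        ≤ ∫ x in periodCell (dil ε⁻¹ 0 ⁻¹' {y | 0 < y.2}) L, (β (dil ε⁻¹ 0 x) - m) ^ 2 :=
          setIntegral_mono_set h1.1 (ae_of_all _ fun x => sq_nonneg _) hsub.eventuallyLE
      _ = N * ε ^ 2 * J := h1.2
      _ ≤ L / (2 * Real.pi) * (J + K₁) * ε := by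
          rw [← hLN]
          have : 0 ≤ L / (2 * Real.pi) * ε := by positivity
          nlinarith
  · have ht0 : (0 : ℝ) ≤ 1 / (2 * ε) := by positivity
    have hG2 : Integrable (fun y => (G y).1 ^ 2 + (G y).2 ^ 2)
        (volume.restrict (Ioo 0 (2 * Real.pi) ×ˢ Ioi (1 / (2 * ε)))) := by
      have hA : Integrable (fun y => (G y).1 ^ 2 + (G y).2 ^ 2)
          (volume.restrict (periodCell (cellDomain f) (2 * Real.pi))) :=
        hmem.memLp_grad.fst.integrable_sq.add hmem.memLp_grad.snd.integrable_sq
      exact IntegrableOn.mono_set hA fun x hx => ⟨hcell _ ht0 hx.2, hx.1⟩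
    have h2 := integral_comp_dil_inv hε hL (measurableSet_lt_snd (1 / (2 * ε)))
      (isCellPeriodic_Ioi _) (w := fun y => (G y).1 ^ 2 + (G y).2 ^ 2)
      (hper _ _ ht0 (by filter_upwards [hmem.periodic_grad] with x hx; rw [hx]))
      (by rw [periodCell_Ioi]; exact hG2)
    rw [periodCell_Ioi (2 * Real.pi)] at h2
    have hset : Ioo 0 L ×ˢ Ioi (1 / 2 : ℝ) =
        periodCell (dil ε⁻¹ 0 ⁻¹' {y : ℝ × ℝ | 1 / (2 * ε) < y.2}) L := by
      rw [← periodCell_Ioi]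
      congr 1
      ext x
      simp only [mem_preimage, mem_ofPred_eq, dil]
      rw [show ε⁻¹ * x.2 = x.2 / ε by ring, div_lt_div_iff₀ (by positivity) hε,
        div_lt_iff₀ (by norm_num)]
      constructor <;> intro h <;> nlinarith
    -- Height `1/2` is height `1/(2ε)` in cell variables. There the decay factor `ε²` offsets the
    -- `ε⁻²` from scaling the gradient, which leaves the `O(ε)` of the cell count.
    calc ∫ x in Ioo 0 L ×ˢ Ioi (1 / 2 : ℝ), ((ε⁻¹ • G (dil ε⁻¹ 0 x)).1 ^ 2 +
          (ε⁻¹ • G (dil ε⁻¹ 0 x)).2 ^ 2)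
        = ε⁻¹ ^ 2 * ∫ x in Ioo 0 L ×ˢ Ioi (1 / 2 : ℝ), ((G (dil ε⁻¹ 0 x)).1 ^ 2 +
          (G (dil ε⁻¹ 0 x)).2 ^ 2) := by
          rw [← integral_const_mul]
          congr 1; ext x
          simp only [Prod.smul_fst, Prod.smul_snd, smul_eq_mul]
          ring
      _ = ε⁻¹ ^ 2 * (N * ε ^ 2 * ∫ y in Ioo 0 (2 * Real.pi) ×ˢ Ioi (1 / (2 * ε)),
          ((G y).1 ^ 2 + (G y).2 ^ 2)) := by rw [hset, h2.2]
      _ ≤ ε⁻¹ ^ 2 * (N * ε ^ 2 * (K₁ * ε ^ 2)) := by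
          gcongr
          exact hdec ε hε
      _ = L / (2 * Real.pi) * ε * K₁ := by rw [hLN]; field_simp
      _ ≤ L / (2 * Real.pi) * (J + K₁) * ε := by
          have : 0 ≤ L / (2 * Real.pi) * ε := by positivity
          nlinarith

end WallLaw

namespace WallLaw

variable {D : Set (ℝ × ℝ)} {u v w b r : ℝ × ℝ → ℝ} {G H R g : ℝ × ℝ → ℝ × ℝ} {f b₀ k l χ : ℝ → ℝ}
  {L ε : ℝ} {N : ℕ}

/-! ### Functions on the rough strip that vanish at the top -/

lemma roughDomain_eq (f : ℝ → ℝ) (ε : ℝ) : roughDomain f ε = stripDomain (wall f ε) := rfl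

/-- Periodic functions on the rough strip with square integrable gradient `G`, with trace `k` on the
wall and zero trace at the top. -/
structure MemStrip (f : ℝ → ℝ) (L ε : ℝ) (u : ℝ × ℝ → ℝ) (G : ℝ × ℝ → ℝ × ℝ) (k : ℝ → ℝ) :
    Prop where
  memD12 : MemD12 (roughDomain f ε) L u G
  trace_wall : HasTrace L 1 (wall f ε) u k
  trace_top : HasTrace L (-1) (fun _ => 1) u 0

lemma MemStrip.add (hf : IsRoughProfile f) (hε : 0 < ε) (hu : MemStrip f L ε u G k)
    (hv : MemStrip f L ε v H l) :
    MemStrip f L ε (fun x => u x + v x) (fun x => G x + H x) (fun s => k s + l s) := by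
  have hw := hf.continuous_wall ε
  have hw0 : ∀ s, wall f ε s ≤ 0 := fun s => (hf.wall_neg hε s).le
  refine ⟨⟨hu.memD12.isWeakGradient.add hv.memD12.isWeakGradient, ?_, ?_,
    hu.memD12.memLp_grad.add hv.memD12.memLp_grad⟩, ?_, ?_⟩
  · filter_upwards [hu.memD12.periodic, hv.memD12.periodic] with x h1 h2
    rw [h1, h2]
  · filter_upwards [hu.memD12.periodic_grad, hv.memD12.periodic_grad] with x h1 h2
    rw [h1, h2]
  · exact hu.trace_wall.add (isLayer_strip_bot hw hw0) hu.memD12.isWeakGradient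
      hu.memD12.memLp_grad hv.memD12.isWeakGradient hv.memD12.memLp_grad hv.trace_wall
  · have := hu.trace_top.add (isLayer_strip_top hw hw0) hu.memD12.isWeakGradient
      hu.memD12.memLp_grad hv.memD12.isWeakGradient hv.memD12.memLp_grad hv.trace_top
    convert this using 1
    ext s; simp

lemma MemStrip.const_mul (c : ℝ) (hu : MemStrip f L ε u G k) :
    MemStrip f L ε (fun x => c * u x) (fun x => c • G x) (fun s => c * k s) := by
  refine ⟨⟨hu.memD12.isWeakGradient.const_mul c, ?_, ?_, hu.memD12.memLp_grad.const_smul c⟩,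
    hu.trace_wall.const_mul c, ?_⟩
  · filter_upwards [hu.memD12.periodic] with x h1
    rw [h1]
  · filter_upwards [hu.memD12.periodic_grad] with x h1
    rw [h1]
  · have := hu.trace_top.const_mul c
    convert this using 1
    ext s; simp

lemma MemStrip.memRough (hf : IsRoughProfile f) (hε : 0 < ε) (hu : MemStrip f L ε u G k)
    (hk : ∀ s, k s = 0) : MemRough f L ε u G := by
  have e : k = 0 := funext hk
  refine ⟨⟨hu.memD12, ?_⟩, e ▸ hu.trace_wall, hu.trace_top⟩
  exact strip_memLp hε.le (hf.continuous_wall ε) (fun s => (hf.wall_neg hε s).le) (hf.le_wall hε)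
    hu.memD12.isWeakGradient hu.memD12.memLp_grad hu.trace_top

lemma MemRough.memStrip (hu : MemRough f L ε u G) : MemStrip f L ε u G 0 :=
  ⟨hu.memH1.toMemD12, hu.trace_wall, hu.trace_top⟩

lemma memStrip_profile (hf : IsRoughProfile f) (hε : 0 < ε) (L C a : ℝ) :
    MemStrip f L ε (fun x => profile C a x.2) (fun x => (0, deriv (profile C a) x.2))
      (fun s => profile C a (wall f ε s)) := by
  have hPd : Continuous (deriv (profile C a)) := (contDiff_profile C a).continuous_deriv (by simp)
  refine ⟨⟨isWeakGradient_comp_snd (contDiff_profile C a), ?_, ?_, ?_⟩, ?_, ?_⟩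
  · exact ae_of_all _ fun x => rfl
  · exact ae_of_all _ fun x => rfl
  · exact memLp_prodMk (MemLp.zero (ε := ℝ))
      (memLp_comp_snd hPd (hf.le_wall hε) (hf.continuous_wall ε))
  · exact hasTrace_comp_snd (contDiff_profile C a) (hf.continuous_wall ε) L 1
  · have := hasTrace_comp_snd (contDiff_profile C a) (continuous_const (y := 1)) L (-1)
    convert this using 1
    ext s; simp [profile]

/-! ### Cutting off at the top -/

/-- A smooth cutoff function, equal to `1` below the height `1/2` and to `0` above `3/4`. -/
structure IsTopCutoff (M : ℝ) (χ : ℝ → ℝ) : Prop where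
  contDiff : ContDiff ℝ ∞ χ
  nonneg : ∀ t, 0 ≤ χ t
  le_one : ∀ t, χ t ≤ 1
  eq_one : ∀ t, t ≤ 1 / 2 → χ t = 1
  eq_zero : ∀ t, 3 / 4 ≤ t → χ t = 0
  deriv_eq_zero : ∀ t, t ≤ 1 / 2 → deriv χ t = 0
  deriv_eq_zero' : ∀ t, 3 / 4 < t → deriv χ t = 0
  abs_deriv_le : ∀ t, |deriv χ t| ≤ M

lemma exists_isTopCutoff : ∃ M χ, 0 ≤ M ∧ IsTopCutoff M χ := by
  obtain ⟨M, hM0, hM⟩ := exists_deriv_smoothTransition_le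
  have hd : ∀ t, HasDerivAt (fun t : ℝ => 1 - Real.smoothTransition (8 * t + -5))
      (-(deriv Real.smoothTransition (8 * t + -5) * 8)) t := fun t =>
    (hasDerivAt_smoothTransition_comp 8 (-5) t).const_sub 1
  refine ⟨8 * M, fun t => 1 - Real.smoothTransition (8 * t + -5), by positivity, ?_, ?_, ?_, ?_, ?_,
    ?_, ?_, ?_⟩
  · exact contDiff_const.sub (Real.smoothTransition.contDiff.comp (by fun_prop))
  · exact fun t => sub_nonneg.2 (Real.smoothTransition.le_one _)
  · exact fun t => sub_le_self _ (Real.smoothTransition.nonneg _)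
  · intro t ht
    simp [Real.smoothTransition.zero_of_nonpos (by linarith : 8 * t + -5 ≤ 0)]
  · intro t ht
    simp [Real.smoothTransition.one_of_one_le (by linarith : 1 ≤ 8 * t + -5)]
  · intro t ht
    have : (fun t : ℝ => 1 - Real.smoothTransition (8 * t + -5)) =ᶠ[𝓝 t] fun _ => 1 := by
      filter_upwards [Iio_mem_nhds (by linarith : t < 5 / 8)] with y hy
      have hy' : y < 5 / 8 := hy
      simp [Real.smoothTransition.zero_of_nonpos (by linarith : 8 * y + -5 ≤ 0)]
    rw [this.deriv_eq]; simp
  · intro t ht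
    have : (fun t : ℝ => 1 - Real.smoothTransition (8 * t + -5)) =ᶠ[𝓝 t] fun _ => 0 := by
      filter_upwards [Ioi_mem_nhds ht] with y hy
      have hy' : 3 / 4 < y := hy
      simp [Real.smoothTransition.one_of_one_le (by linarith : 1 ≤ 8 * y + -5)]
    rw [this.deriv_eq]; simp
  · intro t
    rw [(hd t).deriv, abs_neg, abs_mul, abs_of_pos (by norm_num : (0 : ℝ) < 8)]
    linarith [hM (8 * t + -5)]

lemma IsTopCutoff.continuous_deriv {M : ℝ} (hχ : IsTopCutoff M χ) : Continuous (deriv χ) :=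
  hχ.contDiff.continuous_deriv (by simp)

lemma IsTopCutoff.le_of_mem_tsupport {M t : ℝ} (hχ : IsTopCutoff M χ) (ht : t ∈ tsupport χ) :
    t ≤ 3 / 4 := by
  have : tsupport χ ⊆ Iic (3 / 4) := closure_minimal (fun s hs => by
    by_contra hcon
    exact hs (hχ.eq_zero s (not_le.1 hcon).le)) isClosed_Iic
  exact this ht

lemma HasTrace.congr_layer {σ d₀ : ℝ} {h : ℝ → ℝ} (hd₀ : 0 < d₀) (ht : HasTrace L σ h u k)
    (huv : ∀ s, ∀ t ∈ Ioo 0 d₀, v (s, h s + σ * t) = u (s, h s + σ * t)) :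
    HasTrace L σ h v k := by
  refine ⟨ht.memLp, ht.tendsto.congr' ?_⟩
  filter_upwards [Ioo_mem_nhdsGT hd₀] with d hd
  congr 1
  refine setLIntegral_congr_fun measurableSet_Ioo fun t ht' => ?_
  simp_rw [huv _ t ⟨ht'.1, ht'.2.trans hd.2⟩]

lemma IsTopCutoff.memLp_smul {M : ℝ} (hχ : IsTopCutoff M χ) {μ : Measure (ℝ × ℝ)}
    (hG : MemLp G 2 μ) : MemLp (fun x => χ x.2 • G x) 2 μ := by
  refine hG.of_le ((hχ.contDiff.continuous.comp continuous_snd).aestronglyMeasurable.smul hG.1)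
    (ae_of_all _ fun x => ?_)
  rw [norm_smul, Real.norm_eq_abs, abs_of_nonneg (hχ.nonneg _)]
  exact mul_le_of_le_one_left (norm_nonneg _) (hχ.le_one _)

lemma IsTopCutoff.memLp_deriv_mul {M : ℝ} (hM : 0 ≤ M) (hχ : IsTopCutoff M χ)
    {μ : Measure (ℝ × ℝ)} (hw : MemLp w 2 μ) : MemLp (fun x => deriv χ x.2 * w x) 2 μ := by
  refine (hw.const_mul M).of_le
    ((hχ.continuous_deriv.comp continuous_snd).aestronglyMeasurable.mul hw.1)
    (ae_of_all _ fun x => ?_)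
  rw [norm_mul, norm_mul, Real.norm_eq_abs, Real.norm_eq_abs M, abs_of_nonneg hM]
  exact mul_le_mul_of_nonneg_right (hχ.abs_deriv_le _) (norm_nonneg _)

lemma measurableSet_roughCell (hf : IsRoughProfile f) (ε L : ℝ) :
    MeasurableSet (periodCell (roughDomain f ε) L) :=
  measurableSet_periodCell (isOpen_stripDomain (hf.continuous_wall ε)) L

lemma measurableSet_smoothCell (L : ℝ) : MeasurableSet (periodCell smoothDomain L) :=
  measurableSet_periodCell (isOpen_stripDomain continuous_const) L

lemma roughCell_subset : periodCell (roughDomain f ε) L ⊆ periodCell (cellDomain (wall f ε)) L :=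
  fun _ hx => ⟨hx.1.1, hx.2⟩

lemma smoothCell_subset (hf : IsRoughProfile f) (hε : 0 < ε) :
    periodCell smoothDomain L ⊆ periodCell (roughDomain f ε) L :=
  fun x hx => ⟨⟨(hf.wall_neg hε x.1).trans hx.1.1, hx.1.2⟩, hx.2⟩

/-- The derivative of the cutoff vanishes up to height `1/2`, so the square integrability of `b`
above height `0`, which is all a corrector provides, is enough. -/
lemma IsCorrector.memLp_grad_cutoff {K M : ℝ} (hf : IsRoughProfile f) (hM : 0 ≤ M)
    (hb : IsCorrector f L ε K b₀ b g) (hχ : IsTopCutoff M χ) :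
    MemLp (fun x => χ x.2 • g x + (0, deriv χ x.2 * b x)) 2
      (volume.restrict (periodCell (roughDomain f ε) L)) := by
  refine (hχ.memLp_smul (hb.memD12.memLp_grad.mono_measure
    (Measure.restrict_mono roughCell_subset le_rfl))).add
    (memLp_prodMk (MemLp.zero (ε := ℝ)) ?_)
  refine memLp_restrict_of_eq_zero (measurableSet_smoothCell L)
    (hχ.memLp_deriv_mul hM hb.memLp) (measurableSet_roughCell hf ε L) fun x hx hxs => ?_
  rw [hχ.deriv_eq_zero, zero_mul]
  by_contra hcon
  exact hxs ⟨⟨by linarith, hx.1.2⟩, hx.2⟩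

lemma IsCorrector.memStrip {K M : ℝ} (hf : IsRoughProfile f) (hε : 0 < ε) (hM : 0 ≤ M)
    (hb : IsCorrector f L ε K b₀ b g) (hχ : IsTopCutoff M χ) :
    MemStrip f L ε (fun x => χ x.2 * b x) (fun x => χ x.2 • g x + (0, deriv χ x.2 * b x)) b₀ := by
  have hsub : roughDomain f ε ⊆ cellDomain (wall f ε) := fun x hx => hx.1
  refine ⟨⟨?_, ?_, ?_, hb.memLp_grad_cutoff hf hM hχ⟩, ?_, ?_⟩
  · exact hb.memD12.isWeakGradient.cutoff_mul hχ.contDiff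
      (isOpen_cellDomain (hf.continuous_wall ε)) fun x hx _ => hsub hx
  · filter_upwards [ae_restrict_of_ae_restrict_of_subset hsub hb.memD12.periodic] with x hx
    simp only [hx]
  · filter_upwards [ae_restrict_of_ae_restrict_of_subset hsub hb.memD12.periodic,
      ae_restrict_of_ae_restrict_of_subset hsub hb.memD12.periodic_grad] with x hx hx'
    simp only [hx, hx']
  · refine hb.trace.congr_layer (d₀ := 1 / 2) (by norm_num) fun s t ht => ?_
    simp only
    rw [hχ.eq_one _ (by linarith [hf.wall_neg hε s, ht.2]), one_mul]
  · refine hasTrace_zero_of_layer_eq_zero (d₀ := 1 / 4) (by norm_num) fun s _ t ht => ?_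
    simp only
    rw [hχ.eq_zero _ (by linarith [ht.2]), zero_mul]

/-- Cutting off extends a function on the rough strip to the region above the wall. -/
lemma MemRough.cutoff {M : ℝ} (hf : IsRoughProfile f) (hε : 0 < ε) (hM : 0 ≤ M)
    (hr : MemRough f L ε r R) (hχ : IsTopCutoff M χ) :
    MemD12 (cellDomain (wall f ε)) L (fun x => χ x.2 * r x)
        (fun x => χ x.2 • R x + (0, deriv χ x.2 * r x)) ∧
      HasTrace L 1 (wall f ε) (fun x => χ x.2 * r x) 0 := by
  have hwo : IsOpen (cellDomain (wall f ε)) := isOpen_cellDomain (hf.continuous_wall ε)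
  have hro : IsOpen (roughDomain f ε) := isOpen_stripDomain (hf.continuous_wall ε)
  have hper : ∀ {E : Type} (W : ℝ × ℝ → E), IsPeriodicOn (roughDomain f ε) L W →
      ∀ᵐ x ∂volume.restrict (cellDomain (wall f ε)), x.2 < 1 → W (x.1 + L, x.2) = W x := by
    intro E W hW
    unfold IsPeriodicOn at hW
    rw [ae_restrict_iff' hro.measurableSet] at hW
    filter_upwards [ae_restrict_of_ae hW, ae_restrict_mem hwo.measurableSet] with x hx hx' hx1
    exact hx ⟨hx', hx1⟩
  have hzero : ∀ t, 1 ≤ t → χ t = 0 ∧ deriv χ t = 0 := fun t ht =>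
    ⟨hχ.eq_zero t (by linarith), hχ.deriv_eq_zero' t (by linarith)⟩
  refine ⟨⟨?_, ?_, ?_, ?_⟩, ?_⟩
  · exact hr.memH1.isWeakGradient.cutoff_mul hχ.contDiff hro fun x hx hx' =>
      ⟨hx, by linarith [hχ.le_of_mem_tsupport hx']⟩
  · filter_upwards [hper r hr.memH1.periodic] with x hx
    rcases lt_or_ge x.2 1 with h | h
    · simp only [hx h]
    · simp only [(hzero _ h).1, zero_mul]
  · filter_upwards [hper r hr.memH1.periodic, hper R hr.memH1.periodic_grad] with x hx hx'
    rcases lt_or_ge x.2 1 with h | h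
    · simp only [hx h, hx' h]
    · simp only [(hzero _ h).1, (hzero _ h).2, zero_mul, zero_smul]
  · refine memLp_restrict_of_eq_zero (measurableSet_roughCell hf ε L)
      ((hχ.memLp_smul hr.memH1.memLp_grad).add (memLp_prodMk (MemLp.zero (ε := ℝ))
        (hχ.memLp_deriv_mul hM hr.memH1.memLp))) (measurableSet_periodCell hwo L) fun x hx hxr => ?_
    have h : 1 ≤ x.2 := by
      by_contra hcon
      exact hxr ⟨⟨hx.1, not_le.1 hcon⟩, hx.2⟩
    simp only [(hzero _ h).1, (hzero _ h).2, zero_mul, zero_smul]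
    ext <;> simp
  · refine hr.trace_wall.congr_layer (d₀ := 1 / 2) (by norm_num) fun s t ht => ?_
    simp only
    rw [hχ.eq_one _ (by linarith [hf.wall_neg hε s, ht.2]), one_mul]

end WallLaw

namespace WallLaw

variable {u v w b r : ℝ × ℝ → ℝ} {G H R g : ℝ × ℝ → ℝ × ℝ} {f b₀ χ : ℝ → ℝ} {L ε : ℝ}

/-! ### The energy estimate -/

lemma lintegral_enorm_sq_eq {μ : Measure (ℝ × ℝ)} (hw : MemLp w 2 μ) :
    ∫⁻ x, ‖w x‖ₑ ^ 2 ∂μ = ENNReal.ofReal (∫ x, w x ^ 2 ∂μ) := by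
  rw [ofReal_integral_eq_lintegral_ofReal hw.integrable_sq (ae_of_all _ fun x => sq_nonneg _)]
  refine lintegral_congr fun x => ?_
  rw [Real.enorm_eq_ofReal_abs, ← ENNReal.ofReal_pow (abs_nonneg _), sq_abs]

lemma eLpNorm_two_le {μ : Measure (ℝ × ℝ)} (hw : MemLp w 2 μ) {B : ℝ} (hB : 0 ≤ B)
    (h : ∫ x, w x ^ 2 ∂μ ≤ B ^ 2) : eLpNorm w 2 μ ≤ ENNReal.ofReal B := by
  rw [eLpNorm_eq_lintegral_rpow_enorm_toReal two_ne_zero ENNReal.ofNat_ne_top]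
  simp only [ENNReal.toReal_ofNat, ENNReal.rpow_ofNat]
  rw [lintegral_enorm_sq_eq hw]
  calc ENNReal.ofReal (∫ x, w x ^ 2 ∂μ) ^ (1 / 2 : ℝ)
      ≤ ENNReal.ofReal (B ^ 2) ^ (1 / 2 : ℝ) := by gcongr
    _ = ENNReal.ofReal B := by
        rw [ENNReal.ofReal_rpow_of_nonneg (by positivity) (by norm_num), ← Real.sqrt_eq_rpow,
          Real.sqrt_sq hB]

/-- Poincaré's inequality on `Ω⁰` uses only the zero trace at the top, so the energy on the rough
cell controls the norm on `Ω⁰` with constant `1`. -/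
lemma MemRough.smooth_poincare (hf : IsRoughProfile f) (hε : 0 < ε) (hr : MemRough f L ε r R) :
    ∫ x in periodCell smoothDomain L, r x ^ 2 ≤
      ∫ x in periodCell (roughDomain f ε) L, ((R x).1 ^ 2 + (R x).2 ^ 2) := by
  have hle := Measure.restrict_mono (μ := volume) (smoothCell_subset hf hε (L := L)) le_rfl
  have hR := hr.memH1.memLp_grad.mono_measure hle
  have hr2 := hr.memH1.memLp.mono_measure hle
  have h1 := strip_poincare (M := 0) (h := fun _ => 0) le_rfl continuous_const (fun _ => le_rfl)
    (by simp) (hr.memH1.isWeakGradient.mono (D₁ := smoothDomain) fun x hx =>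
      ⟨(hf.wall_neg hε x.1).trans hx.1, hx.2⟩) hR hr.trace_top
  rw [← smoothDomain_eq, lintegral_enorm_sq_eq hr2, lintegral_enorm_sq_eq hR.snd, add_zero, one_pow,
    ENNReal.ofReal_one, one_mul,
    ENNReal.ofReal_le_ofReal_iff (integral_nonneg fun x => sq_nonneg _)] at h1
  refine h1.trans ?_
  have i1 := hr.memH1.memLp_grad.fst.integrable_sq
  have i2 := hr.memH1.memLp_grad.snd.integrable_sq
  calc ∫ x in periodCell smoothDomain L, (R x).2 ^ 2
      ≤ ∫ x in periodCell (roughDomain f ε) L, (R x).2 ^ 2 :=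
        setIntegral_mono_set i2 (ae_of_all _ fun x => sq_nonneg _)
          (smoothCell_subset hf hε).eventuallyLE
    _ ≤ _ := integral_mono i2 (i1.add i2) fun x => by
        simp only [Pi.add_apply]; nlinarith [sq_nonneg (R x).1]

lemma integrable_dirichlet {A : Set (ℝ × ℝ)} (hG : MemLp G 2 (volume.restrict A))
    (hH : MemLp H 2 (volume.restrict A)) :
    Integrable (fun x => (G x).1 * (H x).1 + (G x).2 * (H x).2) (volume.restrict A) :=
  (hG.fst.integrable_mul hH.fst).add (hG.snd.integrable_mul hH.snd)

lemma dirichletForm_add_left {A : Set (ℝ × ℝ)} (hG : MemLp G 2 (volume.restrict A))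
    (hH : MemLp H 2 (volume.restrict A)) (hR : MemLp R 2 (volume.restrict A)) :
    dirichletForm A (fun x => G x + H x) R = dirichletForm A G R + dirichletForm A H R := by
  unfold dirichletForm
  rw [← integral_add (integrable_dirichlet hG hR) (integrable_dirichlet hH hR)]
  congr 1; ext x
  simp only [Prod.fst_add, Prod.snd_add]
  ring

lemma dirichletForm_smul_left (A : Set (ℝ × ℝ)) (c : ℝ) (G R : ℝ × ℝ → ℝ × ℝ) :
    dirichletForm A (fun x => c • G x) R = c * dirichletForm A G R := by
  unfold dirichletForm
  rw [← integral_const_mul]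
  congr 1; ext x
  simp only [Prod.smul_fst, Prod.smul_snd, smul_eq_mul]
  ring

/-- The pairing with a cut off corrector only sees the region where the cutoff varies. -/
lemma IsCorrector.dirichletForm_cutoff {K M : ℝ} (hf : IsRoughProfile f) (hε : 0 < ε) (hM : 0 ≤ M)
    (hb : IsCorrector f L ε K b₀ b g) (hχ : IsTopCutoff M χ) (hr : MemRough f L ε r R) :
    dirichletForm (periodCell (roughDomain f ε) L)
        (fun x => χ x.2 • g x + (0, deriv χ x.2 * b x)) R =
      ∫ x in Ioo 0 L ×ˢ Ioo (1 / 2) 1, deriv χ x.2 * (b x * (R x).2 - (g x).2 * r x) := by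
  obtain ⟨hv, hvt⟩ := hr.cutoff hf hε hM hχ
  have h0 := hb.harmonic _ _ hv hvt
  set A := periodCell (roughDomain f ε) L
  have hAm : MeasurableSet A := measurableSet_roughCell hf ε L
  have hle := Measure.restrict_mono (μ := volume) (roughCell_subset (f := f) (ε := ε) (L := L)) le_rfl
  have h1 : dirichletForm A g (fun x => χ x.2 • R x + (0, deriv χ x.2 * r x)) = 0 := by
    refine Eq.trans ?_ h0
    unfold dirichletForm
    refine (setIntegral_eq_of_subset_of_forall_sdiff_eq_zero
      (measurableSet_periodCell (isOpen_cellDomain (hf.continuous_wall ε)) L) roughCell_subset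
      fun x hx => ?_).symm
    have h : 1 ≤ x.2 := by
      by_contra hcon
      exact hx.2 ⟨⟨hx.1.1, not_le.1 hcon⟩, hx.1.2⟩
    simp [hχ.eq_zero _ (by linarith : 3 / 4 ≤ x.2), hχ.deriv_eq_zero' _ (by linarith : 3 / 4 < x.2)]
  have hgA := hb.memD12.memLp_grad.mono_measure hle
  have hcA := hv.memLp_grad.mono_measure hle
  -- Subtracting the vanishing pairing of `g` with the cut-off `r` cancels the products weighted by
  -- `χ`. Only the commutator with `χ'` survives.
  have h2 : dirichletForm A (fun x => χ x.2 • g x + (0, deriv χ x.2 * b x)) R =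
      dirichletForm A (fun x => χ x.2 • g x + (0, deriv χ x.2 * b x)) R -
        dirichletForm A g (fun x => χ x.2 • R x + (0, deriv χ x.2 * r x)) := by rw [h1, sub_zero]
  rw [h2]
  unfold dirichletForm
  rw [← integral_sub (integrable_dirichlet (hb.memLp_grad_cutoff hf hM hχ) hr.memH1.memLp_grad)
    (integrable_dirichlet hgA hcA)]
  have hsub : Ioo 0 L ×ˢ Ioo (1 / 2 : ℝ) 1 ⊆ A := fun x hx =>
    ⟨⟨(hf.wall_neg hε x.1).trans (by linarith [hx.2.1]), hx.2.2⟩, hx.1⟩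
  rw [← setIntegral_eq_of_subset_of_forall_sdiff_eq_zero hAm hsub (f := fun x =>
    deriv χ x.2 * (b x * (R x).2 - (g x).2 * r x))]
  · congr 1; ext x
    simp only [Prod.fst_add, Prod.snd_add, Prod.smul_fst, Prod.smul_snd, smul_eq_mul]
    ring
  · intro x hx
    have h : x.2 ≤ 1 / 2 := by
      by_contra hcon
      exact hx.2 ⟨hx.1.2, not_le.1 hcon, hx.1.1.2⟩
    rw [hχ.deriv_eq_zero _ h, zero_mul]

/-- Where the cutoff varies, `b` and `g` have squared norms at most `K ε`, while `r` and `R` are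
bounded by the energy. The energy carries the factor `1/4` so that two correctors together use up
only half of it. -/
lemma IsCorrector.mul_dirichletForm_le {K M : ℝ} (hf : IsRoughProfile f) (hε : 0 < ε) (hM : 0 ≤ M)
    (hb : IsCorrector f L ε K b₀ b g) (hχ : IsTopCutoff M χ) (hr : MemRough f L ε r R) (c : ℝ) :
    c * dirichletForm (periodCell (roughDomain f ε) L)
        (fun x => χ x.2 • g x + (0, deriv χ x.2 * b x)) R ≤
      1 / 4 * (∫ x in periodCell (roughDomain f ε) L, ((R x).1 ^ 2 + (R x).2 ^ 2)) +
        4 * c ^ 2 * M ^ 2 * (K * ε) := by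
  rw [hb.dirichletForm_cutoff hf hε hM hχ hr]
  set A := periodCell (roughDomain f ε) L
  set S := periodCell smoothDomain L
  set B := Ioo 0 L ×ˢ Ioo (1 / 2 : ℝ) 1
  have hBS : B ⊆ S := fun x hx => ⟨⟨by linarith [hx.2.1], hx.2.2⟩, hx.1⟩
  have hSA : S ⊆ A := smoothCell_subset hf hε
  have hBI : B ⊆ Ioo 0 L ×ˢ Ioi (1 / 2 : ℝ) := fun x hx => ⟨hx.1, hx.2.1⟩
  have hIW : Ioo 0 L ×ˢ Ioi (1 / 2 : ℝ) ⊆ periodCell (cellDomain (wall f ε)) L := fun x hx =>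
    ⟨(hf.wall_neg hε x.1).trans (lt_trans (by norm_num) hx.2), hx.1⟩
  have hRA := hr.memH1.memLp_grad
  have iR : IntegrableOn (fun x => (R x).1 ^ 2 + (R x).2 ^ 2) A :=
    hRA.fst.integrable_sq.add hRA.snd.integrable_sq
  have ir : IntegrableOn (fun x => r x ^ 2) S :=
    (hr.memH1.memLp.mono_measure (Measure.restrict_mono hSA le_rfl)).integrable_sq
  have ib : IntegrableOn (fun x => b x ^ 2) S := hb.memLp.integrable_sq
  have ig : IntegrableOn (fun x => (g x).1 ^ 2 + (g x).2 ^ 2) (Ioo 0 L ×ˢ Ioi (1 / 2 : ℝ)) := by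
    have hgI := hb.memD12.memLp_grad.mono_measure (Measure.restrict_mono hIW le_rfl)
    exact hgI.fst.integrable_sq.add hgI.snd.integrable_sq
  have jR := iR.mono_set (hBS.trans hSA)
  have jr := ir.mono_set hBS
  have jb := ib.mono_set hBS
  have jg := ig.mono_set hBI
  have mR : ∫ x in B, ((R x).1 ^ 2 + (R x).2 ^ 2) ≤ ∫ x in A, ((R x).1 ^ 2 + (R x).2 ^ 2) :=
    setIntegral_mono_set iR (ae_of_all _ fun x => by positivity) (hBS.trans hSA).eventuallyLE
  have mr : ∫ x in B, r x ^ 2 ≤ ∫ x in A, ((R x).1 ^ 2 + (R x).2 ^ 2) :=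
    (setIntegral_mono_set ir (ae_of_all _ fun x => sq_nonneg _) hBS.eventuallyLE).trans
      (hr.smooth_poincare hf hε)
  have mb : ∫ x in B, b x ^ 2 ≤ K * ε :=
    (setIntegral_mono_set ib (ae_of_all _ fun x => sq_nonneg _) hBS.eventuallyLE).trans hb.sq_le
  have mg : ∫ x in B, ((g x).1 ^ 2 + (g x).2 ^ 2) ≤ K * ε :=
    (setIntegral_mono_set ig (ae_of_all _ fun x => by positivity) hBI.eventuallyLE).trans
      hb.grad_sq_le
  have hRB := hRA.mono_measure (Measure.restrict_mono (hBS.trans hSA) le_rfl)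
  have hrB := hr.memH1.memLp.mono_measure (Measure.restrict_mono (hBS.trans hSA) le_rfl)
  have hbB := hb.memLp.mono_measure (Measure.restrict_mono hBS le_rfl)
  have hgB := hb.memD12.memLp_grad.mono_measure (Measure.restrict_mono (hBI.trans hIW) le_rfl)
  have jL : Integrable (fun x => deriv χ x.2 * (b x * (R x).2 - (g x).2 * r x))
      (volume.restrict B) := by
    have i1 := (hχ.memLp_deriv_mul hM hbB).integrable_mul hRB.snd
    have i2 := (hχ.memLp_deriv_mul hM hrB).integrable_mul hgB.snd
    refine (i1.sub i2).congr (ae_of_all _ fun x => ?_)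
    simp only [Pi.sub_apply, Pi.mul_apply]
    ring
  -- The Young constant dual to `1/8`: `x y ≤ x²/8 + 2 y²`, applied to each of the two products.
  set c2 := 2 * c ^ 2 * M ^ 2
  have hc2 : 0 ≤ c2 := by positivity
  have j1 : Integrable (fun x => 1 / 8 * ((R x).1 ^ 2 + (R x).2 ^ 2) + 1 / 8 * r x ^ 2)
      (volume.restrict B) := (jR.const_mul _).add (jr.const_mul _)
  have j2 : Integrable (fun x => c2 * b x ^ 2 + c2 * ((g x).1 ^ 2 + (g x).2 ^ 2))
      (volume.restrict B) := (jb.const_mul _).add (jg.const_mul _)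
  rw [← integral_const_mul]
  calc ∫ x in B, c * (deriv χ x.2 * (b x * (R x).2 - (g x).2 * r x))
      ≤ ∫ x in B, ((1 / 8 * ((R x).1 ^ 2 + (R x).2 ^ 2) + 1 / 8 * r x ^ 2) +
          (c2 * b x ^ 2 + c2 * ((g x).1 ^ 2 + (g x).2 ^ 2))) := by
        refine integral_mono (jL.const_mul c) (j1.add j2) fun x => ?_
        have hd : deriv χ x.2 ^ 2 ≤ M ^ 2 := by
          rw [← sq_abs]
          exact pow_le_pow_left₀ (abs_nonneg _) (hχ.abs_deriv_le _) 2
        set d := deriv χ x.2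
        have e1 : c ^ 2 * d ^ 2 * b x ^ 2 ≤ c ^ 2 * M ^ 2 * b x ^ 2 := by gcongr
        have e2 : c ^ 2 * d ^ 2 * (g x).2 ^ 2 ≤ c ^ 2 * M ^ 2 * (g x).2 ^ 2 := by gcongr
        have e3 : 0 ≤ c ^ 2 * M ^ 2 * (g x).1 ^ 2 := by positivity
        simp only [c2]
        nlinarith [sq_nonneg ((R x).2 - 4 * (c * d * b x)), sq_nonneg (r x + 4 * (c * d * (g x).2)),
          sq_nonneg (R x).1]
    _ = (1 / 8 * (∫ x in B, ((R x).1 ^ 2 + (R x).2 ^ 2)) + 1 / 8 * ∫ x in B, r x ^ 2) +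
          (c2 * (∫ x in B, b x ^ 2) + c2 * ∫ x in B, ((g x).1 ^ 2 + (g x).2 ^ 2)) := by
        rw [integral_add j1 j2, integral_add (jR.const_mul _) (jr.const_mul _),
          integral_add (jb.const_mul _) (jg.const_mul _), integral_const_mul, integral_const_mul,
          integral_const_mul, integral_const_mul]
    _ ≤ _ := by
        have e1 := mul_le_mul_of_nonneg_left mb hc2
        have e2 := mul_le_mul_of_nonneg_left mg hc2
        simp only [c2] at *
        linarith

/-- Comparison of the rough solution with a quadratic profile that matches two correctors on the
wall. -/
theorem rough_sub_profile_sq_le {C a c₁ c₂ K₁ K₂ M : ℝ} {b₁ b₂ : ℝ × ℝ → ℝ}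
    {g₁ g₂ : ℝ × ℝ → ℝ × ℝ} {k₁ k₂ : ℝ → ℝ} (hf : IsRoughProfile f) (hε : 0 < ε) (hM : 0 ≤ M)
    (hχ : IsTopCutoff M χ) (hb₁ : IsCorrector f L ε K₁ k₁ b₁ g₁)
    (hb₂ : IsCorrector f L ε K₂ k₂ b₂ g₂)
    (hmatch : ∀ s, profile C a (wall f ε s) + c₁ * k₁ s + c₂ * k₂ s = 0)
    (hu : IsRoughSolution f L C ε u) :
    MemLp (fun x => u x - profile C a x.2) 2 (volume.restrict (periodCell smoothDomain L)) ∧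
      ∫ x in periodCell smoothDomain L, (u x - profile C a x.2) ^ 2 ≤
        3 * (8 * M ^ 2 + 1) * ε * (c₁ ^ 2 * K₁ + c₂ ^ 2 * K₂) := by
  obtain ⟨G, hG, hsol⟩ := hu
  set A := periodCell (roughDomain f ε) L
  set S := periodCell smoothDomain L
  have hP := memStrip_profile hf hε L C a
  have hB₁ := hb₁.memStrip hf hε hM hχ
  have hB₂ := hb₂.memStrip hf hε hM hχ
  set P : ℝ × ℝ → ℝ × ℝ := fun x => (0, deriv (profile C a) x.2) with hPdef
  set Q₁ : ℝ × ℝ → ℝ × ℝ := fun x => χ x.2 • g₁ x + (0, deriv χ x.2 * b₁ x)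
  set Q₂ : ℝ × ℝ → ℝ × ℝ := fun x => χ x.2 • g₂ x + (0, deriv χ x.2 * b₂ x)
  -- `hmatch` makes the remainder vanish on the wall, so it is admissible as a test function in the
  -- equation of the rough solution and for the correctors.
  have hr := (((hG.memStrip.add hf hε (hP.const_mul (-1))).add hf hε (hB₁.const_mul (-c₁))).add hf hε
    (hB₂.const_mul (-c₂))).memRough hf hε fun s => by
      have := hmatch s
      simp only [Pi.zero_apply]
      linarith
  set r : ℝ × ℝ → ℝ := fun x => u x + -1 * profile C a x.2 + -c₁ * (χ x.2 * b₁ x) +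
    -c₂ * (χ x.2 * b₂ x) with hrdef
  set R : ℝ × ℝ → ℝ × ℝ := fun x => G x + (-1 : ℝ) • P x + (-c₁) • Q₁ x + (-c₂) • Q₂ x with hRdef
  have hRm := hr.memH1.memLp_grad
  have mG := hG.memH1.memLp_grad
  have mP := hP.memD12.memLp_grad
  have m1 := hB₁.memD12.memLp_grad
  have m2 := hB₂.memD12.memLp_grad
  set X := ∫ x in A, ((R x).1 ^ 2 + (R x).2 ^ 2) with hX
  have eX : X = dirichletForm A R R := by
    rw [hX]; unfold dirichletForm
    congr 1; ext x; ring
  have e0 : dirichletForm A R R = dirichletForm A G R + -1 * dirichletForm A P R +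
      -c₁ * dirichletForm A Q₁ R + -c₂ * dirichletForm A Q₂ R := by
    have n1 : MemLp (fun x => (-1 : ℝ) • P x) 2 (volume.restrict A) := mP.const_smul (-1 : ℝ)
    have n2 : MemLp (fun x => (-c₁) • Q₁ x) 2 (volume.restrict A) := m1.const_smul (-c₁)
    have n3 : MemLp (fun x => (-c₂) • Q₂ x) 2 (volume.restrict A) := m2.const_smul (-c₂)
    have n4 : MemLp (fun x => G x + (-1 : ℝ) • P x) 2 (volume.restrict A) := mG.add n1
    have n5 : MemLp (fun x => G x + (-1 : ℝ) • P x + (-c₁) • Q₁ x) 2 (volume.restrict A) :=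
      n4.add n2
    rw [← dirichletForm_smul_left, ← dirichletForm_smul_left, ← dirichletForm_smul_left,
      ← dirichletForm_add_left mG n1 hRm, ← dirichletForm_add_left n4 n2 hRm,
      ← dirichletForm_add_left n5 n3 hRm]
  have e1 : dirichletForm A G R = ∫ x in A, C * r x := hsol r R hr
  -- The profile solves the same equation, and the boundary terms vanish with the traces of `r`;
  -- hence the source cancels from the energy of the remainder.
  have e2 : dirichletForm A P R = ∫ x in A, C * r x := by
    have hgreen := strip_green hε.le (hf.continuous_wall ε) (fun s => (hf.wall_neg hε s).le)
      (hf.le_wall hε) hr.memH1.isWeakGradient hr.memH1.memLp_grad hr.trace_top hr.trace_wall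
      (C / 2 * (1 - a)) C
    simp only [Pi.zero_apply, mul_zero, integral_zero, sub_zero] at hgreen
    rw [← roughDomain_eq] at hgreen
    rw [← hgreen]
    unfold dirichletForm
    simp only [hPdef, deriv_profile, zero_mul, zero_add]
    rfl
  have e3 := hb₁.mul_dirichletForm_le hf hε hM hχ hr (-c₁)
  have e4 := hb₂.mul_dirichletForm_le hf hε hM hχ hr (-c₂)
  -- Absorbing half of `X` doubles the constant `4` to `8`.
  have hXle : X ≤ 8 * M ^ 2 * ε * (c₁ ^ 2 * K₁ + c₂ ^ 2 * K₂) := by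
    have : X ≤ 1 / 4 * X + 4 * (-c₁) ^ 2 * M ^ 2 * (K₁ * ε) +
        (1 / 4 * X + 4 * (-c₂) ^ 2 * M ^ 2 * (K₂ * ε)) := by
      calc X = -c₁ * dirichletForm A Q₁ R + -c₂ * dirichletForm A Q₂ R := by
            rw [eX, e0, e1, e2]; ring
        _ ≤ _ := add_le_add e3 e4
    nlinarith
  have hrS : ∫ x in S, r x ^ 2 ≤ X := hr.smooth_poincare hf hε
  have hle := Measure.restrict_mono (μ := volume) (smoothCell_subset hf hε (L := L)) le_rfl
  have mrS := hr.memH1.memLp.mono_measure hle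
  have mw : MemLp (fun x => u x - profile C a x.2) 2 (volume.restrict S) :=
    (hG.memH1.memLp.mono_measure hle).sub (memLp_comp_snd (h := fun _ => 0) (M := 0)
      (contDiff_profile C a).continuous (by simp) continuous_const)
  refine ⟨mw, ?_⟩
  have i1 := mrS.integrable_sq
  have i2 := hb₁.memLp.integrable_sq
  have i3 := hb₂.memLp.integrable_sq
  have i4 : Integrable (fun x => 3 * r x ^ 2 + 3 * c₁ ^ 2 * b₁ x ^ 2) (volume.restrict S) :=
    (i1.const_mul _).add (i2.const_mul _)
  -- The difference is the sum of `r` and the two cut-off correctors, whence the factor `3`. The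
  -- correctors account for the `+ 1` in the final constant.
  have key : ∫ x in S, (u x - profile C a x.2) ^ 2 ≤ 3 * (∫ x in S, r x ^ 2) +
      3 * c₁ ^ 2 * (∫ x in S, b₁ x ^ 2) + 3 * c₂ ^ 2 * ∫ x in S, b₂ x ^ 2 := by
    rw [← integral_const_mul, ← integral_const_mul, ← integral_const_mul,
      ← integral_add (i1.const_mul _) (i2.const_mul _), ← integral_add i4 (i3.const_mul _)]
    refine integral_mono mw.integrable_sq (i4.add (i3.const_mul _)) fun x => ?_
    have hc0 := hχ.nonneg x.2
    have hc1 := hχ.le_one x.2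
    have hc2 : χ x.2 ^ 2 ≤ 1 := by nlinarith
    have q1 : (c₁ * (χ x.2 * b₁ x)) ^ 2 ≤ c₁ ^ 2 * b₁ x ^ 2 := by
      have := mul_le_mul_of_nonneg_left hc2 (by positivity : 0 ≤ c₁ ^ 2 * b₁ x ^ 2)
      nlinarith
    have q2 : (c₂ * (χ x.2 * b₂ x)) ^ 2 ≤ c₂ ^ 2 * b₂ x ^ 2 := by
      have := mul_le_mul_of_nonneg_left hc2 (by positivity : 0 ≤ c₂ ^ 2 * b₂ x ^ 2)
      nlinarith
    have q3 : u x - profile C a x.2 = r x + c₁ * (χ x.2 * b₁ x) + c₂ * (χ x.2 * b₂ x) := by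
      simp only [hrdef]; ring
    simp only
    rw [q3]
    set y₁ := c₁ * (χ x.2 * b₁ x)
    set y₂ := c₂ * (χ x.2 * b₂ x)
    nlinarith [sq_nonneg (r x - y₁), sq_nonneg (r x - y₂), sq_nonneg (y₁ - y₂)]
  have s1 := mul_le_mul_of_nonneg_left hb₁.sq_le (by positivity : 0 ≤ 3 * c₁ ^ 2)
  have s2 := mul_le_mul_of_nonneg_left hb₂.sq_le (by positivity : 0 ≤ 3 * c₂ ^ 2)
  nlinarith

end WallLaw

namespace WallLaw

variable {u : ℝ × ℝ → ℝ} {L : ℝ}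

/-! ### Comparison of two profiles -/

lemma volume_smoothCell (hL : 0 ≤ L) : (volume (periodCell smoothDomain L)).toReal = L := by
  have : periodCell smoothDomain L = Ioo 0 L ×ˢ Ioo (0 : ℝ) 1 := by
    ext x; exact and_comm
  rw [this, Measure.volume_eq_prod, Measure.prod_prod, Real.volume_Ioo, Real.volume_Ioo]
  simp [hL]

/-- Two profiles differ by `C/2 (1 - t) (a - a₁)`, at most `|C/2| |a - a₁|` in absolute value on a
cell of area `L`. This carries the estimate over from the second-order profile to the first-order
one. -/
lemma sub_profile_sq_le (hL : 0 ≤ L) {C a : ℝ} (a₁ : ℝ)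
    (hmem : MemLp (fun x => u x - profile C a x.2) 2
      (volume.restrict (periodCell smoothDomain L))) :
    MemLp (fun x => u x - profile C a₁ x.2) 2 (volume.restrict (periodCell smoothDomain L)) ∧
      ∫ x in periodCell smoothDomain L, (u x - profile C a₁ x.2) ^ 2 ≤
        2 * (∫ x in periodCell smoothDomain L, (u x - profile C a x.2) ^ 2) +
          L * (2 * ((C / 2) ^ 2 * (a - a₁) ^ 2)) := by
  set S := periodCell smoothDomain L
  have e : ∀ x : ℝ × ℝ, u x - profile C a₁ x.2 =
      u x - profile C a x.2 + C / 2 * (1 - x.2) * (a - a₁) := fun x => by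
    simp only [profile]; ring
  have hmem₁ : MemLp (fun x : ℝ × ℝ => C / 2 * (1 - x.2) * (a - a₁)) 2 (volume.restrict S) :=
    memLp_comp_snd (h := fun _ => 0) (P := fun t => C / 2 * (1 - t) * (a - a₁)) (M := 0)
      (by fun_prop) (by simp) continuous_const
  have hfin : IsFiniteMeasure (volume.restrict S) := ⟨by
    rw [Measure.restrict_apply_univ]
    exact volume_periodCell_strip_lt_top (h := fun _ => 0) (M := 0) (by simp)⟩
  have hadd : MemLp (fun x => u x - profile C a₁ x.2) 2 (volume.restrict S) := by
    simp only [e]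
    exact hmem.add hmem₁
  refine ⟨hadd, ?_⟩
  have i1 := hmem.integrable_sq.const_mul 2
  have i2 : Integrable (fun _ : ℝ × ℝ => 2 * ((C / 2) ^ 2 * (a - a₁) ^ 2)) (volume.restrict S) :=
    integrable_const _
  calc ∫ x in S, (u x - profile C a₁ x.2) ^ 2
      ≤ ∫ x in S, (2 * (u x - profile C a x.2) ^ 2 + 2 * ((C / 2) ^ 2 * (a - a₁) ^ 2)) := by
        refine setIntegral_mono_on hadd.integrable_sq (i1.add i2)
          (measurableSet_smoothCell L) fun x hx => ?_
        have hx0 : 0 < x.2 := hx.1.1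
        have hx1 : x.2 < 1 := hx.1.2
        have h1 : (C / 2 * (1 - x.2) * (a - a₁)) ^ 2 ≤ (C / 2) ^ 2 * (a - a₁) ^ 2 := by
          have h2 : (1 - x.2) ^ 2 ≤ 1 := pow_le_one₀ (by linarith) (by linarith)
          rw [mul_pow, mul_pow]
          exact mul_le_mul_of_nonneg_right (mul_le_of_le_one_right (sq_nonneg _) h2) (sq_nonneg _)
        rw [e]
        generalize C / 2 * (1 - x.2) * (a - a₁) = y at h1
        nlinarith [sq_nonneg (u x - profile C a x.2 - y)]
    _ = 2 * (∫ x in S, (u x - profile C a x.2) ^ 2) + L * (2 * ((C / 2) ^ 2 * (a - a₁) ^ 2)) := by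
        rw [integral_add i1 i2, integral_const_mul, setIntegral_const, measureReal_def,
          volume_smoothCell hL, smul_eq_mul]

end WallLaw

end

/-! ### Matching on the wall and the final estimate -/

theorem mainTheorem2 (f : ℝ → ℝ) (hf : WallLaw.IsRoughProfile f)
    (L C : ℝ) (hL : 0 < L)
    (β γ : ℝ × ℝ → ℝ) (mβ mγ : ℝ)
    (hβ : WallLaw.IsCellSolution f (fun y₂ => -y₂) β)
    (hmβ : WallLaw.IsInterfaceMean β mβ)
    (hγ : WallLaw.IsCellSolution f (fun y₂ => -y₂ ^ 2) γ)
    (hmγ : WallLaw.IsInterfaceMean γ mγ) :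
    ∃ K : ℝ, ∀ (ε : ℝ) (N : ℕ), 0 < ε → L = 2 * Real.pi * ε * N →
      ∀ u : ℝ × ℝ → ℝ, WallLaw.IsRoughSolution f L C ε u →
        (∀ u₁ : ℝ × ℝ → ℝ, WallLaw.IsRobinSolution L C ε mβ u₁ →
          MeasureTheory.eLpNorm (fun x => u x - u₁ x) 2
              (MeasureTheory.volume.restrict (WallLaw.periodCell WallLaw.smoothDomain L))
            ≤ ENNReal.ofReal (K * ε ^ (3 / 2 : ℝ))) ∧
        (∀ u₂ : ℝ × ℝ → ℝ, WallLaw.IsWentzellSolution L C ε mβ mγ u₂ →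
          MeasureTheory.eLpNorm (fun x => u x - u₂ x) 2
              (MeasureTheory.volume.restrict (WallLaw.periodCell WallLaw.smoothDomain L))
            ≤ ENNReal.ofReal (K * ε ^ (3 / 2 : ℝ))) := by
  have hβ' := hβ
  have hγ' := hγ
  obtain ⟨Gβ, hβm, hβt, hβe⟩ := hβ'
  obtain ⟨Gγ, hγm, hγt, hγe⟩ := hγ'
  have hm : 0 < mβ := WallLaw.interfaceMean_pos hf hβm hβe hmβ hβt
  have hn : mγ ≤ 0 := WallLaw.interfaceMean_nonpos hf hγm hγe hmγ hγt
    fun s => neg_nonpos.2 (sq_nonneg _)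
  obtain ⟨K₁, hK₁, hc₁⟩ := WallLaw.exists_isCorrector hf hL continuous_neg hβ hmβ
  obtain ⟨K₂, hK₂, hc₂⟩ := WallLaw.exists_isCorrector hf hL (by fun_prop) hγ hmγ
  obtain ⟨M, χ, hM, hχ⟩ := WallLaw.exists_isTopCutoff
  have hpi := Real.pi_pos
  -- `e` bounds every admissible `ε`: `N = 0` would force `L = 0`, so `N ≥ 1`. Surplus powers of `ε`
  -- are replaced by powers of `e`, which makes the constant uniform over all `ε`, not just small
  -- ones.
  obtain ⟨e, he⟩ : ∃ e, e = L / (2 * Real.pi) := ⟨_, rfl⟩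
  have he0 : 0 < e := by rw [he]; positivity
  obtain ⟨Q, hQ⟩ : ∃ Q, Q = 3 * (8 * M ^ 2 + 1) * (C / 2) ^ 2 *
    ((1 + (e * mβ - e ^ 2 * mγ)) ^ 2 * K₁ + e ^ 2 * K₂) := ⟨_, rfl⟩
  have hQ0 : 0 ≤ Q := by rw [hQ]; positivity
  -- `Q` serves the Wentzell law; the extra term pays for the distance between the two profiles.
  obtain ⟨Q', hQ'⟩ : ∃ Q', Q' = 2 * Q + 2 * L * (C / 2) ^ 2 * mγ ^ 2 * e := ⟨_, rfl⟩
  have hQQ' : Q ≤ Q' := by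
    have : 0 ≤ 2 * L * (C / 2) ^ 2 * mγ ^ 2 * e := by positivity
    linarith
  have hQ'0 : 0 ≤ Q' := hQ0.trans hQQ'
  refine ⟨√Q', fun ε N hε hLN u hu => ?_⟩
  have hεe : ε ≤ e := by
    have hN : (1 : ℝ) ≤ N := by
      rcases Nat.eq_zero_or_pos N with h | h
      · rw [h] at hLN; simp at hLN; linarith
      · exact_mod_cast h
    rw [he, le_div_iff₀ (by positivity), hLN]
    nlinarith [mul_pos hpi hε]
  have hp : 0 < 1 + ε * mβ := by positivity
  -- The parameter of the Wentzell profile, used as the reference for both laws because it matches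
  -- the correctors on the wall exactly.
  obtain ⟨a, ha⟩ : ∃ a, a = (ε * mβ - ε ^ 2 * mγ) / (1 + ε * mβ) := ⟨_, rfl⟩
  have ha' : a * (1 + ε * mβ) = ε * mβ - ε ^ 2 * mγ := by rw [ha]; field_simp
  have hnum : 0 ≤ ε * mβ - ε ^ 2 * mγ := by
    have := mul_nonneg (sq_nonneg ε) (neg_nonneg.2 hn)
    nlinarith [mul_pos hε hm]
  have ha0 : 0 ≤ a := by rw [ha]; positivity
  have ha1 : a ≤ e * mβ - e ^ 2 * mγ := by
    have h1 : a ≤ ε * mβ - ε ^ 2 * mγ := by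
      rw [← ha']; nlinarith [mul_nonneg ha0 (mul_pos hε hm).le]
    have h2 : ε ^ 2 ≤ e ^ 2 := by gcongr
    have h3 : ε * mβ ≤ e * mβ := by gcongr
    nlinarith
  have haQ : (1 - a) ^ 2 ≤ (1 + (e * mβ - e ^ 2 * mγ)) ^ 2 := by
    apply sq_le_sq' <;> linarith
  obtain ⟨b₁, g₁, hb₁⟩ := hc₁ ε N hε hLN
  obtain ⟨b₂, g₂, hb₂⟩ := hc₂ ε N hε hLN
  -- With these coefficients the terms in `f` and `f²` cancel on the wall, and `ha'` cancels the
  -- constants.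
  obtain ⟨hmem, hsq⟩ := WallLaw.rough_sub_profile_sq_le (a := a) (C := C)
    (c₁ := C / 2 * (1 - a) * ε) (c₂ := -(C / 2 * ε ^ 2)) hf hε hM hχ hb₁ hb₂
    (fun s => by
      simp only [WallLaw.profile, WallLaw.wall]
      linear_combination C / 2 * ha') hu
  have hsq' : ∫ x in WallLaw.periodCell WallLaw.smoothDomain L,
      (u x - WallLaw.profile C a x.2) ^ 2 ≤ Q * ε ^ 3 := by
    refine hsq.trans ?_
    have h1 : (C / 2 * (1 - a) * ε) ^ 2 * K₁ ≤
        (C / 2) ^ 2 * (1 + (e * mβ - e ^ 2 * mγ)) ^ 2 * ε ^ 2 * K₁ := by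
      rw [mul_pow, mul_pow]; gcongr
    have h2 : (-(C / 2 * ε ^ 2)) ^ 2 * K₂ ≤ (C / 2) ^ 2 * e ^ 2 * ε ^ 2 * K₂ := by
      have : (-(C / 2 * ε ^ 2)) ^ 2 = (C / 2) ^ 2 * ε ^ 2 * ε ^ 2 := by ring
      rw [this]; gcongr
    calc 3 * (8 * M ^ 2 + 1) * ε *
          ((C / 2 * (1 - a) * ε) ^ 2 * K₁ + (-(C / 2 * ε ^ 2)) ^ 2 * K₂)
        ≤ 3 * (8 * M ^ 2 + 1) * ε * ((C / 2) ^ 2 * (1 + (e * mβ - e ^ 2 * mγ)) ^ 2 * ε ^ 2 * K₁ +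
          (C / 2) ^ 2 * e ^ 2 * ε ^ 2 * K₂) := by gcongr
      _ = Q * ε ^ 3 := by rw [hQ]; ring
  have hB0 : 0 ≤ √Q' * ε ^ (3 / 2 : ℝ) := by positivity
  have hB : (√Q' * ε ^ (3 / 2 : ℝ)) ^ 2 = Q' * ε ^ 3 := by
    rw [mul_pow, Real.sq_sqrt hQ'0, ← Real.rpow_natCast (ε ^ (3 / 2 : ℝ)) 2, ← Real.rpow_mul hε.le,
      ← Real.rpow_natCast ε 3]
    norm_num
  constructor
  · intro u₁ hu₁
    have hae := hu₁.ae_eq hL hε hm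
    obtain ⟨a₁, ha₁⟩ : ∃ a₁, a₁ = ε * mβ / (1 + ε * mβ) := ⟨_, rfl⟩
    rw [← ha₁] at hae
    -- The parameters differ by `ε² mγ / (1 + ε mβ)` in absolute value, so the squared discrepancy
    -- is `O(ε⁴)`, below the required `ε³`.
    have hdiff : (a - a₁) ^ 2 ≤ mγ ^ 2 * ε ^ 4 := by
      have h1 : (a - a₁) * (1 + ε * mβ) = -(ε ^ 2 * mγ) := by
        rw [ha, ha₁]; field_simp; ring
      have h2 : (a - a₁) ^ 2 * (1 + ε * mβ) ^ 2 = mγ ^ 2 * ε ^ 4 := by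
        rw [← mul_pow, h1]; ring
      have h3 : 1 ≤ (1 + ε * mβ) ^ 2 := one_le_pow₀ (by linarith [mul_pos hε hm])
      rw [← h2]
      exact le_mul_of_one_le_right (sq_nonneg _) h3
    have hcong : (fun x => u x - u₁ x) =ᵐ[MeasureTheory.volume.restrict
        (WallLaw.periodCell WallLaw.smoothDomain L)] fun x => u x - WallLaw.profile C a₁ x.2 := by
      filter_upwards [hae] with x hx
      rw [hx]
    obtain ⟨hmem₁, hsq₁⟩ := WallLaw.sub_profile_sq_le hL.le a₁ hmem
    rw [MeasureTheory.eLpNorm_congr_ae hcong]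
    refine WallLaw.eLpNorm_two_le hmem₁ hB0 (hsq₁.trans ?_)
    rw [hB]
    calc 2 * (∫ x in WallLaw.periodCell WallLaw.smoothDomain L,
            (u x - WallLaw.profile C a x.2) ^ 2) + L * (2 * ((C / 2) ^ 2 * (a - a₁) ^ 2))
        ≤ 2 * (Q * ε ^ 3) + L * (2 * ((C / 2) ^ 2 * (mγ ^ 2 * ε ^ 4))) := by gcongr
      _ = 2 * (Q * ε ^ 3) + 2 * L * (C / 2) ^ 2 * mγ ^ 2 * (ε * ε ^ 3) := by ring
      _ ≤ 2 * (Q * ε ^ 3) + 2 * L * (C / 2) ^ 2 * mγ ^ 2 * (e * ε ^ 3) := by gcongr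
      _ = Q' * ε ^ 3 := by rw [hQ']; ring
  · intro u₂ hu₂
    have hae := hu₂.ae_eq hL hε hm hn
    rw [← ha] at hae
    have hcong : (fun x => u x - u₂ x) =ᵐ[MeasureTheory.volume.restrict
        (WallLaw.periodCell WallLaw.smoothDomain L)] fun x => u x - WallLaw.profile C a x.2 := by
      filter_upwards [hae] with x hx
      rw [hx]
    rw [MeasureTheory.eLpNorm_congr_ae hcong]
    refine WallLaw.eLpNorm_two_le hmem hB0 (hsq'.trans ?_)
    rw [hB]
    gcongr
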